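/- Let $k$ be a field of characteristic $\neq 2$; $\otimes=\otimes_k$, and signs $\pm$ in maps that permute homogeneous elements are Koszul signs. **DG coalgebras and forms.** A DG coalgebra is a $\mathbb Z$-graded $k$-vector space $C$ with a coassociative comultiplication $\Delta c=\sum c'\otimes c''$ and a counit $\eta$, both of degree $0$, and a differential $\delta$ of degree $+1$ with $\delta^2=0$, $\eta\delta=0$, which is a coderivation; morphisms are linear maps of degree $0$ compatible with $\Delta,\eta,\delta$. The tensor product $C\otimes D$ of two DG coalgebras is the DG coalgebra with $\delta=\delta\otimes1\pm1\otimes\delta$, counit $\eta\otimes\eta$ and comultiplication $R_{23}(\Delta\otimes\Delta)$, where $R_{23}$ is the signed exchange of the second and third factors; $\tau$ is the signed exchange on $C\otimes C$. Put $\Omega^nC=C\otimes\bar C^{\otimes n}$ with $\bar C=\ker\eta$, inside $C^{\otimes(n+1)}$, with the differential $\delta$ induced by that of $C$. Define $d(c\otimes m)=\eta(c)m$ and $$b(c)=\sum c'\otimes c''\mp c''\otimes c',\qquad b(x\otimes y)=\sum x'\otimes x''\otimes y-x\otimes y'\otimes y''\pm x''\otimes y\otimes x',$$ $$b(x\otimes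 y\otimes z)=\sum x'\otimes x''\otimes y\otimes z-x\otimes y'\otimes y''\otimes z+x\otimes y\otimes z'\otimes z''\mp x''\otimes y\otimes z\otimes x'.$$ Let $\Omega^1C_\natural=\ker(b|\Omega^1C)$, $\Omega^2C_\natural=\{\omega\in\Omega^2C: b\omega=0,\ bd\omega=0\}$ and $\dot\Omega^1C=\ker(2db+bd\,|\,\Omega^1C)$. **Supercomplexes.** A supercomplex is a $\mathbb Z/2$-graded vector space with an odd differential $\partial$, $\partial^2=0$; morphisms are even linear maps commuting with $\partial$, and $\partial(v\otimes w)=\partial v\otimes w+(-1)^{|v|}v\otimes\partial w$ on tensor products. Let $$\hat X(C)=C\oplus\Omega^1C_\natural,\qquad \partial(\omega_0+\omega_1)=(\delta\omega_0+d\omega_1)+(b\omega_0-\delta\omega_1),$$ $$\hat X^2(C)=C\oplus\Omega^2C_\natural\oplus\dot\Omega^1C,\qquad \partial(\omega_0+\omega_2+\omega_1)=(\delta\omega_0+d\omega_1)+(\delta\omega_2+b\omega_1)+(b\omega_0+2d\omega_2-\delta\omega_1),$$ where the parity of a homogeneous $n$-form is its degree plus $n$. These are supercomplexes, and $I(\omega_0+\omega_1)=\omega_0+0+\omega_1$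 is a morphism $I:\hat X(C)\to\hat X^2(C)$. **Bar construction.** Let $A$ be an associative, not necessarily unital $k$-algebra. $BA=\bigoplus_{n\ge0}A^{\otimes n}$, with words of length $n$ in degree $-n$, is the DG coalgebra with the deconcatenation coproduct, the counit $\eta$ given by projection onto $A^{\otimes 0}=k$, and the differential $b'(a_1,\dots,a_n)=\sum_{i=1}^{n-1}(-1)^{i-1}(a_1,\dots,a_ia_{i+1},\dots,a_n)$. Identify $\Omega^1BA\cong BA\otimes A\otimes BA$ by $$\alpha\otimes(b_1,\dots,b_m)\mapsto\alpha\otimes b_1\otimes(b_2,\dots,b_m)-(\alpha_1,\dots,\alpha_{n-1})\otimes\alpha_n\otimes(b_1,\dots,b_m)$$ for $\alpha=(\alpha_1,\dots,\alpha_n)$ (the second term is $0$ if $n=0$). Identify $A\otimes BA\cong\Omega^1BA_\natural$ by $a\otimes\gamma\mapsto\sum\pm\gamma''\otimes a\otimes\gamma'$, where $\Delta\gamma=\sum\gamma'\otimes\gamma''$ and $a$ has degree $-1$. Let $\theta:\Omega^1BA\to\Omega^1BA_\natural$ be $\theta(\alpha\otimes a\otimes\beta)=\eta(\alpha)\,a\otimes\beta$,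 and let $\nabla:\Omega^2BA\to\Omega^1BA$ be $\nabla(\beta\otimes\alpha\otimes a)=\pm\alpha\otimes a\otimes\beta$ if $a$ is a word of length one, and $0$ if the last factor is a word of any other length. **Theorem.** Let $C,D$ be DG coalgebras over $k$. (1) There is a morphism of supercomplexes $p:\hat X(C)\otimes\hat X(D)\to\hat X^2(C\otimes D)$ given, for homogeneous $c\in C$, $e\in D$, $\omega\in\Omega^1C_\natural$, $\omega'\in\Omega^1D_\natural$ (with $|\cdot|$ the degree inherited from $C$ and $D$), by $$p(c\otimes e)=c\otimes e\in C\otimes D,$$ $$p(c\otimes\omega')=\tfrac12(-1)^{|c|}R_{23}\bigl((\Delta+\tau\Delta)c\otimes\omega'\bigr)\in\dot\Omega^1(C\otimes D),\qquad p(\omega\otimes e)=\tfrac12R_{23}\bigl(\omega\otimes(\Delta+\tau\Delta)e\bigr)\in\dot\Omega^1(C\otimes D),$$ $$p(\omega\otimes\omega')=\tfrac12(-1)^{|\omega|}S\bigl((1\otimes\Delta)\omega\otimes(\Delta\otimes1)\omega'-(\Delta\otimes1)\omega\otimes(1\otimes\Delta)\omega'\bigr)\in\Omega^2(C\otimes D)_\natural,$$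 where $S:C^{\otimes3}\otimes D^{\otimes3}\to(C\otimes D)^{\otimes3}$ is the signed shuffle. (2) The formula $R(\omega_0+\omega_2+\omega_1)=(\omega_0+d\nabla\omega_2)+\theta(\omega_1-\delta\nabla\omega_2)$ defines a morphism of supercomplexes $R:\hat X^2(BA)\to\hat X(BA)$, and $RI=1$. (3) Every morphism of DG coalgebras $f:C\otimes D\to BA$ induces a morphism of supercomplexes $\hat X^2(f):\hat X^2(C\otimes D)\to\hat X^2(BA)$, given by $f$, $f\otimes f\otimes f$ and $f\otimes f$ on forms of degree $0$, $2$ and $1$, and the composite $$\hat X(C)\otimes\hat X(D)\xrightarrow{\ p\ }\hat X^2(C\otimes D)\xrightarrow{\hat X^2(f)}\hat X^2(BA)\xrightarrow{\ R\ }\hat X(BA)$$ is a morphism of supercomplexes. -/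

import Mathlib

open scoped TensorProduct

noncomputable section

namespace XComplex

section Gradings

/-- A `ℤ`-grading of a `k`-linear space `V`, i.e. a decomposition `V = ⨁ₙ Vₙ`. -/
structure ZGrading (k V : Type*) [Field k] [AddCommGroup V] [Module k V] where
  /-- the subspace of homogeneous elements of a given degree -/
  deg : ℤ → Submodule k V
  isInternal : DirectSum.IsInternal deg

variable {k V W : Type*} [Field k] [AddCommGroup V] [Module k V] [AddCommGroup W] [Module k W]

theorem isInternal_of_splitting (deg : ℤ → Submodule k V)
    (ψ : V →ₗ[k] DirectSum ℤ fun i => deg i)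
    (h1 : ∀ v, DirectSum.coeLinearMap deg (ψ v) = v)
    (h2 : ∀ (i : ℤ) (x : V) (hx : x ∈ deg i), ψ x = DirectSum.lof k ℤ (fun i => deg i) i ⟨x, hx⟩) :
    DirectSum.IsInternal deg := by
  have h3 : ψ ∘ₗ DirectSum.coeLinearMap deg = LinearMap.id := by
    apply DirectSum.linearMap_ext
    intro i
    ext1 x
    simp only [LinearMap.comp_apply, DirectSum.coeLinearMap_lof, LinearMap.id_apply]
    exact h2 i x x.2
  constructor
  · intro a b hab
    have ha := LinearMap.congr_fun h3 a
    have hb := LinearMap.congr_fun h3 b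
    simp only [LinearMap.comp_apply, LinearMap.id_apply] at ha hb
    rw [← ha, ← hb]
    exact congrArg ψ hab
  · intro v
    exact ⟨ψ v, h1 v⟩

namespace ZGrading

variable (G : ZGrading k V) (H : ZGrading k W)

theorem ext_of_homogeneous {U : Type*} [AddCommGroup U] [Module k U] {f g : V →ₗ[k] U}
    (h : ∀ i, ∀ v ∈ G.deg i, f v = g v) : f = g := by
  ext v
  have hv : v ∈ iSup G.deg := by
    rw [G.isInternal.submodule_iSup_eq_top]; trivial
  induction hv using Submodule.iSup_induction' with
  | mem i x hx => exact h i x hx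
  | zero => simp
  | add x y _ _ hx hy => rw [map_add, map_add, hx, hy]

theorem ext_of_homogeneous₂ {U : Type*} [AddCommGroup U] [Module k U] {f g : V ⊗[k] W →ₗ[k] U}
    (h : ∀ i, ∀ v ∈ G.deg i, ∀ j, ∀ w ∈ H.deg j, f (v ⊗ₜ w) = g (v ⊗ₜ w)) : f = g := by
  apply TensorProduct.ext
  apply G.ext_of_homogeneous
  intro i v hv
  apply H.ext_of_homogeneous
  intro j w hw
  exact h i v hv j w hw

theorem bijective : Function.Bijective (DirectSum.coeLinearMap G.deg) := G.isInternal

/-- The decomposition of a vector into its homogeneous components. -/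
def split : V ≃ₗ[k] DirectSum ℤ fun i => G.deg i :=
  (LinearEquiv.ofBijective (DirectSum.coeLinearMap G.deg) G.bijective).symm

theorem split_of_mem {i : ℤ} {v : V} (hv : v ∈ G.deg i) :
    G.split v = DirectSum.lof k ℤ (fun i => G.deg i) i ⟨v, hv⟩ := by
  rw [split, LinearEquiv.symm_apply_eq]
  simp [DirectSum.coeLinearMap_lof]

/-- The operator that multiplies the homogeneous elements of degree `i` by the scalar `c i`. -/
def weight (c : ℤ → k) : V →ₗ[k] V :=
  DirectSum.toModule k ℤ V (fun i => c i • (G.deg i).subtype) ∘ₗ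
    G.split.toLinearMap

theorem weight_of_mem (c : ℤ → k) {i : ℤ} {v : V} (hv : v ∈ G.deg i) :
    G.weight c v = c i • v := by
  simp [weight, G.split_of_mem hv, DirectSum.toModule_lof]

/-- The grading involution: `ε v = (-1)^i v` for `v` of degree `i`. -/
def ε : V →ₗ[k] V := G.weight fun i => if Even i then 1 else -1

/-- The projection onto the part of even degree. -/
def ev : V →ₗ[k] V := G.weight fun i => if Even i then 1 else 0

/-- The projection onto the part of odd degree. -/
def od : V →ₗ[k] V := G.weight fun i => if Even i then 0 else 1

@[simp] theorem ev_add_od (v : V) : G.ev v + G.od v = v := by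
  have : G.ev + G.od = LinearMap.id := by
    apply G.ext_of_homogeneous
    intro i v hv
    simp only [ev, od, LinearMap.add_apply, G.weight_of_mem _ hv, LinearMap.id_apply]
    split_ifs <;> simp
  exact LinearMap.congr_fun this v

@[simp] theorem ev_ε (v : V) : G.ev (G.ε v) = G.ev v := by
  have : G.ev ∘ₗ G.ε = G.ev := by
    apply G.ext_of_homogeneous
    intro i v hv
    simp only [ev, ε, LinearMap.comp_apply, G.weight_of_mem _ hv, map_smul]
    split_ifs <;> simp
  exact LinearMap.congr_fun this v

@[simp] theorem ε_ev (v : V) : G.ε (G.ev v) = G.ev v := by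
  have : G.ε ∘ₗ G.ev = G.ev := by
    apply G.ext_of_homogeneous
    intro i v hv
    simp only [ev, ε, LinearMap.comp_apply, G.weight_of_mem _ hv, map_smul]
    split_ifs <;> simp
  exact LinearMap.congr_fun this v

@[simp] theorem od_ε (v : V) : G.od (G.ε v) = - G.od v := by
  have : G.od ∘ₗ G.ε = - G.od := by
    apply G.ext_of_homogeneous
    intro i v hv
    simp only [od, ε, LinearMap.comp_apply, LinearMap.neg_apply, G.weight_of_mem _ hv, map_smul]
    split_ifs <;> simp
  exact LinearMap.congr_fun this v

@[simp] theorem ε_od (v : V) : G.ε (G.od v) = - G.od v := by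
  have : G.ε ∘ₗ G.od = - G.od := by
    apply G.ext_of_homogeneous
    intro i v hv
    simp only [od, ε, LinearMap.comp_apply, LinearMap.neg_apply, G.weight_of_mem _ hv, map_smul]
    split_ifs <;> simp
  exact LinearMap.congr_fun this v

@[simp] theorem ε_ε (v : V) : G.ε (G.ε v) = v := by
  have : G.ε ∘ₗ G.ε = LinearMap.id := by
    apply G.ext_of_homogeneous
    intro i v hv
    simp only [ε, LinearMap.comp_apply, LinearMap.id_apply, G.weight_of_mem _ hv, map_smul]
    split_ifs <;> simp
  exact LinearMap.congr_fun this v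

@[simp] theorem ev_ev (v : V) : G.ev (G.ev v) = G.ev v := by
  have : G.ev ∘ₗ G.ev = G.ev := by
    apply G.ext_of_homogeneous
    intro i v hv
    simp only [ev, LinearMap.comp_apply, G.weight_of_mem _ hv, map_smul]
    split_ifs <;> simp
  exact LinearMap.congr_fun this v

@[simp] theorem od_od (v : V) : G.od (G.od v) = G.od v := by
  have : G.od ∘ₗ G.od = G.od := by
    apply G.ext_of_homogeneous
    intro i v hv
    simp only [od, LinearMap.comp_apply, G.weight_of_mem _ hv, map_smul]
    split_ifs <;> simp
  exact LinearMap.congr_fun this v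

@[simp] theorem ev_od (v : V) : G.ev (G.od v) = 0 := by
  have : G.ev ∘ₗ G.od = 0 := by
    apply G.ext_of_homogeneous
    intro i v hv
    simp only [ev, od, LinearMap.comp_apply, G.weight_of_mem _ hv, map_smul, LinearMap.zero_apply]
    split_ifs <;> simp
  exact LinearMap.congr_fun this v

@[simp] theorem od_ev (v : V) : G.od (G.ev v) = 0 := by
  have : G.od ∘ₗ G.ev = 0 := by
    apply G.ext_of_homogeneous
    intro i v hv
    simp only [ev, od, LinearMap.comp_apply, G.weight_of_mem _ hv, map_smul, LinearMap.zero_apply]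
    split_ifs <;> simp
  exact LinearMap.congr_fun this v

/-- A map of degree zero commutes with the operators `weight c`. -/
theorem map_weight {f : V →ₗ[k] W} (hf : ∀ i, ∀ v ∈ G.deg i, f v ∈ H.deg i) (c : ℤ → k) (v : V) :
    f (G.weight c v) = H.weight c (f v) := by
  have : f ∘ₗ G.weight c = H.weight c ∘ₗ f := by
    apply G.ext_of_homogeneous
    intro i v hv
    simp only [LinearMap.comp_apply, G.weight_of_mem _ hv, map_smul, H.weight_of_mem _ (hf i v hv)]
  exact LinearMap.congr_fun this v

/-- Behaviour of the operators `weight c` with respect to a map of degree one. -/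
theorem map_weight_one {f : V →ₗ[k] W} (hf : ∀ i, ∀ v ∈ G.deg i, f v ∈ H.deg (i + 1))
    {c c' : ℤ → k} (h : ∀ i, c' i = c (i + 1)) (v : V) :
    H.weight c (f v) = f (G.weight c' v) := by
  have : H.weight c ∘ₗ f = f ∘ₗ G.weight c' := by
    apply G.ext_of_homogeneous
    intro i v hv
    simp only [LinearMap.comp_apply, G.weight_of_mem _ hv, map_smul, H.weight_of_mem _ (hf i v hv),
      h]
  exact LinearMap.congr_fun this v

/-- The homogeneous part of degree `n` of a tensor product, spanned by the tensors `v ⊗ w` of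
homogeneous elements with `|v| + |w| = n`. -/
def tensorDeg (n : ℤ) : Submodule k (V ⊗[k] W) :=
  Submodule.span k {t | ∃ i j : ℤ, ∃ v ∈ G.deg i, ∃ w ∈ H.deg j, i + j = n ∧ t = v ⊗ₜ w}

theorem tmul_mem_tensorDeg {i j n : ℤ} {v : V} {w : W} (hv : v ∈ G.deg i) (hw : w ∈ H.deg j)
    (h : i + j = n) : v ⊗ₜ w ∈ G.tensorDeg H n :=
  Submodule.subset_span ⟨i, j, v, hv, w, hw, h, rfl⟩

theorem map_mem_of_mem_tensorDeg {U : Type*} [AddCommGroup U] [Module k U]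
    (f : V ⊗[k] W →ₗ[k] U) (S : Submodule k U) (n : ℤ)
    (h : ∀ i j : ℤ, ∀ v ∈ G.deg i, ∀ w ∈ H.deg j, i + j = n → f (v ⊗ₜ w) ∈ S)
    {t : V ⊗[k] W} (ht : t ∈ G.tensorDeg H n) : f t ∈ S := by
  have : G.tensorDeg H n ≤ S.comap f := by
    refine Submodule.span_le.2 ?_
    rintro _ ⟨i, j, v, hv, w, hw, hn, rfl⟩
    exact h i j v hv w hw hn
  exact this ht

/-- auxiliary splitting map for the tensor product of gradings -/
def tensorSplit : V ⊗[k] W →ₗ[k] DirectSum ℤ fun n => G.tensorDeg H n :=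
  TensorProduct.lift
      (DirectSum.toModule k ℤ _ fun i => LinearMap.flip
        (DirectSum.toModule k ℤ _ fun j => LinearMap.flip <|
          (LinearMap.mk₂ k (fun (v : G.deg i) (w : H.deg j) =>
            DirectSum.lof k ℤ (fun n => G.tensorDeg H n) (i + j)
              ⟨(v : V) ⊗ₜ[k] (w : W), G.tmul_mem_tensorDeg H v.2 w.2 rfl⟩)
            (by intro a b c; rw [← map_add]; congr 1; ext; simp [TensorProduct.add_tmul])
            (by intro r a c; rw [← map_smul]; congr 1)
            (by intro a b c; rw [← map_add]; congr 1; ext; simp [TensorProduct.tmul_add])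
            (by intro r a c; rw [← map_smul]; congr 1; ext; simp)))) ∘ₗ
    TensorProduct.map G.split.toLinearMap H.split.toLinearMap

theorem tensorSplit_tmul {i j : ℤ} {v : V} {w : W} (hv : v ∈ G.deg i) (hw : w ∈ H.deg j) :
    G.tensorSplit H (v ⊗ₜ w) = DirectSum.lof k ℤ (fun n => G.tensorDeg H n) (i + j)
      ⟨v ⊗ₜ w, G.tmul_mem_tensorDeg H hv hw rfl⟩ := by
  simp [tensorSplit, G.split_of_mem hv, H.split_of_mem hw, DirectSum.toModule_lof]

/-- The grading of a tensor product. -/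
def tensor : ZGrading k (V ⊗[k] W) where
  deg := G.tensorDeg H
  isInternal := by
    refine isInternal_of_splitting _ (G.tensorSplit H) ?_ ?_
    · intro t
      have : DirectSum.coeLinearMap (G.tensorDeg H) ∘ₗ G.tensorSplit H = LinearMap.id := by
        apply G.ext_of_homogeneous₂ H
        intro i v hv j w hw
        simp [G.tensorSplit_tmul H hv hw, DirectSum.coeLinearMap_lof]
      exact LinearMap.congr_fun this t
    · intro n x hx
      have key : ∃ hx' : x ∈ G.tensorDeg H n, G.tensorSplit H x
          = DirectSum.lof k ℤ (fun n => G.tensorDeg H n) n ⟨x, hx'⟩ := by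
        induction hx using Submodule.span_induction with
        | mem t ht =>
          obtain ⟨i, j, v, hv, w, hw, rfl, rfl⟩ := ht
          exact ⟨_, G.tensorSplit_tmul H hv hw⟩
        | zero => exact ⟨Submodule.zero_mem _, by
            rw [map_zero]
            exact (map_zero (DirectSum.lof k ℤ (fun n => G.tensorDeg H n) n)).symm⟩
        | add a b _ _ ha hb =>
          obtain ⟨ha, ha'⟩ := ha
          obtain ⟨hb, hb'⟩ := hb
          refine ⟨Submodule.add_mem _ ha hb, ?_⟩
          rw [map_add, ha', hb', ← map_add]; rfl
        | smul r a _ ha =>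
          obtain ⟨ha, ha'⟩ := ha
          refine ⟨Submodule.smul_mem _ r ha, ?_⟩
          rw [map_smul, ha', ← map_smul]; rfl
      exact key.2

theorem tensor_ε : (G.tensor H).ε = TensorProduct.map G.ε H.ε := by
  apply G.ext_of_homogeneous₂ H
  intro i v hv j w hw
  rw [ε, (G.tensor H).weight_of_mem _ (G.tmul_mem_tensorDeg H hv hw rfl), TensorProduct.map_tmul,
    ε, ε, G.weight_of_mem _ hv, H.weight_of_mem _ hw]
  by_cases h1 : Even i <;> by_cases h2 : Even j <;> simp [Int.even_add, h1, h2, TensorProduct.tmul_neg, TensorProduct.neg_tmul]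

theorem tensor_ev : (G.tensor H).ev
    = TensorProduct.map G.ev H.ev + TensorProduct.map G.od H.od := by
  apply G.ext_of_homogeneous₂ H
  intro i v hv j w hw
  rw [ev, (G.tensor H).weight_of_mem _ (G.tmul_mem_tensorDeg H hv hw rfl), LinearMap.add_apply,
    TensorProduct.map_tmul, TensorProduct.map_tmul, ev, ev, od, od,
    G.weight_of_mem _ hv, H.weight_of_mem _ hw, G.weight_of_mem _ hv, H.weight_of_mem _ hw]
  by_cases h1 : Even i <;> by_cases h2 : Even j <;> simp [Int.even_add, h1, h2]

theorem tensor_od : (G.tensor H).od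
    = TensorProduct.map G.ev H.od + TensorProduct.map G.od H.ev := by
  apply G.ext_of_homogeneous₂ H
  intro i v hv j w hw
  rw [od, (G.tensor H).weight_of_mem _ (G.tmul_mem_tensorDeg H hv hw rfl), LinearMap.add_apply,
    TensorProduct.map_tmul, TensorProduct.map_tmul, ev, ev, od, od,
    G.weight_of_mem _ hv, H.weight_of_mem _ hw, G.weight_of_mem _ hv, H.weight_of_mem _ hw]
  by_cases h1 : Even i <;> by_cases h2 : Even j <;> simp [Int.even_add, h1, h2]

/-- The signed exchange `v ⊗ w ↦ (-1)^(|v||w|) w ⊗ v`. -/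
def swap : V ⊗[k] W →ₗ[k] W ⊗[k] V :=
  (TensorProduct.comm k V W).toLinearMap ∘ₗ
    (TensorProduct.map G.ev LinearMap.id + TensorProduct.map G.od H.ε)

theorem swap_tmul (v : V) (w : W) : G.swap H (v ⊗ₜ w) = w ⊗ₜ G.ev v + H.ε w ⊗ₜ G.od v := by
  simp [swap]

theorem swap_of_mem {i j : ℤ} {v : V} {w : W} (hv : v ∈ G.deg i) (hw : w ∈ H.deg j) :
    G.swap H (v ⊗ₜ w) = (-1 : k) ^ (i * j) • (w ⊗ₜ v) := by
  rw [swap_tmul, ev, od, ε, G.weight_of_mem _ hv, H.weight_of_mem _ hw, G.weight_of_mem _ hv]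
  by_cases h1 : Even i
  · have : Even (i * j) := h1.mul_right j
    simp [h1, this.neg_one_zpow]
  · by_cases h2 : Even j
    · have : Even (i * j) := h2.mul_left i
      simp [h1, h2, this.neg_one_zpow]
    · have : Odd (i * j) := (Int.not_even_iff_odd.1 h1).mul (Int.not_even_iff_odd.1 h2)
      simp [h1, h2, this.neg_one_zpow, TensorProduct.neg_tmul]

/-- The signed exchange of the two inner factors,
`(u ⊗ v) ⊗ (w ⊗ z) ↦ (-1)^(|v||w|) (u ⊗ w) ⊗ (v ⊗ z)`. -/
def interchange (U Z : Type*) [AddCommGroup U] [Module k U] [AddCommGroup Z] [Module k Z] :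
    (U ⊗[k] V) ⊗[k] (W ⊗[k] Z) →ₗ[k] (U ⊗[k] W) ⊗[k] (V ⊗[k] Z) :=
  (TensorProduct.tensorTensorTensorComm k U V W Z).toLinearMap ∘ₗ
    (TensorProduct.map (TensorProduct.map LinearMap.id G.ev) LinearMap.id +
      TensorProduct.map (TensorProduct.map LinearMap.id G.od)
        (TensorProduct.map H.ε LinearMap.id))

theorem interchange_tmul {U Z : Type*} [AddCommGroup U] [Module k U] [AddCommGroup Z] [Module k Z]
    (u : U) (v : V) (w : W) (z : Z) :
    G.interchange H U Z ((u ⊗ₜ v) ⊗ₜ (w ⊗ₜ z))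
      = (u ⊗ₜ w) ⊗ₜ (G.ev v ⊗ₜ z) + (u ⊗ₜ H.ε w) ⊗ₜ (G.od v ⊗ₜ z) := by
  simp [interchange]

/-- The differential `v ⊗ w ↦ δ v ⊗ w + (-1)^|v| v ⊗ δ w` of a tensor product. -/
def tensorδ (δV : V →ₗ[k] V) (δW : W →ₗ[k] W) : V ⊗[k] W →ₗ[k] V ⊗[k] W :=
  TensorProduct.map δV LinearMap.id + TensorProduct.map G.ε δW

theorem tensorδ_tmul (δV : V →ₗ[k] V) (δW : W →ₗ[k] W) (v : V) (w : W) :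
    G.tensorδ δV δW (v ⊗ₜ w) = δV v ⊗ₜ w + G.ε v ⊗ₜ δW w := by
  simp [tensorδ]

end ZGrading

end Gradings

open TensorProduct

section Naturality

variable {k V W V' W' U U' Z Z' : Type*} [Field k] [AddCommGroup V] [Module k V]
  [AddCommGroup W] [Module k W] [AddCommGroup V'] [Module k V'] [AddCommGroup W'] [Module k W']
  [AddCommGroup U] [Module k U] [AddCommGroup U'] [Module k U']
  [AddCommGroup Z] [Module k Z] [AddCommGroup Z'] [Module k Z']

namespace ZGrading

/-- An even map of graded spaces. -/
structure IsEven (G : ZGrading k V) (G' : ZGrading k V') (f : V →ₗ[k] V') : Prop where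
  ev : ∀ v, G'.ev (f v) = f (G.ev v)
  od : ∀ v, G'.od (f v) = f (G.od v)
  ε : ∀ v, G'.ε (f v) = f (G.ε v)

/-- An odd map of graded spaces. -/
structure IsOdd (G : ZGrading k V) (G' : ZGrading k V') (f : V →ₗ[k] V') : Prop where
  ev : ∀ v, G'.ev (f v) = f (G.od v)
  od : ∀ v, G'.od (f v) = f (G.ev v)
  ε : ∀ v, G'.ε (f v) = - f (G.ε v)

variable (G : ZGrading k V) (H : ZGrading k W) (G' : ZGrading k V') (H' : ZGrading k W')

theorem isEven_of_deg {f : V →ₗ[k] V'} (hf : ∀ i, ∀ v ∈ G.deg i, f v ∈ G'.deg i) :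
    IsEven G G' f :=
  ⟨fun v => (G.map_weight G' hf _ v).symm, fun v => (G.map_weight G' hf _ v).symm,
    fun v => (G.map_weight G' hf _ v).symm⟩

theorem isOdd_of_deg {f : V →ₗ[k] V'} (hf : ∀ i, ∀ v ∈ G.deg i, f v ∈ G'.deg (i + 1)) :
    IsOdd G G' f := by
  refine ⟨fun v => G.map_weight_one G' hf ?_ v, fun v => G.map_weight_one G' hf ?_ v, fun v => ?_⟩
  · intro i; by_cases h : Even i <;> simp [h]
  · intro i; by_cases h : Even i <;> simp [h]
  · have : -(f (G.ε v)) = f (G.weight (fun i => if Even i then -1 else 1) v) := by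
      rw [← map_neg]
      congr 1
      have h : -G.ε = G.weight (fun i => if Even i then -1 else 1) := by
        apply G.ext_of_homogeneous
        intro i v hv
        rw [LinearMap.neg_apply, ZGrading.ε, G.weight_of_mem _ hv, G.weight_of_mem _ hv]
        split_ifs <;> simp
      exact LinearMap.congr_fun h v
    rw [this]
    refine G.map_weight_one G' hf ?_ v
    intro i; by_cases h : Even i <;> simp [h]

variable {G H G' H'}

theorem IsEven.swap {f : V →ₗ[k] V'} {g : W →ₗ[k] W'} (hf : IsEven G G' f) (hg : IsEven H H' g)
    (t : V ⊗[k] W) :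
    G'.swap H' (TensorProduct.map f g t) = TensorProduct.map g f (G.swap H t) := by
  induction t using TensorProduct.induction_on with
  | zero => simp
  | tmul v w => simp [swap_tmul, hf.ev, hf.od, hg.ε]
  | add x y hx hy => simp only [map_add, hx, hy]

theorem IsEven.interchange {f : V →ₗ[k] V'} {g : W →ₗ[k] W'} (hf : IsEven G G' f)
    (hg : IsEven H H' g) (p : U →ₗ[k] U') (q : Z →ₗ[k] Z') (t : (U ⊗[k] V) ⊗[k] (W ⊗[k] Z)) :
    G'.interchange H' U' Z' (TensorProduct.map (TensorProduct.map p f) (TensorProduct.map g q) t)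
      = TensorProduct.map (TensorProduct.map p g) (TensorProduct.map f q)
          (G.interchange H U Z t) := by
  suffices h : G'.interchange H' U' Z' ∘ₗ
      (TensorProduct.map (TensorProduct.map p f) (TensorProduct.map g q))
      = TensorProduct.map (TensorProduct.map p g) (TensorProduct.map f q) ∘ₗ
          (G.interchange H U Z) from LinearMap.congr_fun h t
  ext u v w z
  simp [interchange_tmul, hf.ev, hf.od, hg.ε]

theorem IsEven.tensor {f : V →ₗ[k] V'} {g : W →ₗ[k] W'} (hf : IsEven G G' f)
    (hg : IsEven H H' g) : IsEven (G.tensor H) (G'.tensor H') (TensorProduct.map f g) := by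
  constructor
  · intro t
    induction t using TensorProduct.induction_on with
    | zero => simp
    | tmul v w => simp [tensor_ev, hf.ev, hf.od, hg.ev, hg.od]
    | add x y hx hy => simp only [map_add, hx, hy]
  · intro t
    induction t using TensorProduct.induction_on with
    | zero => simp
    | tmul v w => simp [tensor_od, hf.ev, hf.od, hg.ev, hg.od]
    | add x y hx hy => simp only [map_add, hx, hy]
  · intro t
    induction t using TensorProduct.induction_on with
    | zero => simp
    | tmul v w => simp [tensor_ε, hf.ε, hg.ε]
    | add x y hx hy => simp only [map_add, hx, hy]

variable (G) in
theorem IsEven.id : IsEven G G LinearMap.id := ⟨fun _ => rfl, fun _ => rfl, fun _ => rfl⟩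

theorem swap_tensorδ {δV : V →ₗ[k] V} {δW : W →ₗ[k] W} (hV : IsOdd G G δV) (hW : IsOdd H H δW)
    (t : V ⊗[k] W) :
    G.swap H (G.tensorδ δV δW t) = H.tensorδ δW δV (G.swap H t) := by
  induction t using TensorProduct.induction_on with
  | zero => simp
  | tmul v w =>
    simp only [swap_tmul, tensorδ_tmul, map_add, hV.ev, hV.od, hW.ε, ev_ε, od_ε, ε_ε, tmul_neg,
      neg_tmul]
    abel
  | add x y hx hy => simp only [map_add, hx, hy]

theorem swap_ε (t : V ⊗[k] W) :
    G.swap H (TensorProduct.map G.ε H.ε t) = TensorProduct.map H.ε G.ε (G.swap H t) := by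
  induction t using TensorProduct.induction_on with
  | zero => simp
  | tmul v w => simp [swap_tmul]
  | add x y hx hy => simp only [map_add, hx, hy]

theorem swap_swap (t : V ⊗[k] W) : H.swap G (G.swap H t) = t := by
  induction t using TensorProduct.induction_on with
  | zero => simp
  | tmul v w =>
    have e : ∀ w : W, H.ε w = H.ev w - H.od w := by
      intro w; have := H.ev_add_od (H.ε w); simp at this; rw [← this]; abel
    simp only [swap_tmul, map_add, ε_ev, ε_od, ev_ε, od_ε, tmul_neg, neg_tmul]
    have : v ⊗ₜ[k] w = (G.ev v + G.od v) ⊗ₜ[k] (H.ev w + H.od w) := by simp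
    rw [this]
    simp only [tmul_add, add_tmul]
    abel
  | add x y hx hy => simp only [map_add, hx, hy]

theorem tensorδ_sq {δV : V →ₗ[k] V} {δW : W →ₗ[k] W} (hV : IsOdd G G δV)
    (h1 : ∀ v, δV (δV v) = 0) (h2 : ∀ w, δW (δW w) = 0) (t : V ⊗[k] W) :
    G.tensorδ δV δW (G.tensorδ δV δW t) = 0 := by
  induction t using TensorProduct.induction_on with
  | zero => simp
  | tmul v w => simp [tensorδ_tmul, hV.ε, h1, h2, neg_tmul]
  | add x y hx hy => simp only [map_add, hx, hy, add_zero]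

theorem tensorδ_ε {δV : V →ₗ[k] V} {δW : W →ₗ[k] W} (hV : IsOdd G G δV)
    (hW : ∀ w, H.ε (δW w) = - δW (H.ε w)) (t : V ⊗[k] W) :
    TensorProduct.map G.ε H.ε (G.tensorδ δV δW t)
      = - G.tensorδ δV δW (TensorProduct.map G.ε H.ε t) := by
  induction t using TensorProduct.induction_on with
  | zero => simp
  | tmul v w => simp [tensorδ_tmul, hV.ε, hW, neg_tmul, tmul_neg]; abel
  | add x y hx hy => simp only [map_add, hx, hy]; abel

theorem tensorδ_odd {δV : V →ₗ[k] V} {δW : W →ₗ[k] W} (hV : IsOdd G G δV) (hW : IsOdd H H δW) :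
    IsOdd (G.tensor H) (G.tensor H) (G.tensorδ δV δW) := by
  constructor
  · intro t
    induction t using TensorProduct.induction_on with
    | zero => simp
    | tmul v w =>
      simp [tensorδ_tmul, tensor_ev, tensor_od, hV.ev, hV.od, hW.ev, hW.od, neg_tmul]
      abel
    | add x y hx hy => simp only [map_add, hx, hy]
  · intro t
    induction t using TensorProduct.induction_on with
    | zero => simp
    | tmul v w =>
      simp [tensorδ_tmul, tensor_ev, tensor_od, hV.ev, hV.od, hW.ev, hW.od, neg_tmul]
      abel
    | add x y hx hy => simp only [map_add, hx, hy]
  · intro t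
    rw [tensor_ε, tensorδ_ε hV hW.ε]

theorem tensorδ_map {δV : V →ₗ[k] V} {δW : W →ₗ[k] W} {δV' : V' →ₗ[k] V'} {δW' : W' →ₗ[k] W'}
    {f : V →ₗ[k] V'} {g : W →ₗ[k] W'} (hf : ∀ v, G'.ε (f v) = f (G.ε v))
    (hfδ : ∀ v, δV' (f v) = f (δV v)) (hgδ : ∀ w, δW' (g w) = g (δW w)) (t : V ⊗[k] W) :
    G'.tensorδ δV' δW' (TensorProduct.map f g t) = TensorProduct.map f g (G.tensorδ δV δW t) := by
  induction t using TensorProduct.induction_on with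
  | zero => simp
  | tmul v w => simp [tensorδ_tmul, hf, hfδ, hgδ]
  | add x y hx hy => simp only [map_add, hx, hy]

variable (G H) in
theorem tensorδ_assoc (δV : V →ₗ[k] V) (δW : W →ₗ[k] W) (δU : U →ₗ[k] U)
    (t : (V ⊗[k] W) ⊗[k] U) :
    G.tensorδ δV (H.tensorδ δW δU) (TensorProduct.assoc k V W U t)
      = TensorProduct.assoc k V W U ((G.tensor H).tensorδ (G.tensorδ δV δW) δU t) := by
  suffices h : G.tensorδ δV (H.tensorδ δW δU) ∘ₗ (TensorProduct.assoc k V W U).toLinearMap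
      = (TensorProduct.assoc k V W U).toLinearMap ∘ₗ
          ((G.tensor H).tensorδ (G.tensorδ δV δW) δU) from LinearMap.congr_fun h t
  ext v w u
  simp [tensorδ_tmul, tensor_ε, add_tmul, tmul_add]
  abel

theorem tensorδ_interchange {A : ZGrading k U} {δU : U →ₗ[k] U} {δZ : Z →ₗ[k] Z}
    {δV : V →ₗ[k] V} {δW : W →ₗ[k] W} (hV : IsOdd G G δV) (hW : IsOdd H H δW)
    (t : (U ⊗[k] V) ⊗[k] (W ⊗[k] Z)) :
    G.interchange H U Z ((A.tensor G).tensorδ (A.tensorδ δU δV) (H.tensorδ δW δZ) t)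
      = (A.tensor H).tensorδ (A.tensorδ δU δW) (G.tensorδ δV δZ) (G.interchange H U Z t) := by
  suffices h : G.interchange H U Z ∘ₗ
        ((A.tensor G).tensorδ (A.tensorδ δU δV) (H.tensorδ δW δZ))
      = (A.tensor H).tensorδ (A.tensorδ δU δW) (G.tensorδ δV δZ) ∘ₗ (G.interchange H U Z) from
    LinearMap.congr_fun h t
  ext u v w z
  simp [tensorδ_tmul, tensor_ε, add_tmul, tmul_add, interchange_tmul, hV.ev, hV.od, hW.ε,
    neg_tmul, tmul_neg]
  abel

/-- The two ways of interchanging three factors with three factors agree. -/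
theorem interchange_assoc (G₂ : ZGrading k V) (G₃ : ZGrading k V')
    (H₁ : ZGrading k W) (H₂ : ZGrading k W') (t : ((U ⊗[k] V) ⊗[k] V') ⊗[k] ((W ⊗[k] W') ⊗[k] Z)) :
    LinearMap.lTensor (U ⊗[k] W) (G₃.interchange H₂ V Z)
        ((G₂.tensor G₃).interchange H₁ U (W' ⊗[k] Z)
          (TensorProduct.map (TensorProduct.assoc k U V V').toLinearMap
            (TensorProduct.assoc k W W' Z).toLinearMap t))
      = TensorProduct.assoc k (U ⊗[k] W) (V ⊗[k] W') (V' ⊗[k] Z)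
          (LinearMap.rTensor (V' ⊗[k] Z) (G₂.interchange H₁ U W')
            (G₃.interchange (H₁.tensor H₂) (U ⊗[k] V) Z t)) := by
  suffices h : (LinearMap.lTensor (U ⊗[k] W) (G₃.interchange H₂ V Z)) ∘ₗ
      (G₂.tensor G₃).interchange H₁ U (W' ⊗[k] Z) ∘ₗ
        (TensorProduct.map (TensorProduct.assoc k U V V').toLinearMap
          (TensorProduct.assoc k W W' Z).toLinearMap)
      = (TensorProduct.assoc k (U ⊗[k] W) (V ⊗[k] W') (V' ⊗[k] Z)).toLinearMap ∘ₗ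
          (LinearMap.rTensor (V' ⊗[k] Z) (G₂.interchange H₁ U W')) ∘ₗ
            (G₃.interchange (H₁.tensor H₂) (U ⊗[k] V) Z) from LinearMap.congr_fun h t
  ext u v v' w w' z
  simp [interchange_tmul, tensor_ε, tensor_ev, tensor_od, add_tmul, tmul_add]
  abel

end ZGrading

end Naturality

section Coalgebras

/-- A differential graded coalgebra over `k`: a `ℤ`-graded space with a coassociative coproduct
`Δ` and a counit `η`, both of degree zero, and a differential `δ` of degree `+1` which is a
coderivation. Signs follow the Koszul rule. -/
structure DGCoalgebra (k C : Type*) [Field k] [AddCommGroup C] [Module k C]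
    extends ZGrading k C where
  /-- the coproduct -/
  Δ : C →ₗ[k] C ⊗[k] C
  /-- the counit -/
  η : C →ₗ[k] k
  /-- the differential -/
  δ : C →ₗ[k] C
  Δ_mem : ∀ n, ∀ x ∈ deg n, Δ x ∈ toZGrading.tensorDeg toZGrading n
  η_eq_zero : ∀ n, n ≠ 0 → ∀ x ∈ deg n, η x = 0
  δ_mem : ∀ n, ∀ x ∈ deg n, δ x ∈ deg (n + 1)
  coassoc : ∀ x, TensorProduct.assoc k C C C (Δ.rTensor C (Δ x)) = Δ.lTensor C (Δ x)
  counit_left : ∀ x, TensorProduct.lid k C (η.rTensor C (Δ x)) = x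
  counit_right : ∀ x, TensorProduct.rid k C (η.lTensor C (Δ x)) = x
  δ_δ : ∀ x, δ (δ x) = 0
  η_δ : ∀ x, η (δ x) = 0
  Δ_δ : ∀ x, Δ (δ x) = toZGrading.tensorδ δ δ (Δ x)

namespace DGCoalgebra

variable {k C D : Type*} [Field k] [AddCommGroup C] [Module k C] [AddCommGroup D] [Module k D]

/-- A morphism of differential graded coalgebras. -/
structure Hom (X : DGCoalgebra k C) (Y : DGCoalgebra k D) where
  toLin : C →ₗ[k] D
  map_deg : ∀ n, ∀ x ∈ X.deg n, toLin x ∈ Y.deg n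
  map_Δ : ∀ x, Y.Δ (toLin x) = TensorProduct.map toLin toLin (X.Δ x)
  map_η : ∀ x, Y.η (toLin x) = X.η x
  map_δ : ∀ x, Y.δ (toLin x) = toLin (X.δ x)

variable (X : DGCoalgebra k C) (Y : DGCoalgebra k D)

theorem Δ_even : ZGrading.IsEven X.toZGrading (X.toZGrading.tensor X.toZGrading) X.Δ :=
  ZGrading.isEven_of_deg _ _ X.Δ_mem

theorem δ_odd : ZGrading.IsOdd X.toZGrading X.toZGrading X.δ :=
  ZGrading.isOdd_of_deg _ _ X.δ_mem

@[simp] theorem η_ε (x : C) : X.η (X.ε x) = X.η x := by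
  have : X.η ∘ₗ X.ε = X.η := by
    apply X.ext_of_homogeneous
    intro i v hv
    rw [LinearMap.comp_apply, ZGrading.ε, X.weight_of_mem _ hv, map_smul]
    by_cases h : i = 0
    · simp [h]
    · simp [X.η_eq_zero i h v hv]
  exact LinearMap.congr_fun this x

@[simp] theorem η_od (x : C) : X.η (X.od x) = 0 := by
  have : X.η ∘ₗ X.od = 0 := by
    apply X.ext_of_homogeneous
    intro i v hv
    rw [LinearMap.comp_apply, ZGrading.od, X.weight_of_mem _ hv, map_smul]
    by_cases h : i = 0
    · simp [h]
    · simp [X.η_eq_zero i h v hv]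
  exact LinearMap.congr_fun this x

@[simp] theorem η_ev (x : C) : X.η (X.ev x) = X.η x := by
  have h := congrArg X.η (X.ev_add_od x)
  rwa [map_add, η_od, add_zero] at h

theorem Δ_ε (x : C) : X.Δ (X.ε x) = TensorProduct.map X.ε X.ε (X.Δ x) := by
  rw [← X.Δ_even.ε, ZGrading.tensor_ε]

/-- The tensor product of two DG coalgebras, with coproduct
`c ⊗ d ↦ ∑ (-1)^(|c''||d'|) (c' ⊗ d') ⊗ (c'' ⊗ d'')`. -/
def tensor : DGCoalgebra k (C ⊗[k] D) where
  toZGrading := X.toZGrading.tensor Y.toZGrading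
  Δ := X.interchange Y.toZGrading C D ∘ₗ TensorProduct.map X.Δ Y.Δ
  η := LinearMap.mul' k k ∘ₗ TensorProduct.map X.η Y.η
  δ := X.tensorδ X.δ Y.δ
  Δ_mem := by
    intro n t ht
    refine X.map_mem_of_mem_tensorDeg Y.toZGrading _ _ n ?_ ht
    rintro i j v hv w hw rfl
    rw [LinearMap.comp_apply, TensorProduct.map_tmul]
    have h1 := X.Δ_mem i v hv
    have h2 := Y.Δ_mem j w hw
    refine X.map_mem_of_mem_tensorDeg X.toZGrading
      (X.interchange Y.toZGrading C D ∘ₗ (TensorProduct.mk k _ _).flip (Y.Δ w)) _ i ?_ h1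
    rintro p q a ha b hb rfl
    refine Y.map_mem_of_mem_tensorDeg Y.toZGrading
      (X.interchange Y.toZGrading C D ∘ₗ (TensorProduct.mk k _ _) (a ⊗ₜ b)) _ j ?_ h2
    rintro r s e he f hf rfl
    simp only [LinearMap.comp_apply, TensorProduct.mk_apply, ZGrading.interchange_tmul]
    have hb1 : X.ev b ∈ X.deg q := by
      rw [ZGrading.ev, X.weight_of_mem _ hb]; exact Submodule.smul_mem _ _ hb
    have hb2 : X.od b ∈ X.deg q := by
      rw [ZGrading.od, X.weight_of_mem _ hb]; exact Submodule.smul_mem _ _ hb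
    have he1 : Y.ε e ∈ Y.deg r := by
      rw [ZGrading.ε, Y.weight_of_mem _ he]; exact Submodule.smul_mem _ _ he
    refine Submodule.add_mem _ ?_ ?_
    · exact ZGrading.tmul_mem_tensorDeg _ _ (X.tmul_mem_tensorDeg _ ha he rfl)
        (X.tmul_mem_tensorDeg _ hb1 hf rfl) (by ring)
    · exact ZGrading.tmul_mem_tensorDeg _ _ (X.tmul_mem_tensorDeg _ ha he1 rfl)
        (X.tmul_mem_tensorDeg _ hb2 hf rfl) (by ring)
  η_eq_zero := by
    intro n hn t ht
    have := X.map_mem_of_mem_tensorDeg Y.toZGrading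
      (LinearMap.mul' k k ∘ₗ TensorProduct.map X.η Y.η) ⊥ n ?_ ht
    · simpa using this
    · rintro i j v hv w hw rfl
      by_cases hi : i = 0
      · have hj : j ≠ 0 := by rintro rfl; exact hn (by simp [hi])
        simp [Y.η_eq_zero j hj w hw]
      · simp [X.η_eq_zero i hi v hv]
  δ_mem := by
    intro n t ht
    refine X.map_mem_of_mem_tensorDeg Y.toZGrading _ _ n ?_ ht
    rintro i j v hv w hw rfl
    rw [ZGrading.tensorδ_tmul]
    have hv1 : X.ε v ∈ X.deg i := by
      rw [ZGrading.ε, X.weight_of_mem _ hv]; exact Submodule.smul_mem _ _ hv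
    refine Submodule.add_mem _ ?_ ?_
    · exact X.tmul_mem_tensorDeg _ (X.δ_mem i v hv) hw (by ring)
    · exact X.tmul_mem_tensorDeg _ hv1 (Y.δ_mem j w hw) (by ring)
  coassoc := by
    intro t
    induction t using TensorProduct.induction_on with
    | zero => simp
    | add x y hx hy => simp only [map_add, hx, hy]
    | tmul c d =>
      have h1 := X.Δ_even
      have h2 := Y.Δ_even
      have l : ∀ t, LinearMap.rTensor (C ⊗[k] D)
          (X.interchange Y.toZGrading C D ∘ₗ TensorProduct.map X.Δ Y.Δ)
            (X.interchange Y.toZGrading C D t)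
          = LinearMap.rTensor (C ⊗[k] D) (X.interchange Y.toZGrading C D)
            (X.interchange (Y.toZGrading.tensor Y.toZGrading) (C ⊗[k] C) D
              (TensorProduct.map (TensorProduct.map X.Δ LinearMap.id)
                (TensorProduct.map Y.Δ LinearMap.id) t)) := by
        intro t
        rw [ZGrading.IsEven.interchange (ZGrading.IsEven.id X.toZGrading) h2,
          LinearMap.rTensor_comp, LinearMap.comp_apply, TensorProduct.map_id]
        rfl
      have r : ∀ t, LinearMap.lTensor (C ⊗[k] D)
          (X.interchange Y.toZGrading C D ∘ₗ TensorProduct.map X.Δ Y.Δ)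
            (X.interchange Y.toZGrading C D t)
          = LinearMap.lTensor (C ⊗[k] D) (X.interchange Y.toZGrading C D)
            ((X.toZGrading.tensor X.toZGrading).interchange Y.toZGrading C (D ⊗[k] D)
              (TensorProduct.map (TensorProduct.map LinearMap.id X.Δ)
                (TensorProduct.map LinearMap.id Y.Δ) t)) := by
        intro t
        rw [ZGrading.IsEven.interchange h1 (ZGrading.IsEven.id Y.toZGrading),
          LinearMap.lTensor_comp, LinearMap.comp_apply, TensorProduct.map_id]
        rfl
      rw [LinearMap.comp_apply, l, r, TensorProduct.map_tmul, TensorProduct.map_tmul,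
        TensorProduct.map_tmul]
      have c1 := X.coassoc c
      have c2 := Y.coassoc d
      unfold LinearMap.lTensor at c1 c2
      rw [← c1, ← c2, ← ZGrading.interchange_assoc]
      rfl
  counit_left := by
    intro t
    have key : ∀ s : (C ⊗[k] C) ⊗[k] (D ⊗[k] D),
        TensorProduct.lid k (C ⊗[k] D) (LinearMap.rTensor (C ⊗[k] D)
          (LinearMap.mul' k k ∘ₗ TensorProduct.map X.η Y.η) (X.interchange Y.toZGrading C D s))
        = TensorProduct.map ((TensorProduct.lid k C).toLinearMap ∘ₗ X.η.rTensor C)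
            ((TensorProduct.lid k D).toLinearMap ∘ₗ Y.η.rTensor D) s := by
      intro s
      suffices h : (TensorProduct.lid k (C ⊗[k] D)).toLinearMap ∘ₗ (LinearMap.rTensor (C ⊗[k] D)
          (LinearMap.mul' k k ∘ₗ TensorProduct.map X.η Y.η)) ∘ₗ (X.interchange Y.toZGrading C D)
        = TensorProduct.map ((TensorProduct.lid k C).toLinearMap ∘ₗ X.η.rTensor C)
            ((TensorProduct.lid k D).toLinearMap ∘ₗ Y.η.rTensor D) from LinearMap.congr_fun h s
      ext a b e f
      simp only [AlgebraTensorModule.curry_apply, LinearMap.restrictScalars_self, curry_apply,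
        LinearMap.comp_apply, ZGrading.interchange_tmul, map_add, LinearMap.rTensor_tmul,
        TensorProduct.map_tmul, LinearMap.mul'_apply, LinearEquiv.coe_coe,
        TensorProduct.lid_tmul, η_ε, ← smul_add, ← add_tmul, X.ev_add_od]
      rw [smul_tmul_smul]
    induction t using TensorProduct.induction_on with
    | zero => simp
    | add x y hx hy => simp only [map_add, hx, hy]
    | tmul c d =>
      rw [LinearMap.comp_apply, key, TensorProduct.map_tmul, TensorProduct.map_tmul,
        LinearMap.comp_apply, LinearMap.comp_apply]
      simp only [LinearEquiv.coe_coe, X.counit_left, Y.counit_left]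
  counit_right := by
    intro t
    have key : ∀ s : (C ⊗[k] C) ⊗[k] (D ⊗[k] D),
        TensorProduct.rid k (C ⊗[k] D) (LinearMap.lTensor (C ⊗[k] D)
          (LinearMap.mul' k k ∘ₗ TensorProduct.map X.η Y.η) (X.interchange Y.toZGrading C D s))
        = TensorProduct.map ((TensorProduct.rid k C).toLinearMap ∘ₗ X.η.lTensor C)
            ((TensorProduct.rid k D).toLinearMap ∘ₗ Y.η.lTensor D) s := by
      intro s
      suffices h : (TensorProduct.rid k (C ⊗[k] D)).toLinearMap ∘ₗ (LinearMap.lTensor (C ⊗[k] D)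
          (LinearMap.mul' k k ∘ₗ TensorProduct.map X.η Y.η)) ∘ₗ (X.interchange Y.toZGrading C D)
        = TensorProduct.map ((TensorProduct.rid k C).toLinearMap ∘ₗ X.η.lTensor C)
            ((TensorProduct.rid k D).toLinearMap ∘ₗ Y.η.lTensor D) from LinearMap.congr_fun h s
      ext a b e f
      simp only [AlgebraTensorModule.curry_apply, LinearMap.restrictScalars_self, curry_apply,
        LinearMap.comp_apply, ZGrading.interchange_tmul, map_add, LinearMap.lTensor_tmul,
        TensorProduct.map_tmul, LinearMap.mul'_apply, LinearEquiv.coe_coe,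
        TensorProduct.rid_tmul, η_ev, η_od, zero_mul, zero_smul, add_zero]
      rw [smul_tmul_smul]
    induction t using TensorProduct.induction_on with
    | zero => simp
    | add x y hx hy => simp only [map_add, hx, hy]
    | tmul c d =>
      rw [LinearMap.comp_apply, key, TensorProduct.map_tmul, TensorProduct.map_tmul,
        LinearMap.comp_apply, LinearMap.comp_apply]
      simp only [LinearEquiv.coe_coe, X.counit_right, Y.counit_right]
  δ_δ := ZGrading.tensorδ_sq X.δ_odd X.δ_δ Y.δ_δ
  η_δ := by
    intro t
    induction t using TensorProduct.induction_on with
    | zero => simp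
    | add x y hx hy => simp only [map_add, hx, hy, add_zero]
    | tmul c d => simp [ZGrading.tensorδ_tmul, X.η_δ, Y.η_δ]
  Δ_δ := by
    intro t
    rw [LinearMap.comp_apply, ← ZGrading.tensorδ_map (G := X.toZGrading)
      (G' := X.toZGrading.tensor X.toZGrading) (δV' := X.tensorδ X.δ X.δ)
      (δW' := Y.tensorδ Y.δ Y.δ) X.Δ_even.ε (fun v => (X.Δ_δ v).symm) (fun v => (Y.Δ_δ v).symm),
      ZGrading.tensorδ_interchange X.δ_odd Y.δ_odd]
    rfl

end DGCoalgebra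

end Coalgebras

section Forms

namespace DGCoalgebra

variable {k C D : Type*} [Field k] [AddCommGroup C] [Module k C] [AddCommGroup D] [Module k D]
variable (X : DGCoalgebra k C)

/-- The grading of `C ⊗ C`. -/
def G₁ : ZGrading k (C ⊗[k] C) := X.toZGrading.tensor X.toZGrading

/-- The grading of `C ⊗ C ⊗ C`. -/
def G₂ : ZGrading k (C ⊗[k] (C ⊗[k] C)) := X.toZGrading.tensor X.G₁

/-- The grading of `C ⊗ C ⊗ C ⊗ C`. -/
def G₃ : ZGrading k (C ⊗[k] (C ⊗[k] (C ⊗[k] C))) := X.toZGrading.tensor X.G₂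

/-- The differential induced by `δ` on `C ⊗ C`. -/
def δ₁ : C ⊗[k] C →ₗ[k] C ⊗[k] C := X.tensorδ X.δ X.δ

/-- The differential induced by `δ` on `C ⊗ C ⊗ C`. -/
def δ₂ : C ⊗[k] (C ⊗[k] C) →ₗ[k] C ⊗[k] (C ⊗[k] C) := X.tensorδ X.δ X.δ₁

/-- The differential induced by `δ` on `C ⊗ C ⊗ C ⊗ C`. -/
def δ₃ : C ⊗[k] (C ⊗[k] (C ⊗[k] C)) →ₗ[k] C ⊗[k] (C ⊗[k] (C ⊗[k] C)) := X.tensorδ X.δ X.δ₂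

/-- The signed exchange of the two factors of `C ⊗ C`. -/
def τ : C ⊗[k] C →ₗ[k] C ⊗[k] C := X.swap X.toZGrading

/-- The map `c ⊗ m ↦ ∑ c' ⊗ (c'' ⊗ m)`. -/
def Δl (M : Type*) [AddCommGroup M] [Module k M] : C ⊗[k] M →ₗ[k] C ⊗[k] (C ⊗[k] M) :=
  (TensorProduct.assoc k C C M).toLinearMap ∘ₗ X.Δ.rTensor M

/-- The signed cyclic permutation `a ⊗ b ⊗ c ↦ ± b ⊗ c ⊗ a`. -/
def rot₂ : C ⊗[k] (C ⊗[k] C) →ₗ[k] C ⊗[k] (C ⊗[k] C) :=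
  (TensorProduct.assoc k C C C).toLinearMap ∘ₗ X.swap X.G₁

/-- The signed cyclic permutation `a ⊗ b ⊗ c ⊗ d ↦ ± b ⊗ c ⊗ d ⊗ a`. -/
def rot₃ : C ⊗[k] (C ⊗[k] (C ⊗[k] C)) →ₗ[k] C ⊗[k] (C ⊗[k] (C ⊗[k] C)) :=
  LinearMap.lTensor C (TensorProduct.assoc k C C C).toLinearMap ∘ₗ
    (TensorProduct.assoc k C (C ⊗[k] C) C).toLinearMap ∘ₗ X.swap X.G₂

/-- The (dual) Hochschild boundary on forms of degree `0`: `c ↦ ∑ c' ⊗ c'' - ± c'' ⊗ c'`. -/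
def b₀ : C →ₗ[k] C ⊗[k] C := X.Δ - X.τ ∘ₗ X.Δ

/-- The (dual) Hochschild boundary on forms of degree `1`:
`a ⊗ b ↦ ∑ a' ⊗ a'' ⊗ b - a ⊗ b' ⊗ b'' ± a'' ⊗ b ⊗ a'`. -/
def b₁ : C ⊗[k] C →ₗ[k] C ⊗[k] (C ⊗[k] C) :=
  X.Δl C - LinearMap.lTensor C X.Δ + X.rot₂ ∘ₗ X.Δl C

/-- The (dual) Hochschild boundary on forms of degree `2`:
`a ⊗ b ⊗ c ↦ ∑ a' ⊗ a'' ⊗ b ⊗ c - a ⊗ b' ⊗ b'' ⊗ c + a ⊗ b ⊗ c' ⊗ c'' - ± a'' ⊗ b ⊗ c ⊗ a'`. -/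
def b₂ : C ⊗[k] (C ⊗[k] C) →ₗ[k] C ⊗[k] (C ⊗[k] (C ⊗[k] C)) :=
  X.Δl (C ⊗[k] C) - LinearMap.lTensor C (X.Δl C)
    + LinearMap.lTensor C (LinearMap.lTensor C X.Δ) - X.rot₃ ∘ₗ X.Δl (C ⊗[k] C)

/-- The universal codifferential `c ⊗ m ↦ η(c) m`; it lowers the degree of a form by one. -/
def d (M : Type*) [AddCommGroup M] [Module k M] : C ⊗[k] M →ₗ[k] M :=
  (TensorProduct.lid k M).toLinearMap ∘ₗ X.η.rTensor M

/-- `Ω¹C = C ⊗ ker η`, as a subspace of `C ⊗ C` (the kernel of `1 ⊗ η`). -/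
def Ω₁ : Submodule k (C ⊗[k] C) := LinearMap.ker (X.η.lTensor C)

/-- `Ω²C = C ⊗ ker η ⊗ ker η`, as a subspace of `C ⊗ C ⊗ C` (the intersection of the kernels of
`1 ⊗ η ⊗ 1` and `1 ⊗ 1 ⊗ η`). -/
def Ω₂ : Submodule k (C ⊗[k] (C ⊗[k] C)) :=
  LinearMap.ker ((X.d C).lTensor C) ⊓ LinearMap.ker ((X.η.lTensor C).lTensor C)

/-- The cocommutator subspace `Ω¹C_♮` of `Ω¹C`, i.e. the kernel of `b`. -/
def Ω₁nat : Submodule k (C ⊗[k] C) := X.Ω₁ ⊓ LinearMap.ker X.b₁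

/-- The cocommutator subspace `Ω²C_♮` of `Ω²C` (with respect to the graded coalgebra `ΩC`). Among
the forms `ω` of degree two it is given by `b ω = 0` and `b d ω = 0`; equivalently, it consists of
the `ω` with `b ω = 0` that are annihilated by the square of `b + d N`. -/
def Ω₂nat : Submodule k (C ⊗[k] (C ⊗[k] C)) :=
  X.Ω₂ ⊓ LinearMap.ker X.b₂ ⊓ LinearMap.ker (X.b₁ ∘ₗ X.d (C ⊗[k] C))

/-- The space of forms of degree one that are annihilated by `(b + d N)² = 2 d b + b d`. -/
def Ω₁dot : Submodule k (C ⊗[k] C) :=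
  X.Ω₁ ⊓ LinearMap.ker ((2 : k) • (X.d (C ⊗[k] C) ∘ₗ X.b₁) + X.b₀ ∘ₗ X.d C)

section Identities

variable {M N : Type*} [AddCommGroup M] [Module k M] [AddCommGroup N] [Module k N]

theorem Δl_Δ (x : C) : X.Δl C (X.Δ x) = LinearMap.lTensor C X.Δ (X.Δ x) := X.coassoc x

theorem Δl_Δl (t : C ⊗[k] M) :
    X.Δl (C ⊗[k] M) (X.Δl M t) = LinearMap.lTensor C (X.Δl M) (X.Δl M t) := by
  induction t using TensorProduct.induction_on with
  | zero => simp
  | add x y hx hy => simp only [map_add, hx, hy]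
  | tmul c m =>
    have h1 : ∀ s : C ⊗[k] C, X.Δl (C ⊗[k] M) (TensorProduct.assoc k C C M (s ⊗ₜ m))
        = LinearMap.lTensor C (TensorProduct.assoc k C C M).toLinearMap
          (TensorProduct.assoc k C (C ⊗[k] C) M
            ((TensorProduct.assoc k C C C (X.Δ.rTensor C s)) ⊗ₜ m)) := by
      intro s
      induction s using TensorProduct.induction_on with
      | zero => simp
      | add x y hx hy => simp only [map_add, add_tmul, hx, hy]
      | tmul a b =>
        simp only [Δl, LinearMap.comp_apply, TensorProduct.assoc_tmul, LinearMap.rTensor_tmul,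
          LinearEquiv.coe_coe]
        generalize X.Δ a = u
        induction u using TensorProduct.induction_on with
        | zero => simp
        | add x y hx hy => simp only [map_add, add_tmul, hx, hy]
        | tmul a b => simp
    have h2 : ∀ s : C ⊗[k] C, LinearMap.lTensor C (X.Δl M) (TensorProduct.assoc k C C M (s ⊗ₜ m))
        = LinearMap.lTensor C (TensorProduct.assoc k C C M).toLinearMap
          (TensorProduct.assoc k C (C ⊗[k] C) M ((X.Δ.lTensor C s) ⊗ₜ m)) := by
      intro s
      induction s using TensorProduct.induction_on with
      | zero => simp
      | add x y hx hy => simp only [map_add, add_tmul, hx, hy]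
      | tmul a b => simp [Δl]
    have h3 : X.Δl M (c ⊗ₜ m) = TensorProduct.assoc k C C M (X.Δ c ⊗ₜ m) := by simp [Δl]
    rw [h3, h1, h2, X.coassoc]

theorem Δl_nat (f : M →ₗ[k] N) (t : C ⊗[k] M) :
    X.Δl N (LinearMap.lTensor C f t)
      = LinearMap.lTensor C (LinearMap.lTensor C f) (X.Δl M t) := by
  induction t using TensorProduct.induction_on with
  | zero => simp
  | add x y hx hy => simp only [map_add, hx, hy]
  | tmul c m =>
    simp only [Δl, LinearMap.comp_apply, LinearMap.lTensor_tmul, LinearMap.rTensor_tmul,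
      LinearEquiv.coe_coe]
    generalize X.Δ c = u
    induction u using TensorProduct.induction_on with
    | zero => simp
    | add x y hx hy => simp only [map_add, add_tmul, hx, hy]
    | tmul a b => simp

theorem lTensor_Δ_Δ (t : C ⊗[k] C) :
    LinearMap.lTensor C (X.Δl C) (LinearMap.lTensor C X.Δ t)
      = LinearMap.lTensor C (LinearMap.lTensor C X.Δ) (LinearMap.lTensor C X.Δ t) := by
  induction t using TensorProduct.induction_on with
  | zero => simp
  | add x y hx hy => simp only [map_add, hx, hy]
  | tmul c m => simp only [LinearMap.lTensor_tmul, X.Δl_Δ]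

theorem rot₂_lTensor (t : C ⊗[k] C) :
    X.rot₂ (LinearMap.lTensor C X.Δ t) = X.Δl C (X.τ t) := by
  have := ZGrading.IsEven.swap (ZGrading.IsEven.id X.toZGrading) X.Δ_even t
  unfold rot₂ Δl τ G₁ LinearMap.lTensor LinearMap.rTensor
  rw [LinearMap.comp_apply, LinearMap.comp_apply, this]

theorem isEven_assoc :
    ZGrading.IsEven ((X.toZGrading.tensor X.toZGrading).tensor X.toZGrading) X.G₂
      (TensorProduct.assoc k C C C).toLinearMap := by
  constructor
  · intro t
    suffices h : X.G₂.ev ∘ₗ (TensorProduct.assoc k C C C).toLinearMap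
        = (TensorProduct.assoc k C C C).toLinearMap ∘ₗ ZGrading.ev _ from LinearMap.congr_fun h t
    ext a b c
    simp [G₂, G₁, ZGrading.tensor_ev, ZGrading.tensor_od, tmul_add, add_tmul]
    abel
  · intro t
    suffices h : X.G₂.od ∘ₗ (TensorProduct.assoc k C C C).toLinearMap
        = (TensorProduct.assoc k C C C).toLinearMap ∘ₗ ZGrading.od _ from LinearMap.congr_fun h t
    ext a b c
    simp [G₂, G₁, ZGrading.tensor_ev, ZGrading.tensor_od, tmul_add, add_tmul]
    abel
  · intro t
    suffices h : X.G₂.ε ∘ₗ (TensorProduct.assoc k C C C).toLinearMap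
        = (TensorProduct.assoc k C C C).toLinearMap ∘ₗ ZGrading.ε _ from LinearMap.congr_fun h t
    ext a b c
    simp [G₂, G₁, ZGrading.tensor_ε]

theorem Δl_even : ZGrading.IsEven X.G₁ X.G₂ (X.Δl C) := by
  have h := ZGrading.IsEven.tensor X.Δ_even (ZGrading.IsEven.id X.toZGrading)
  have h' := X.isEven_assoc
  exact ⟨fun v => (h'.ev _).trans (congrArg _ (h.ev v)),
    fun v => (h'.od _).trans (congrArg _ (h.od v)),
    fun v => (h'.ε _).trans (congrArg _ (h.ε v))⟩

theorem lTensor_Δ_even : ZGrading.IsEven X.G₁ X.G₂ (LinearMap.lTensor C X.Δ) :=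
  ZGrading.IsEven.tensor (ZGrading.IsEven.id X.toZGrading) X.Δ_even

theorem rot₃_lTensor_Δl (t : C ⊗[k] (C ⊗[k] C)) :
    X.rot₃ (LinearMap.lTensor C (X.Δl C) t) = X.Δl (C ⊗[k] C) (X.rot₂ t) := by
  have := ZGrading.IsEven.swap (ZGrading.IsEven.id X.toZGrading) X.Δl_even t
  unfold rot₃ rot₂ LinearMap.lTensor
  rw [LinearMap.comp_apply, LinearMap.comp_apply, this, LinearMap.comp_apply]
  generalize X.swap X.G₁ t = u
  induction u using TensorProduct.induction_on with
  | zero => simp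
  | add x y hx hy => simp only [map_add, hx, hy]
  | tmul p a =>
    induction p using TensorProduct.induction_on with
    | zero => simp
    | add x y hx hy => simp only [map_add, add_tmul, hx, hy]
    | tmul b c =>
      simp only [Δl, LinearMap.comp_apply, TensorProduct.map_tmul, LinearMap.rTensor_tmul,
        LinearEquiv.coe_coe, LinearMap.id_apply, TensorProduct.assoc_tmul]
      generalize X.Δ b = u
      induction u using TensorProduct.induction_on with
      | zero => simp
      | add x y hx hy => simp only [map_add, add_tmul, hx, hy]
      | tmul a b => simp

theorem rot₃_lTensor_Δ (t : C ⊗[k] (C ⊗[k] C)) :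
    X.rot₃ (LinearMap.lTensor C (LinearMap.lTensor C X.Δ) t)
      = LinearMap.lTensor C (X.Δl C) (X.rot₂ t) := by
  have := ZGrading.IsEven.swap (ZGrading.IsEven.id X.toZGrading) X.lTensor_Δ_even t
  unfold rot₃ rot₂
  unfold LinearMap.lTensor at this ⊢
  rw [LinearMap.comp_apply, LinearMap.comp_apply, this, LinearMap.comp_apply]
  generalize X.swap X.G₁ t = u
  induction u using TensorProduct.induction_on with
  | zero => simp
  | add x y hx hy => simp only [map_add, hx, hy]
  | tmul p a =>
    induction p using TensorProduct.induction_on with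
    | zero => simp
    | add x y hx hy => simp only [map_add, add_tmul, hx, hy]
    | tmul b c =>
      simp only [Δl, LinearMap.comp_apply, TensorProduct.map_tmul, LinearMap.rTensor_tmul,
        LinearEquiv.coe_coe, LinearMap.id_apply, TensorProduct.assoc_tmul]

theorem rot₂_rot₂ (t : C ⊗[k] C) :
    X.rot₂ (X.rot₂ (X.Δl C t)) = LinearMap.lTensor C X.Δ (X.τ t) := by
  have key : ∀ s : (C ⊗[k] C) ⊗[k] C, X.rot₂ (X.rot₂ (TensorProduct.assoc k C C C s))
      = X.G₁.swap X.toZGrading s := by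
    intro s
    suffices h : X.rot₂ ∘ₗ X.rot₂ ∘ₗ (TensorProduct.assoc k C C C).toLinearMap
      = X.G₁.swap X.toZGrading from LinearMap.congr_fun h s
    ext a b c
    simp [rot₂, G₁, ZGrading.swap_tmul, ZGrading.tensor_ev, ZGrading.tensor_od, ZGrading.tensor_ε,
      tmul_add, neg_tmul, tmul_neg]
    abel
  have h := ZGrading.IsEven.swap X.Δ_even (ZGrading.IsEven.id X.toZGrading) t
  exact (key _).trans h

theorem rot₃_rot₃ (t : C ⊗[k] (C ⊗[k] C)) :
    X.rot₃ (X.rot₃ (X.Δl (C ⊗[k] C) t))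
      = LinearMap.lTensor C (LinearMap.lTensor C X.Δ) (X.rot₂ t) := by
  have key : ∀ s : (C ⊗[k] C) ⊗[k] (C ⊗[k] C),
      X.rot₃ (X.rot₃ (TensorProduct.assoc k C C (C ⊗[k] C) s))
      = TensorProduct.assoc k C C (C ⊗[k] C) (X.G₁.swap X.G₁ s) := by
    intro s
    suffices h : X.rot₃ ∘ₗ X.rot₃ ∘ₗ (TensorProduct.assoc k C C (C ⊗[k] C)).toLinearMap
      = (TensorProduct.assoc k C C (C ⊗[k] C)).toLinearMap ∘ₗ X.G₁.swap X.G₁ from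
      LinearMap.congr_fun h s
    ext a b c e
    simp [rot₃, G₁, G₂, ZGrading.swap_tmul, ZGrading.tensor_ev, ZGrading.tensor_od,
      ZGrading.tensor_ε, tmul_add, neg_tmul, tmul_neg]
    abel
  have h := ZGrading.IsEven.swap X.Δ_even (ZGrading.IsEven.id X.G₁) t
  refine (key _).trans ((congrArg _ h).trans ?_)
  rw [rot₂, LinearMap.comp_apply]
  generalize X.swap X.G₁ t = u
  induction u using TensorProduct.induction_on with
  | zero => simp
  | add x y hx hy => simp only [map_add, hx, hy]
  | tmul p a =>
    induction p using TensorProduct.induction_on with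
    | zero => simp
    | add x y hx hy => simp only [map_add, add_tmul, hx, hy]
    | tmul b c => simp

theorem b₁_b₀ (x : C) : X.b₁ (X.b₀ x) = 0 := by
  have h1 := X.Δl_Δ x
  have h2 : X.rot₂ (X.Δl C (X.Δ x)) = X.Δl C (X.τ (X.Δ x)) := by rw [h1, X.rot₂_lTensor]
  have h3 : LinearMap.lTensor C X.Δ (X.τ (X.Δ x)) = X.rot₂ (X.Δl C (X.τ (X.Δ x))) := by
    rw [← h2, X.rot₂_rot₂]
  simp only [b₁, b₀, LinearMap.add_apply, LinearMap.sub_apply, LinearMap.comp_apply, map_sub]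
  rw [h3, h2, h1]
  abel

theorem b₂_b₁ (t : C ⊗[k] C) : X.b₂ (X.b₁ t) = 0 := by
  have e00 := X.Δl_Δl t
  have e11 := X.lTensor_Δ_Δ t
  have e01 := X.Δl_nat X.Δ t
  have e30 : X.rot₃ (X.Δl (C ⊗[k] C) (X.Δl C t)) = X.Δl (C ⊗[k] C) (X.rot₂ (X.Δl C t)) := by
    rw [e00, X.rot₃_lTensor_Δl]
  have e31 : X.rot₃ (X.Δl (C ⊗[k] C) (LinearMap.lTensor C X.Δ t))
      = LinearMap.lTensor C (X.Δl C) (X.rot₂ (X.Δl C t)) := by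
    rw [e01, X.rot₃_lTensor_Δ]
  have e32 : X.rot₃ (X.Δl (C ⊗[k] C) (X.rot₂ (X.Δl C t)))
      = LinearMap.lTensor C (LinearMap.lTensor C X.Δ) (X.rot₂ (X.Δl C t)) := by
    rw [← e30, X.rot₃_rot₃]
  simp only [b₂, b₁, LinearMap.add_apply, LinearMap.sub_apply, LinearMap.comp_apply, map_sub,
    map_add]
  rw [e32, e31, e30, e01, e11, e00]
  abel

theorem d_Δ (x : C) : X.d C (X.Δ x) = x := X.counit_left x

theorem η_τ (t : C ⊗[k] C) :
    TensorProduct.rid k C (X.η.lTensor C (X.τ t)) = X.d C t := by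
  induction t using TensorProduct.induction_on with
  | zero => simp
  | add x y hx hy => simp only [map_add, hx, hy]
  | tmul a b => simp [d, τ, ZGrading.swap_tmul]

theorem d_τ (t : C ⊗[k] C) :
    X.d C (X.τ t) = TensorProduct.rid k C (X.η.lTensor C t) := by
  induction t using TensorProduct.induction_on with
  | zero => simp
  | add x y hx hy => simp only [map_add, hx, hy]
  | tmul a b => simp [d, τ, ZGrading.swap_tmul, ← smul_add]

theorem d_b₀ (x : C) : X.d C (X.b₀ x) = 0 := by
  simp [b₀, X.d_Δ, d_τ, X.counit_right]

theorem b₀_mem (x : C) : X.b₀ x ∈ X.Ω₁ := by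
  rw [Ω₁, LinearMap.mem_ker, ← (TensorProduct.rid k C).map_eq_zero_iff]
  simp [b₀, X.d_Δ, η_τ, X.counit_right]

theorem d_Δl (t : C ⊗[k] M) : X.d (C ⊗[k] M) (X.Δl M t) = t := by
  induction t using TensorProduct.induction_on with
  | zero => simp
  | add x y hx hy => simp only [map_add, hx, hy]
  | tmul c m =>
    have h : ∀ s : C ⊗[k] C, X.d (C ⊗[k] M) (TensorProduct.assoc k C C M (s ⊗ₜ m))
        = X.d C s ⊗ₜ m := by
      intro s
      induction s using TensorProduct.induction_on with
      | zero => simp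
      | add x y hx hy => simp only [map_add, add_tmul, hx, hy]
      | tmul a b => simp [d, smul_tmul']
    have := h (X.Δ c)
    rw [X.d_Δ] at this
    have h3 : X.Δl M (c ⊗ₜ m) = TensorProduct.assoc k C C M (X.Δ c ⊗ₜ m) := by simp [Δl]
    rw [h3, this]

theorem d_lTensor (f : M →ₗ[k] N) (t : C ⊗[k] M) :
    X.d N (LinearMap.lTensor C f t) = f (X.d M t) := by
  induction t using TensorProduct.induction_on with
  | zero => simp
  | add x y hx hy => simp only [map_add, hx, hy]
  | tmul c m => simp [d]

theorem d_rot₂ (t : C ⊗[k] (C ⊗[k] C)) :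
    X.d (C ⊗[k] C) (X.rot₂ t) = X.τ (LinearMap.lTensor C (X.d C) t) := by
  suffices h : X.d (C ⊗[k] C) ∘ₗ X.rot₂ = X.τ ∘ₗ LinearMap.lTensor C (X.d C) from
    LinearMap.congr_fun h t
  ext a b c
  simp [d, rot₂, τ, G₁, ZGrading.swap_tmul, ZGrading.tensor_ε, smul_tmul']

theorem lTensor_d_Δl (t : C ⊗[k] M) : LinearMap.lTensor C (X.d M) (X.Δl M t) = t := by
  induction t using TensorProduct.induction_on with
  | zero => simp
  | add x y hx hy => simp only [map_add, hx, hy]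
  | tmul c m =>
    have h : ∀ s : C ⊗[k] C, LinearMap.lTensor C (X.d M) (TensorProduct.assoc k C C M (s ⊗ₜ m))
        = (TensorProduct.rid k C (X.η.lTensor C s)) ⊗ₜ m := by
      intro s
      induction s using TensorProduct.induction_on with
      | zero => simp
      | add x y hx hy => simp only [map_add, add_tmul, hx, hy]
      | tmul a b => simp [d, smul_tmul']
    have := h (X.Δ c)
    rw [X.counit_right] at this
    have h3 : X.Δl M (c ⊗ₜ m) = TensorProduct.assoc k C C M (X.Δ c ⊗ₜ m) := by simp [Δl]
    rw [h3, this]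

theorem d_b₁ (t : C ⊗[k] C) :
    X.d (C ⊗[k] C) (X.b₁ t) = t - X.Δ (X.d C t) + X.τ t := by
  simp only [b₁, LinearMap.add_apply, LinearMap.sub_apply, LinearMap.comp_apply, map_add, map_sub,
    X.d_Δl, X.d_lTensor, X.d_rot₂, X.lTensor_d_Δl]

theorem b₀_d {t : C ⊗[k] C} (ht : X.b₁ t = 0) : X.b₀ (X.d C t) = 0 := by
  have h := X.d_b₁ t
  rw [ht, map_zero] at h
  have h' : X.Δ (X.d C t) = t + X.τ t := by
    rw [eq_comm, sub_add_eq_add_sub, sub_eq_zero] at h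
    exact h.symm
  have h2 : X.τ (X.τ t) = t := ZGrading.swap_swap t
  rw [b₀, LinearMap.sub_apply, LinearMap.comp_apply, h', map_add, h2]
  abel

theorem lTensor_d_rot₂ (t : C ⊗[k] (C ⊗[k] C)) :
    LinearMap.lTensor C (X.d C) (X.rot₂ t)
      = X.τ (LinearMap.lTensor C ((TensorProduct.rid k C).toLinearMap ∘ₗ X.η.lTensor C) t) := by
  suffices h : LinearMap.lTensor C (X.d C) ∘ₗ X.rot₂
      = X.τ ∘ₗ LinearMap.lTensor C ((TensorProduct.rid k C).toLinearMap ∘ₗ X.η.lTensor C) from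
    LinearMap.congr_fun h t
  ext a b c
  simp [d, rot₂, τ, G₁, ZGrading.swap_tmul, ZGrading.tensor_ε]

theorem rid_rot₂ (t : C ⊗[k] (C ⊗[k] C)) :
    LinearMap.lTensor C ((TensorProduct.rid k C).toLinearMap ∘ₗ X.η.lTensor C) (X.rot₂ t)
      = X.d (C ⊗[k] C) t := by
  suffices h : LinearMap.lTensor C ((TensorProduct.rid k C).toLinearMap ∘ₗ X.η.lTensor C) ∘ₗ X.rot₂
      = X.d (C ⊗[k] C) from LinearMap.congr_fun h t
  ext a b c
  simp [d, rot₂, G₁, ZGrading.swap_tmul, ZGrading.tensor_ε]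

theorem mem_Ω₂ {t : C ⊗[k] (C ⊗[k] C)} : t ∈ X.Ω₂ ↔ LinearMap.lTensor C (X.d C) t = 0 ∧
    LinearMap.lTensor C ((TensorProduct.rid k C).toLinearMap ∘ₗ X.η.lTensor C) t = 0 := by
  rw [Ω₂, Submodule.mem_inf, LinearMap.mem_ker, LinearMap.mem_ker]
  refine and_congr Iff.rfl ?_
  rw [LinearMap.lTensor_comp, LinearMap.comp_apply]
  exact ((LinearEquiv.lTensor C (TensorProduct.rid k C)).map_eq_zero_iff).symm

theorem b₁_mem {t : C ⊗[k] C} (ht : t ∈ X.Ω₁) : X.b₁ t ∈ X.Ω₂ := by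
  rw [Ω₁, LinearMap.mem_ker] at ht
  have h1 : LinearMap.lTensor C (X.d C) (LinearMap.lTensor C X.Δ t) = t := by
    rw [← LinearMap.comp_apply, ← LinearMap.lTensor_comp]
    have : X.d C ∘ₗ X.Δ = LinearMap.id := by ext x; exact X.d_Δ x
    rw [this]; simp
  have h2 : LinearMap.lTensor C ((TensorProduct.rid k C).toLinearMap ∘ₗ X.η.lTensor C)
      (LinearMap.lTensor C X.Δ t) = t := by
    rw [← LinearMap.comp_apply, ← LinearMap.lTensor_comp]
    have : ((TensorProduct.rid k C).toLinearMap ∘ₗ X.η.lTensor C) ∘ₗ X.Δ = LinearMap.id := by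
      ext x; exact X.counit_right x
    rw [this]; simp
  have h3 : LinearMap.lTensor C ((TensorProduct.rid k C).toLinearMap ∘ₗ X.η.lTensor C)
      (X.Δl C t) = 0 := by
    rw [LinearMap.lTensor_comp, LinearMap.comp_apply, ← X.Δl_nat, ht]
    simp
  rw [mem_Ω₂]
  simp only [b₁, LinearMap.add_apply, LinearMap.sub_apply, LinearMap.comp_apply, map_add, map_sub]
  rw [h1, h2, h3, X.lTensor_d_Δl, X.lTensor_d_rot₂, X.rid_rot₂, h3, X.d_Δl]
  simp

theorem d_mem {t : C ⊗[k] (C ⊗[k] C)} (ht : t ∈ X.Ω₂) : X.d (C ⊗[k] C) t ∈ X.Ω₁ := by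
  rw [Ω₂, Submodule.mem_inf, LinearMap.mem_ker, LinearMap.mem_ker] at ht
  rw [Ω₁, LinearMap.mem_ker, ← X.d_lTensor, ht.2, map_zero]

theorem d_d {t : C ⊗[k] (C ⊗[k] C)} (ht : t ∈ X.Ω₂) : X.d C (X.d (C ⊗[k] C) t) = 0 := by
  rw [Ω₂, Submodule.mem_inf, LinearMap.mem_ker, LinearMap.mem_ker] at ht
  rw [← X.d_lTensor, ht.1, map_zero]

end Identities

end DGCoalgebra

end Forms

section Complexes

namespace DGCoalgebra

variable {k C D : Type*} [Field k] [AddCommGroup C] [Module k C] [AddCommGroup D] [Module k D]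
variable (X : DGCoalgebra k C)

/-- The grading involution of `C ⊗ C`. -/
def ε₁ : C ⊗[k] C →ₗ[k] C ⊗[k] C := TensorProduct.map X.ε X.ε

/-- The grading involution of `C ⊗ C ⊗ C`. -/
def ε₂ : C ⊗[k] (C ⊗[k] C) →ₗ[k] C ⊗[k] (C ⊗[k] C) := TensorProduct.map X.ε X.ε₁

/-- The grading involution of `C ⊗ C ⊗ C ⊗ C`. -/
def ε₃ : C ⊗[k] (C ⊗[k] (C ⊗[k] C)) →ₗ[k] C ⊗[k] (C ⊗[k] (C ⊗[k] C)) :=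
  TensorProduct.map X.ε X.ε₂

theorem G₁_ε : X.G₁.ε = X.ε₁ := ZGrading.tensor_ε _ _

theorem G₂_ε : X.G₂.ε = X.ε₂ := by rw [G₂, ZGrading.tensor_ε, G₁_ε, ε₂]

theorem ε₁_ε₁ (t : C ⊗[k] C) : X.ε₁ (X.ε₁ t) = t := by
  rw [← X.G₁_ε, ZGrading.ε_ε]

theorem ε₂_ε₂ (t : C ⊗[k] (C ⊗[k] C)) : X.ε₂ (X.ε₂ t) = t := by
  rw [← X.G₂_ε, ZGrading.ε_ε]

theorem δ₁_odd : ZGrading.IsOdd X.G₁ X.G₁ X.δ₁ := ZGrading.tensorδ_odd X.δ_odd X.δ_odd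

theorem δ₂_odd : ZGrading.IsOdd X.G₂ X.G₂ X.δ₂ := ZGrading.tensorδ_odd X.δ_odd X.δ₁_odd

theorem δ₁_δ₁ (t : C ⊗[k] C) : X.δ₁ (X.δ₁ t) = 0 := ZGrading.tensorδ_sq X.δ_odd X.δ_δ X.δ_δ t

theorem δ₂_δ₂ (t : C ⊗[k] (C ⊗[k] C)) : X.δ₂ (X.δ₂ t) = 0 :=
  ZGrading.tensorδ_sq X.δ_odd X.δ_δ X.δ₁_δ₁ t

section Commutation

variable {M N : Type*} [AddCommGroup M] [Module k M] [AddCommGroup N] [Module k N]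

theorem tensorδ_Δl (δM : M →ₗ[k] M) (t : C ⊗[k] M) :
    X.tensorδ X.δ (X.tensorδ X.δ δM) (X.Δl M t) = X.Δl M (X.tensorδ X.δ δM t) := by
  rw [Δl, LinearMap.comp_apply, LinearMap.comp_apply, LinearEquiv.coe_coe,
    ZGrading.tensorδ_assoc, LinearMap.rTensor,
    ZGrading.tensorδ_map (G := X.toZGrading) (δV := X.δ) (δW := δM) (g := LinearMap.id)
      X.Δ_even.ε (fun v => (X.Δ_δ v).symm) (fun _ => rfl)]

theorem tensorδ_lTensor {δM : M →ₗ[k] M} {δN : N →ₗ[k] N} {f : M →ₗ[k] N}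
    (hf : ∀ m, δN (f m) = f (δM m)) (t : C ⊗[k] M) :
    X.tensorδ X.δ δN (LinearMap.lTensor C f t)
      = LinearMap.lTensor C f (X.tensorδ X.δ δM t) :=
  ZGrading.tensorδ_map (G := X.toZGrading) (G' := X.toZGrading) (f := LinearMap.id)
    (δV := X.δ) (δV' := X.δ) (fun _ => rfl) (fun _ => rfl) hf t

theorem δ₂_rot₂ (t : C ⊗[k] (C ⊗[k] C)) : X.δ₂ (X.rot₂ t) = X.rot₂ (X.δ₂ t) := by
  have h : X.swap X.G₁ (X.δ₂ t) = X.G₁.tensorδ X.δ₁ X.δ (X.swap X.G₁ t) :=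
    ZGrading.swap_tensorδ X.δ_odd X.δ₁_odd t
  rw [rot₂, LinearMap.comp_apply, LinearMap.comp_apply, h]
  exact ZGrading.tensorδ_assoc _ _ _ _ _ _

theorem δ₃_rot₃ (t : C ⊗[k] (C ⊗[k] (C ⊗[k] C))) : X.δ₃ (X.rot₃ t) = X.rot₃ (X.δ₃ t) := by
  have h : X.swap X.G₂ (X.δ₃ t) = X.G₂.tensorδ X.δ₂ X.δ (X.swap X.G₂ t) :=
    ZGrading.swap_tensorδ X.δ_odd X.δ₂_odd t
  rw [rot₃, LinearMap.comp_apply, LinearMap.comp_apply, LinearMap.comp_apply,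
    LinearMap.comp_apply, h]
  refine (X.tensorδ_lTensor (δM := X.G₁.tensorδ X.δ₁ X.δ)
    (fun m => ZGrading.tensorδ_assoc _ _ _ _ _ _) _).trans ?_
  exact congrArg _ (ZGrading.tensorδ_assoc _ _ _ _ _ _)

theorem δ₁_b₀ (x : C) : X.δ₁ (X.b₀ x) = X.b₀ (X.δ x) := by
  have h : X.τ (X.δ₁ (X.Δ x)) = X.δ₁ (X.τ (X.Δ x)) := ZGrading.swap_tensorδ X.δ_odd X.δ_odd _
  have h' : X.Δ (X.δ x) = X.δ₁ (X.Δ x) := X.Δ_δ x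
  simp only [b₀, LinearMap.sub_apply, LinearMap.comp_apply, map_sub, h', h]

theorem δ₂_b₁ (t : C ⊗[k] C) : X.δ₂ (X.b₁ t) = X.b₁ (X.δ₁ t) := by
  have h1 : X.δ₂ (X.Δl C t) = X.Δl C (X.δ₁ t) := X.tensorδ_Δl X.δ t
  have h2 : X.δ₂ (LinearMap.lTensor C X.Δ t) = LinearMap.lTensor C X.Δ (X.δ₁ t) :=
    X.tensorδ_lTensor (fun m => (X.Δ_δ m).symm) t
  simp only [b₁, LinearMap.sub_apply, LinearMap.add_apply, LinearMap.comp_apply, map_sub, map_add,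
    h1, h2, δ₂_rot₂]

theorem δ₃_b₂ (t : C ⊗[k] (C ⊗[k] C)) : X.δ₃ (X.b₂ t) = X.b₂ (X.δ₂ t) := by
  have h1 : X.δ₃ (X.Δl (C ⊗[k] C) t) = X.Δl (C ⊗[k] C) (X.δ₂ t) := X.tensorδ_Δl X.δ₁ t
  have h2 : X.δ₃ (LinearMap.lTensor C (X.Δl C) t) = LinearMap.lTensor C (X.Δl C) (X.δ₂ t) :=
    X.tensorδ_lTensor (fun m => X.tensorδ_Δl X.δ m) t
  have h3 : X.δ₃ (LinearMap.lTensor C (LinearMap.lTensor C X.Δ) t)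
      = LinearMap.lTensor C (LinearMap.lTensor C X.Δ) (X.δ₂ t) :=
    X.tensorδ_lTensor (fun m => X.tensorδ_lTensor (fun m => (X.Δ_δ m).symm) m) t
  simp only [b₂, LinearMap.sub_apply, LinearMap.add_apply, LinearMap.comp_apply, map_sub, map_add,
    h1, h2, h3, δ₃_rot₃]

theorem d_tensorδ (δM : M →ₗ[k] M) (t : C ⊗[k] M) :
    X.d M (X.tensorδ X.δ δM t) = δM (X.d M t) := by
  induction t using TensorProduct.induction_on with
  | zero => simp
  | add x y hx hy => simp only [map_add, hx, hy]
  | tmul c m => simp [d, ZGrading.tensorδ_tmul, X.η_δ]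

theorem δ_mem_Ω₁ {t : C ⊗[k] C} (ht : t ∈ X.Ω₁) : X.δ₁ t ∈ X.Ω₁ := by
  rw [Ω₁, LinearMap.mem_ker] at ht ⊢
  have := X.tensorδ_lTensor (δM := X.δ) (δN := (0 : k →ₗ[k] k)) (f := X.η)
    (fun m => (X.η_δ m).symm) t
  rw [ht, map_zero] at this
  exact this.symm

theorem δ_mem_Ω₂ {t : C ⊗[k] (C ⊗[k] C)} (ht : t ∈ X.Ω₂) : X.δ₂ t ∈ X.Ω₂ := by
  rw [Ω₂, Submodule.mem_inf, LinearMap.mem_ker, LinearMap.mem_ker] at ht ⊢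
  constructor
  · have := X.tensorδ_lTensor (δM := X.δ₁) (δN := X.δ) (f := X.d C)
      (fun m => (X.d_tensorδ X.δ m).symm) t
    rw [ht.1, map_zero] at this
    exact this.symm
  · have := X.tensorδ_lTensor (δM := X.δ₁) (δN := X.tensorδ X.δ (0 : k →ₗ[k] k))
      (f := X.η.lTensor C)
      (fun m => X.tensorδ_lTensor (fun m => (X.η_δ m).symm) m) t
    rw [ht.2, map_zero] at this
    exact this.symm

theorem map_ε_Δl {εM : M →ₗ[k] M} (t : C ⊗[k] M) :
    TensorProduct.map X.ε (TensorProduct.map X.ε εM) (X.Δl M t)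
      = X.Δl M (TensorProduct.map X.ε εM t) := by
  induction t using TensorProduct.induction_on with
  | zero => simp
  | add x y hx hy => simp only [map_add, hx, hy]
  | tmul c m =>
    simp only [Δl, LinearMap.comp_apply, LinearMap.rTensor_tmul, TensorProduct.map_tmul, X.Δ_ε,
      LinearEquiv.coe_coe]
    generalize X.Δ c = u
    induction u using TensorProduct.induction_on with
    | zero => simp
    | add x y hx hy => simp only [map_add, add_tmul, hx, hy]
    | tmul a b => simp

theorem map_ε_lTensor {εM : M →ₗ[k] M} {εN : N →ₗ[k] N} {f : M →ₗ[k] N}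
    (hf : ∀ m, εN (f m) = f (εM m)) (t : C ⊗[k] M) :
    TensorProduct.map X.ε εN (LinearMap.lTensor C f t)
      = LinearMap.lTensor C f (TensorProduct.map X.ε εM t) := by
  induction t using TensorProduct.induction_on with
  | zero => simp
  | add x y hx hy => simp only [map_add, hx, hy]
  | tmul c m => simp [hf]

theorem ε₂_rot₂ (t : C ⊗[k] (C ⊗[k] C)) : X.ε₂ (X.rot₂ t) = X.rot₂ (X.ε₂ t) := by
  suffices h : X.ε₂ ∘ₗ X.rot₂ = X.rot₂ ∘ₗ X.ε₂ from LinearMap.congr_fun h t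
  ext a b c
  simp [rot₂, ε₂, ε₁, ZGrading.swap_tmul, G₁, ZGrading.tensor_ε]

theorem ε₃_rot₃ (t : C ⊗[k] (C ⊗[k] (C ⊗[k] C))) : X.ε₃ (X.rot₃ t) = X.rot₃ (X.ε₃ t) := by
  suffices h : X.ε₃ ∘ₗ X.rot₃ = X.rot₃ ∘ₗ X.ε₃ from LinearMap.congr_fun h t
  ext a b c e
  simp [rot₃, ε₃, ε₂, ε₁, ZGrading.swap_tmul, G₁, G₂, ZGrading.tensor_ε]

theorem ε₁_b₀ (x : C) : X.ε₁ (X.b₀ x) = X.b₀ (X.ε x) := by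
  have h : X.τ (X.ε₁ (X.Δ x)) = X.ε₁ (X.τ (X.Δ x)) := ZGrading.swap_ε _
  have h' : X.Δ (X.ε x) = X.ε₁ (X.Δ x) := X.Δ_ε x
  simp only [b₀, LinearMap.sub_apply, LinearMap.comp_apply, map_sub, h', h]

theorem ε₂_b₁ (t : C ⊗[k] C) : X.ε₂ (X.b₁ t) = X.b₁ (X.ε₁ t) := by
  have h1 : X.ε₂ (X.Δl C t) = X.Δl C (X.ε₁ t) := X.map_ε_Δl t
  have h2 : X.ε₂ (LinearMap.lTensor C X.Δ t) = LinearMap.lTensor C X.Δ (X.ε₁ t) :=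
    X.map_ε_lTensor (fun m => (X.Δ_ε m).symm) t
  simp only [b₁, LinearMap.sub_apply, LinearMap.add_apply, LinearMap.comp_apply, map_sub, map_add,
    h1, h2, ε₂_rot₂]

theorem ε₃_b₂ (t : C ⊗[k] (C ⊗[k] C)) : X.ε₃ (X.b₂ t) = X.b₂ (X.ε₂ t) := by
  have h1 : X.ε₃ (X.Δl (C ⊗[k] C) t) = X.Δl (C ⊗[k] C) (X.ε₂ t) := X.map_ε_Δl t
  have h2 : X.ε₃ (LinearMap.lTensor C (X.Δl C) t) = LinearMap.lTensor C (X.Δl C) (X.ε₂ t) :=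
    X.map_ε_lTensor (fun m => X.map_ε_Δl m) t
  have h3 : X.ε₃ (LinearMap.lTensor C (LinearMap.lTensor C X.Δ) t)
      = LinearMap.lTensor C (LinearMap.lTensor C X.Δ) (X.ε₂ t) :=
    X.map_ε_lTensor (fun m => X.map_ε_lTensor (fun m => (X.Δ_ε m).symm) m) t
  simp only [b₂, LinearMap.sub_apply, LinearMap.add_apply, LinearMap.comp_apply, map_sub, map_add,
    h1, h2, h3, ε₃_rot₃]

theorem d_map_ε (εM : M →ₗ[k] M) (t : C ⊗[k] M) :
    X.d M (TensorProduct.map X.ε εM t) = εM (X.d M t) := by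
  induction t using TensorProduct.induction_on with
  | zero => simp
  | add x y hx hy => simp only [map_add, hx, hy]
  | tmul c m => simp [d]

theorem ε_mem_Ω₁ {t : C ⊗[k] C} (ht : t ∈ X.Ω₁) : X.ε₁ t ∈ X.Ω₁ := by
  rw [Ω₁, LinearMap.mem_ker] at ht ⊢
  have := X.map_ε_lTensor (εM := X.ε) (εN := (LinearMap.id : k →ₗ[k] k)) (f := X.η)
    (fun m => (X.η_ε m).symm) t
  rw [ht, map_zero] at this
  exact this.symm

theorem ε_mem_Ω₂ {t : C ⊗[k] (C ⊗[k] C)} (ht : t ∈ X.Ω₂) : X.ε₂ t ∈ X.Ω₂ := by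
  rw [Ω₂, Submodule.mem_inf, LinearMap.mem_ker, LinearMap.mem_ker] at ht ⊢
  constructor
  · have := X.map_ε_lTensor (εM := X.ε₁) (εN := X.ε) (f := X.d C)
      (fun m => (X.d_map_ε X.ε m).symm) t
    rw [ht.1, map_zero] at this
    exact this.symm
  · have := X.map_ε_lTensor (εM := X.ε₁) (εN := TensorProduct.map X.ε (LinearMap.id : k →ₗ[k] k))
      (f := X.η.lTensor C)
      (fun m => X.map_ε_lTensor (fun m => (X.η_ε m).symm) m) t
    rw [ht.2, map_zero] at this
    exact this.symm

theorem δ_mem_Ω₁nat {t : C ⊗[k] C} (ht : t ∈ X.Ω₁nat) : X.δ₁ t ∈ X.Ω₁nat := by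
  have h := LinearMap.mem_ker.1 ht.2
  exact ⟨X.δ_mem_Ω₁ ht.1, LinearMap.mem_ker.2 (by rw [← δ₂_b₁, h, map_zero])⟩

theorem ε_mem_Ω₁nat {t : C ⊗[k] C} (ht : t ∈ X.Ω₁nat) : X.ε₁ t ∈ X.Ω₁nat := by
  have h := LinearMap.mem_ker.1 ht.2
  exact ⟨X.ε_mem_Ω₁ ht.1, LinearMap.mem_ker.2 (by rw [← ε₂_b₁, h, map_zero])⟩

theorem b₀_mem_Ω₁nat (x : C) : X.b₀ x ∈ X.Ω₁nat :=
  ⟨X.b₀_mem x, LinearMap.mem_ker.2 (X.b₁_b₀ x)⟩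

theorem mem_Ω₁dot {t : C ⊗[k] C} : t ∈ X.Ω₁dot ↔
    t ∈ X.Ω₁ ∧ (2 : k) • X.d (C ⊗[k] C) (X.b₁ t) + X.b₀ (X.d C t) = 0 := Iff.rfl

theorem mem_Ω₂nat {t : C ⊗[k] (C ⊗[k] C)} : t ∈ X.Ω₂nat ↔
    t ∈ X.Ω₂ ∧ X.b₂ t = 0 ∧ X.b₁ (X.d (C ⊗[k] C) t) = 0 := and_assoc

theorem Ω₁nat_le_Ω₁dot : X.Ω₁nat ≤ X.Ω₁dot := by
  intro t ht
  have h := LinearMap.mem_ker.1 ht.2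
  exact X.mem_Ω₁dot.2 ⟨ht.1, by rw [h, map_zero, smul_zero, X.b₀_d h, add_zero]⟩

theorem δ_mem_Ω₁dot {t : C ⊗[k] C} (ht : t ∈ X.Ω₁dot) : X.δ₁ t ∈ X.Ω₁dot := by
  rw [mem_Ω₁dot] at ht ⊢
  refine ⟨X.δ_mem_Ω₁ ht.1, ?_⟩
  have h1 : X.d (C ⊗[k] C) (X.δ₂ (X.b₁ t)) = X.δ₁ (X.d (C ⊗[k] C) (X.b₁ t)) :=
    X.d_tensorδ X.δ₁ _
  have h2 : X.d C (X.δ₁ t) = X.δ (X.d C t) := X.d_tensorδ X.δ _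
  rw [← δ₂_b₁, h1, h2, ← δ₁_b₀, ← map_smul, ← map_add, ht.2, map_zero]

theorem ε_mem_Ω₁dot {t : C ⊗[k] C} (ht : t ∈ X.Ω₁dot) : X.ε₁ t ∈ X.Ω₁dot := by
  rw [mem_Ω₁dot] at ht ⊢
  refine ⟨X.ε_mem_Ω₁ ht.1, ?_⟩
  have h1 : X.d (C ⊗[k] C) (X.ε₂ (X.b₁ t)) = X.ε₁ (X.d (C ⊗[k] C) (X.b₁ t)) :=
    X.d_map_ε X.ε₁ _
  have h2 : X.d C (X.ε₁ t) = X.ε (X.d C t) := X.d_map_ε X.ε _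
  rw [← ε₂_b₁, h1, h2, ← ε₁_b₀, ← map_smul, ← map_add, ht.2, map_zero]

theorem δ_mem_Ω₂nat {t : C ⊗[k] (C ⊗[k] C)} (ht : t ∈ X.Ω₂nat) : X.δ₂ t ∈ X.Ω₂nat := by
  rw [mem_Ω₂nat] at ht ⊢
  have h1 : X.d (C ⊗[k] C) (X.δ₂ t) = X.δ₁ (X.d (C ⊗[k] C) t) := X.d_tensorδ X.δ₁ _
  exact ⟨X.δ_mem_Ω₂ ht.1, by rw [← δ₃_b₂, ht.2.1, map_zero],
    by rw [h1, ← δ₂_b₁, ht.2.2, map_zero]⟩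

theorem ε_mem_Ω₂nat {t : C ⊗[k] (C ⊗[k] C)} (ht : t ∈ X.Ω₂nat) : X.ε₂ t ∈ X.Ω₂nat := by
  rw [mem_Ω₂nat] at ht ⊢
  have h1 : X.d (C ⊗[k] C) (X.ε₂ t) = X.ε₁ (X.d (C ⊗[k] C) t) := X.d_map_ε X.ε₁ _
  exact ⟨X.ε_mem_Ω₂ ht.1, by rw [← ε₃_b₂, ht.2.1, map_zero],
    by rw [h1, ← ε₂_b₁, ht.2.2, map_zero]⟩

theorem d_mem_Ω₁dot {t : C ⊗[k] (C ⊗[k] C)} (ht : t ∈ X.Ω₂nat) :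
    X.d (C ⊗[k] C) t ∈ X.Ω₁dot := by
  rw [mem_Ω₂nat] at ht
  rw [mem_Ω₁dot, ht.2.2, X.d_d ht.1]
  exact ⟨X.d_mem ht.1, by simp⟩

theorem b₁_mem_Ω₂nat [NeZero (2 : k)] {t : C ⊗[k] C} (ht : t ∈ X.Ω₁dot) :
    X.b₁ t ∈ X.Ω₂nat := by
  rw [mem_Ω₁dot] at ht
  refine X.mem_Ω₂nat.2 ⟨X.b₁_mem ht.1, X.b₂_b₁ t, ?_⟩
  have h := congrArg X.b₁ ht.2
  rw [map_add, map_smul, b₁_b₀, map_zero, add_zero] at h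
  exact (smul_eq_zero.1 h).resolve_left (NeZero.ne 2)

end Commutation

end DGCoalgebra

/-- The structure of a supercomplex on the `k`-linear space `V`, where `2` is invertible in `k`.
The `ℤ/2`-grading is given by its involution `γ`, which is `1` on the even and `-1` on the odd
part. The differential is odd, i.e. it anticommutes with `γ`, and its square is zero. -/
structure SuperComplex (k V : Type*) [Field k] [AddCommGroup V] [Module k V] where
  /-- the grading involution -/
  γ : V →ₗ[k] V
  /-- the differential -/
  diff : V →ₗ[k] V
  γ_γ : ∀ v, γ (γ v) = v
  γ_diff : ∀ v, γ (diff v) = - diff (γ v)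
  diff_diff : ∀ v, diff (diff v) = 0

namespace SuperComplex

variable {k V W : Type*} [Field k] [AddCommGroup V] [Module k V] [AddCommGroup W] [Module k W]

/-- A morphism of supercomplexes: an even linear map that commutes with the differentials. -/
structure Hom (L : SuperComplex k V) (M : SuperComplex k W) where
  toLin : V →ₗ[k] W
  map_γ : ∀ v, toLin (L.γ v) = M.γ (toLin v)
  map_diff : ∀ v, toLin (L.diff v) = M.diff (toLin v)

/-- The tensor product of two supercomplexes, with differential
`v ⊗ w ↦ ∂ v ⊗ w + (-1)^|v| v ⊗ ∂ w`. -/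
def tensor (L : SuperComplex k V) (M : SuperComplex k W) : SuperComplex k (V ⊗[k] W) where
  γ := TensorProduct.map L.γ M.γ
  diff := TensorProduct.map L.diff LinearMap.id + TensorProduct.map L.γ M.diff
  γ_γ := by
    intro t
    induction t using TensorProduct.induction_on with
    | zero => simp
    | add x y hx hy => simp only [map_add, hx, hy]
    | tmul v w => simp [L.γ_γ, M.γ_γ]
  γ_diff := by
    intro t
    induction t using TensorProduct.induction_on with
    | zero => simp
    | add x y hx hy => simp only [map_add, hx, hy]; abel
    | tmul v w => simp [L.γ_diff, M.γ_diff, neg_tmul, tmul_neg]; abel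
  diff_diff := by
    intro t
    induction t using TensorProduct.induction_on with
    | zero => simp
    | add x y hx hy => simp only [map_add, hx, hy, add_zero]
    | tmul v w => simp [L.γ_diff, L.diff_diff, M.diff_diff, neg_tmul]

end SuperComplex

namespace DGCoalgebra

variable {k C : Type*} [Field k] [AddCommGroup C] [Module k C] (X : DGCoalgebra k C)

/-- The supercomplex `X̂(C)`, the total complex of the `X`-complex `C ⇄ Ω¹C_♮`. Its elements are
the pairs `ω₀ + ω₁`, the parity of `ω₀` is that of its degree, the parity of `ω₁` is opposite to
that of its degree, and
`∂(ω₀ + ω₁) = (δ ω₀ + d ω₁) + (b ω₀ - δ ω₁)`. -/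
def Xhat : SuperComplex k (C × X.Ω₁nat) where
  γ := X.ε.prodMap (-(X.ε₁.restrict fun _ => X.ε_mem_Ω₁nat))
  diff := LinearMap.prod
    (X.δ ∘ₗ LinearMap.fst k C X.Ω₁nat
      + X.d C ∘ₗ X.Ω₁nat.subtype ∘ₗ LinearMap.snd k C X.Ω₁nat)
    (X.b₀.codRestrict X.Ω₁nat X.b₀_mem_Ω₁nat ∘ₗ LinearMap.fst k C X.Ω₁nat
      - (X.δ₁.restrict fun _ => X.δ_mem_Ω₁nat) ∘ₗ LinearMap.snd k C X.Ω₁nat)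
  γ_γ := by
    rintro ⟨x, t⟩
    refine Prod.ext ?_ (Subtype.ext ?_)
    · simp
    · simp [X.ε₁_ε₁]
  γ_diff := by
    rintro ⟨x, t⟩
    have h : X.d C (X.ε₁ t) = X.ε (X.d C t) := X.d_map_ε X.ε _
    refine Prod.ext ?_ (Subtype.ext ?_)
    · simp [X.δ_odd.ε, h]; abel
    · have h' := X.δ₁_odd.ε t
      rw [X.G₁_ε] at h'
      simp [X.ε₁_b₀, h']; abel
  diff_diff := by
    rintro ⟨x, t⟩
    have h : X.d C (X.δ₁ t) = X.δ (X.d C t) := X.d_tensorδ X.δ _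
    refine Prod.ext ?_ (Subtype.ext ?_)
    · simp [X.δ_δ, X.d_b₀, h]
    · simp [X.δ₁_δ₁, X.δ₁_b₀, X.b₀_d (LinearMap.mem_ker.1 t.2.2)]

/-- The supercomplex `X̂²(C)`, the total complex of `C ⊕ Ω²C_♮ ⇄ Ω̇¹C`. Its elements are the
triples `ω₀ + ω₂ + ω₁`, the parities of `ω₀` and `ω₂` are those of their degrees, the parity of
`ω₁` is opposite to that of its degree, and
`∂(ω₀ + ω₂ + ω₁) = (δ ω₀ + d ω₁) + (δ ω₂ + b ω₁) + (b ω₀ + 2 d ω₂ - δ ω₁)`. -/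
def Xhat2 [NeZero (2 : k)] : SuperComplex k (C × X.Ω₂nat × X.Ω₁dot) where
  γ := X.ε.prodMap ((X.ε₂.restrict fun _ => X.ε_mem_Ω₂nat).prodMap
    (-(X.ε₁.restrict fun _ => X.ε_mem_Ω₁dot)))
  diff :=
    let p₀ := LinearMap.fst k C (X.Ω₂nat × X.Ω₁dot)
    let p₂ := LinearMap.fst k X.Ω₂nat X.Ω₁dot ∘ₗ LinearMap.snd k C (X.Ω₂nat × X.Ω₁dot)
    let p₁ := LinearMap.snd k X.Ω₂nat X.Ω₁dot ∘ₗ LinearMap.snd k C (X.Ω₂nat × X.Ω₁dot)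
    LinearMap.prod
      (X.δ ∘ₗ p₀ + X.d C ∘ₗ X.Ω₁dot.subtype ∘ₗ p₁)
      (LinearMap.prod
        ((X.δ₂.restrict fun _ => X.δ_mem_Ω₂nat) ∘ₗ p₂
          + (X.b₁.restrict fun _ => X.b₁_mem_Ω₂nat) ∘ₗ p₁)
        (X.b₀.codRestrict X.Ω₁dot (fun x => X.Ω₁nat_le_Ω₁dot (X.b₀_mem_Ω₁nat x)) ∘ₗ p₀
          + (2 : k) • ((X.d (C ⊗[k] C)).restrict fun _ => X.d_mem_Ω₁dot) ∘ₗ p₂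
          - (X.δ₁.restrict fun _ => X.δ_mem_Ω₁dot) ∘ₗ p₁))
  γ_γ := by
    rintro ⟨x, s, t⟩
    refine Prod.ext ?_ (Prod.ext (Subtype.ext ?_) (Subtype.ext ?_))
    · simp
    · simp [X.ε₂_ε₂]
    · simp [X.ε₁_ε₁]
  γ_diff := by
    rintro ⟨x, s, t⟩
    have h : X.d C (X.ε₁ t) = X.ε (X.d C t) := X.d_map_ε X.ε _
    have h1 : X.d (C ⊗[k] C) (X.ε₂ s) = X.ε₁ (X.d (C ⊗[k] C) s) := X.d_map_ε X.ε₁ _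
    have h2 := X.δ₁_odd.ε t
    have h3 := X.δ₂_odd.ε s
    rw [X.G₁_ε] at h2
    rw [X.G₂_ε] at h3
    refine Prod.ext ?_ (Prod.ext (Subtype.ext ?_) (Subtype.ext ?_))
    · simp [X.δ_odd.ε, h]; abel
    · simp [X.ε₂_b₁, h3]; abel
    · simp [X.ε₁_b₀, h1, h2]; abel
  diff_diff := by
    rintro ⟨x, s, t⟩
    have h : X.d C (X.δ₁ t) = X.δ (X.d C t) := X.d_tensorδ X.δ _
    have h1 : X.d (C ⊗[k] C) (X.δ₂ s) = X.δ₁ (X.d (C ⊗[k] C) s) := X.d_tensorδ X.δ₁ _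
    have hs := X.mem_Ω₂nat.1 s.2
    have ht := (X.mem_Ω₁dot.1 t.2).2
    have hd := X.d_d hs.1
    refine Prod.ext ?_ (Prod.ext (Subtype.ext ?_) (Subtype.ext ?_))
    · simp [X.δ_δ, X.d_b₀, h, hd]
    · simp [X.δ₂_δ₂, X.δ₂_b₁, X.b₁_b₀, hs.2.2]
    · simp [X.δ₁_δ₁, X.δ₁_b₀, h1]
      rw [← ht]; abel

/-- The inclusion `I : X̂(C) → X̂²(C)`, `I(ω₀ + ω₁) = ω₀ + 0 + ω₁`. -/
def incl [NeZero (2 : k)] : SuperComplex.Hom X.Xhat X.Xhat2 where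
  toLin := LinearMap.prodMap LinearMap.id
    (LinearMap.inr k X.Ω₂nat X.Ω₁dot ∘ₗ Submodule.inclusion X.Ω₁nat_le_Ω₁dot)
  map_γ := by
    rintro ⟨x, t⟩
    refine Prod.ext ?_ (Prod.ext (Subtype.ext ?_) (Subtype.ext ?_)) <;> simp [Xhat, Xhat2]
  map_diff := by
    rintro ⟨x, t⟩
    have := LinearMap.mem_ker.1 t.2.2
    refine Prod.ext ?_ (Prod.ext (Subtype.ext ?_) (Subtype.ext ?_)) <;> simp [Xhat, Xhat2, this]

end DGCoalgebra

end Complexes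

section Bar

variable {k A : Type*} [Field k] [NonUnitalRing A] [Module k A]

/-- Definition of a linear map on words by recursion on the first letter. -/
def wordRec {V : Type*} [AddCommGroup V] [Module k V] (v₀ : V)
    (s : A →ₗ[k] (TensorAlgebra k A × V) →ₗ[k] V) : TensorAlgebra k A →ₗ[k] V :=
  LinearMap.snd k (TensorAlgebra k A) V ∘ₗ
    LinearMap.applyₗ ((1, v₀) : TensorAlgebra k A × V) ∘ₗ
    (TensorAlgebra.lift k (A := Module.End k (TensorAlgebra k A × V))
      (LinearMap.mk₂ k (fun a q => (TensorAlgebra.ι k a * q.1, s a q))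
        (by intro a b q; simp [add_mul])
        (by intro r a q; simp)
        (by intro a p q; simp [mul_add])
        (by intro r a q; simp))).toLinearMap

theorem wordRec_one {V : Type*} [AddCommGroup V] [Module k V] (v₀ : V)
    (s : A →ₗ[k] (TensorAlgebra k A × V) →ₗ[k] V) : wordRec v₀ s 1 = v₀ := by
  simp [wordRec]

theorem word_mem {S : Submodule k (TensorAlgebra k A)} (h1 : 1 ∈ S)
    (h2 : ∀ a, ∀ x ∈ S, TensorAlgebra.ι k a * x ∈ S) (x : TensorAlgebra k A) : x ∈ S := by
  have : ∀ x : TensorAlgebra k A, ∀ y ∈ S, x * y ∈ S := by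
    intro x
    induction x using TensorAlgebra.induction with
    | algebraMap r => intro y hy; rw [← Algebra.smul_def]; exact S.smul_mem r hy
    | ι a => intro y hy; exact h2 a y hy
    | mul a b ha hb => intro y hy; rw [mul_assoc]; exact ha _ (hb _ hy)
    | add a b ha hb => intro y hy; rw [add_mul]; exact S.add_mem (ha _ hy) (hb _ hy)
  simpa using this x 1 h1

theorem word_ext {V : Type*} [AddCommGroup V] [Module k V] {f g : TensorAlgebra k A →ₗ[k] V}
    (h1 : f 1 = g 1)
    (h2 : ∀ a x, f x = g x → f (TensorAlgebra.ι k a * x) = g (TensorAlgebra.ι k a * x)) :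
    f = g := by
  ext1 x
  have : x ∈ LinearMap.ker (f - g) := by
    refine word_mem ?_ ?_ x
    · simp [h1]
    · intro a x hx
      rw [LinearMap.mem_ker, LinearMap.sub_apply, sub_eq_zero] at hx ⊢
      exact h2 a x hx
  simpa [sub_eq_zero] using this

theorem wordRec_ι_mul {V : Type*} [AddCommGroup V] [Module k V] (v₀ : V)
    (s : A →ₗ[k] (TensorAlgebra k A × V) →ₗ[k] V) (a : A) (x : TensorAlgebra k A) :
    wordRec v₀ s (TensorAlgebra.ι k a * x) = s a (x, wordRec v₀ s x) := by
  have key : ∀ x : TensorAlgebra k A,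
      LinearMap.fst k (TensorAlgebra k A) V (LinearMap.applyₗ ((1, v₀) : TensorAlgebra k A × V)
      ((TensorAlgebra.lift k (A := Module.End k (TensorAlgebra k A × V))
      (LinearMap.mk₂ k (fun a q => (TensorAlgebra.ι k a * q.1, s a q))
        (by intro a b q; simp [add_mul])
        (by intro r a q; simp)
        (by intro a p q; simp [mul_add])
        (by intro r a q; simp))).toLinearMap x)) = x := by
    intro x
    have := word_ext (f := LinearMap.fst k (TensorAlgebra k A) V ∘ₗ
      LinearMap.applyₗ ((1, v₀) : TensorAlgebra k A × V) ∘ₗ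
      ((TensorAlgebra.lift k (A := Module.End k (TensorAlgebra k A × V))
      (LinearMap.mk₂ k (fun a q => (TensorAlgebra.ι k a * q.1, s a q))
        (by intro a b q; simp [add_mul])
        (by intro r a q; simp)
        (by intro a p q; simp [mul_add])
        (by intro r a q; simp))).toLinearMap)) (g := LinearMap.id) (by simp) (by
          intro a x hx
          simp only [LinearMap.comp_apply, AlgHom.toLinearMap_apply, LinearMap.applyₗ_apply_apply,
            LinearMap.fst_apply, LinearMap.id_apply] at hx
          simp [hx])
    exact LinearMap.congr_fun this x
  have h := key x
  simp only [LinearMap.applyₗ_apply_apply, LinearMap.fst_apply, AlgHom.toLinearMap_apply] at h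
  simp only [wordRec, LinearMap.comp_apply, AlgHom.toLinearMap_apply, map_mul,
    TensorAlgebra.lift_ι_apply, LinearMap.applyₗ_apply_apply, LinearMap.snd_apply,
    Module.End.mul_apply, LinearMap.mk₂_apply]
  congr 1
  exact Prod.ext h rfl

/-- The action of a letter on the first factor of `T ⊗ V`, `a, w ⊗ v ↦ a w ⊗ v`. -/
def consL (V : Type*) [AddCommGroup V] [Module k V] :
    A →ₗ[k] TensorAlgebra k A ⊗[k] V →ₗ[k] TensorAlgebra k A ⊗[k] V :=
  LinearMap.rTensorHom V ∘ₗ LinearMap.mul k (TensorAlgebra k A) ∘ₗ TensorAlgebra.ι k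

@[simp] theorem consL_tmul {V : Type*} [AddCommGroup V] [Module k V] (a : A)
    (x : TensorAlgebra k A) (v : V) :
    consL V a (x ⊗ₜ[k] v) = (TensorAlgebra.ι k a * x) ⊗ₜ v := rfl

variable (k A)

/-- The deconcatenation coproduct
`Δ(a₁, …, aₙ) = ∑ᵢ (a₁, …, aᵢ) ⊗ (aᵢ₊₁, …, aₙ)` on words, defined by
`Δ(1) = 1 ⊗ 1` and `Δ(a w) = 1 ⊗ a w + ∑ a w' ⊗ w''`. -/
def deconc : TensorAlgebra k A →ₗ[k] TensorAlgebra k A ⊗[k] TensorAlgebra k A :=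
  wordRec (1 ⊗ₜ 1) (LinearMap.mk₂ k
    (fun a q => 1 ⊗ₜ (TensorAlgebra.ι k a * q.1) + consL (TensorAlgebra k A) a q.2)
    (by intro a b q; simp [add_mul, tmul_add]; abel)
    (by intro r a q; simp)
    (by intro a p q; simp [mul_add, tmul_add]; abel)
    (by intro r a q; simp))

/-- The splitting of the first letter, `(a₁, …, aₙ) ↦ a₁ ⊗ (a₂, …, aₙ)`, and `1 ↦ 0`. -/
def firstLetter : TensorAlgebra k A →ₗ[k] A ⊗[k] TensorAlgebra k A :=
  wordRec 0 (LinearMap.mk₂ k (fun a q => a ⊗ₜ q.1)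
    (by intro a b q; simp [add_tmul])
    (by intro r a q; simp [smul_tmul'])
    (by intro a p q; simp [tmul_add])
    (by intro r a q; simp))

/-- The counit of the tensor coalgebra: the projection onto the words of length zero. -/
def emptyWord : TensorAlgebra k A →ₗ[k] k := TensorAlgebra.algebraMapInv.toLinearMap

/-- The splitting of the last letter, `(a₁, …, aₙ) ↦ (a₁, …, aₙ₋₁) ⊗ aₙ`, and `1 ↦ 0`, defined by
recursion on the length of words. -/
def lastLetter : TensorAlgebra k A →ₗ[k] TensorAlgebra k A ⊗[k] A :=
  wordRec 0 (LinearMap.mk₂ k (fun a q => emptyWord k A q.1 • (1 ⊗ₜ a) + consL A a q.2)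
    (by intro a b q; simp [tmul_add]; abel)
    (by intro r a q; simp [smul_comm r])
    (by intro a p q; simp [add_smul]; abel)
    (by intro r a q; simp [mul_smul]))

variable {k A}

@[simp] theorem deconc_one : deconc k A 1 = 1 ⊗ₜ 1 := wordRec_one _ _

@[simp] theorem deconc_cons (a : A) (x : TensorAlgebra k A) :
    deconc k A (TensorAlgebra.ι k a * x) = 1 ⊗ₜ (TensorAlgebra.ι k a * x) +
      consL (TensorAlgebra k A) a (deconc k A x) := wordRec_ι_mul _ _ _ _

@[simp] theorem firstLetter_one : firstLetter k A 1 = 0 := wordRec_one _ _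

@[simp] theorem firstLetter_cons (a : A) (x : TensorAlgebra k A) :
    firstLetter k A (TensorAlgebra.ι k a * x) = a ⊗ₜ x := wordRec_ι_mul _ _ _ _

@[simp] theorem lastLetter_one : lastLetter k A 1 = 0 := wordRec_one _ _

@[simp] theorem lastLetter_cons (a : A) (x : TensorAlgebra k A) :
    lastLetter k A (TensorAlgebra.ι k a * x)
      = emptyWord k A x • (1 ⊗ₜ a) + consL A a (lastLetter k A x) := wordRec_ι_mul _ _ _ _

@[simp] theorem emptyWord_one : emptyWord k A 1 = 1 := by simp [emptyWord]

@[simp] theorem emptyWord_cons (a : A) (x : TensorAlgebra k A) :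
    emptyWord k A (TensorAlgebra.ι k a * x) = 0 := by
  simp [emptyWord, TensorAlgebra.algebraMapInv]

/-- The degree of a word of length `n` is `-n`. -/
def barDeg (k A : Type*) [Field k] [NonUnitalRing A] [Module k A] (i : ℤ) :
    Submodule k (TensorAlgebra k A) :=
  if i ≤ 0 then LinearMap.range (TensorAlgebra.ι k : A →ₗ[k] TensorAlgebra k A) ^ i.natAbs else ⊥

theorem barDeg_neg (n : ℕ) : barDeg k A (-(n : ℤ))
    = LinearMap.range (TensorAlgebra.ι k : A →ₗ[k] TensorAlgebra k A) ^ n := by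
  simp [barDeg]

theorem barDeg_cases {i : ℤ} {x : TensorAlgebra k A} (hx : x ∈ barDeg k A i) :
    x = 0 ∨ ∃ n : ℕ, i = -(n : ℤ) ∧
      x ∈ LinearMap.range (TensorAlgebra.ι k : A →ₗ[k] TensorAlgebra k A) ^ n := by
  unfold barDeg at hx
  split_ifs at hx with h
  · exact Or.inr ⟨i.natAbs, by omega, hx⟩
  · exact Or.inl (by simpa using hx)

theorem one_mem_barDeg : (1 : TensorAlgebra k A) ∈ barDeg k A 0 := by
  simp [barDeg]

theorem cons_mem_barDeg {i : ℤ} {x : TensorAlgebra k A} (hx : x ∈ barDeg k A i) (a : A) {j : ℤ}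
    (hj : j = i - 1) : TensorAlgebra.ι k a * x ∈ barDeg k A j := by
  subst hj
  rcases barDeg_cases hx with rfl | ⟨n, rfl, hx'⟩
  · simp
  · have h : (-(n : ℤ) - 1) = -((n + 1 : ℕ) : ℤ) := by push_cast; ring
    rw [h, barDeg_neg, pow_succ']
    exact Submodule.mul_mem_mul (LinearMap.mem_range_self _ a) hx'

/-- Induction over homogeneous words. -/
theorem barDeg_induction {P : ℤ → TensorAlgebra k A → Prop}
    (h0 : ∀ i, P i 0) (h1 : P 0 1) (hs : ∀ i (r : k) x, P i x → P i (r • x))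
    (ha : ∀ i x y, P i x → P i y → P i (x + y))
    (hc : ∀ i a, ∀ x ∈ barDeg k A i, P i x → P (i - 1) (TensorAlgebra.ι k a * x))
    {i : ℤ} {x : TensorAlgebra k A} (hx : x ∈ barDeg k A i) : P i x := by
  rcases barDeg_cases hx with rfl | ⟨n, rfl, hx'⟩
  · exact h0 i
  · clear hx
    induction hx' using Submodule.pow_induction_on_left' with
    | algebraMap r =>
      rw [Algebra.algebraMap_eq_smul_one]
      exact hs _ _ _ (by simpa using h1)
    | add x y i hx hy ihx ihy =>
      exact ha _ _ _ ihx ihy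
    | mem_mul m hm i x hx ih =>
      obtain ⟨a, rfl⟩ := hm
      have hx' : x ∈ barDeg k A (-(i : ℤ)) := (barDeg_neg (k := k) (A := A) i).symm ▸ hx
      have h : (-((i + 1 : ℕ) : ℤ)) = -(i : ℤ) - 1 := by push_cast; ring
      rw [Nat.succ_eq_add_one, h]
      exact hc _ a x hx' ih

theorem barDeg_isInternal : DirectSum.IsInternal (barDeg k A) := by
  let φ : (DirectSum ℕ fun n =>
      ↥(LinearMap.range (TensorAlgebra.ι k : A →ₗ[k] TensorAlgebra k A) ^ n)) →ₗ[k]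
      DirectSum ℤ fun i => barDeg k A i :=
    DirectSum.toModule k ℕ _ fun n => DirectSum.lof k ℤ (fun i => barDeg k A i) (-(n : ℤ)) ∘ₗ
      Submodule.inclusion (barDeg_neg (k := k) (A := A) n).ge
  let e := DirectSum.decomposeLinearEquiv (R := k)
    (fun n : ℕ => LinearMap.range (TensorAlgebra.ι k : A →ₗ[k] TensorAlgebra k A) ^ n)
  have he : ∀ (n : ℕ) (x : TensorAlgebra k A)
      (hx : x ∈ LinearMap.range (TensorAlgebra.ι k : A →ₗ[k] TensorAlgebra k A) ^ n),
      φ (e x) = DirectSum.lof k ℤ (fun i => barDeg k A i) (-(n : ℤ))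
        ⟨x, (barDeg_neg (k := k) (A := A) n).ge hx⟩ := by
    intro n x hx
    have : e x = DirectSum.lof k ℕ (fun n =>
      ↥(LinearMap.range (TensorAlgebra.ι k : A →ₗ[k] TensorAlgebra k A) ^ n)) n ⟨x, hx⟩ :=
      DirectSum.decompose_of_mem _ hx
    rw [this, DirectSum.toModule_lof]
    rfl
  refine isInternal_of_splitting _ (φ ∘ₗ e.toLinearMap) ?_ ?_
  · intro x
    have h : DirectSum.coeLinearMap (barDeg k A) ∘ₗ φ = e.symm.toLinearMap := by
      apply DirectSum.linearMap_ext
      intro n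
      ext1 x
      simp only [φ, LinearMap.comp_apply, DirectSum.toModule_lof, DirectSum.coeLinearMap_lof]
      rw [LinearEquiv.coe_coe, LinearEquiv.eq_symm_apply]
      exact DirectSum.decompose_of_mem _ x.2
    have := LinearMap.congr_fun h (e x)
    simpa using this
  · intro i x hx
    rcases barDeg_cases hx with rfl | ⟨n, rfl, hx'⟩
    · rw [map_zero]
      exact (map_zero (DirectSum.lof k ℤ (fun i => barDeg k A i) i)).symm
    · exact he n x hx'

variable (k A) in
/-- The grading of the bar construction of an ungraded algebra. -/
def barGrading : ZGrading k (TensorAlgebra k A) where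
  deg := barDeg k A
  isInternal := barDeg_isInternal

theorem bar_ε_one : (barGrading k A).ε 1 = 1 := by
  rw [ZGrading.ε, (barGrading k A).weight_of_mem _ one_mem_barDeg]
  simp

theorem bar_ε_cons (a : A) (x : TensorAlgebra k A) :
    (barGrading k A).ε (TensorAlgebra.ι k a * x)
      = - (TensorAlgebra.ι k a * (barGrading k A).ε x) := by
  suffices h : (barGrading k A).ε ∘ₗ LinearMap.mulLeft k (TensorAlgebra.ι k a)
      = - (LinearMap.mulLeft k (TensorAlgebra.ι k a) ∘ₗ (barGrading k A).ε) from
    LinearMap.congr_fun h x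
  apply (barGrading k A).ext_of_homogeneous
  intro i x hx
  have hx' : TensorAlgebra.ι k a * x ∈ (barGrading k A).deg (i - 1) := cons_mem_barDeg hx a rfl
  simp only [LinearMap.comp_apply, LinearMap.neg_apply, LinearMap.mulLeft_apply]
  rw [ZGrading.ε, (barGrading k A).weight_of_mem _ hx, (barGrading k A).weight_of_mem _ hx']
  by_cases h : Even i <;> simp [h]

theorem consL_mem {n : ℤ} (a : A) {t : TensorAlgebra k A ⊗[k] TensorAlgebra k A}
    (ht : t ∈ (barGrading k A).tensorDeg (barGrading k A) n) :
    consL _ a t ∈ (barGrading k A).tensorDeg (barGrading k A) (n - 1) := by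
  refine ZGrading.map_mem_of_mem_tensorDeg _ _ _ _ n ?_ ht
  rintro i j v hv w hw rfl
  rw [consL_tmul]
  exact ZGrading.tmul_mem_tensorDeg _ _ (cons_mem_barDeg hv a rfl) hw (by ring)

theorem deconc_mem (n : ℤ) (x : TensorAlgebra k A) (hx : x ∈ (barGrading k A).deg n) :
    deconc k A x ∈ (barGrading k A).tensorDeg (barGrading k A) n := by
  refine barDeg_induction (P := fun n x =>
    deconc k A x ∈ (barGrading k A).tensorDeg (barGrading k A) n) ?_ ?_ ?_ ?_ ?_ hx
  · intro i; simp
  · rw [deconc_one]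
    exact ZGrading.tmul_mem_tensorDeg _ _ one_mem_barDeg one_mem_barDeg rfl
  · intro i r x h; rw [map_smul]; exact Submodule.smul_mem _ _ h
  · intro i x y h h'; rw [map_add]; exact Submodule.add_mem _ h h'
  · intro i a x hx h
    rw [deconc_cons]
    refine Submodule.add_mem _ ?_ (consL_mem a h)
    exact ZGrading.tmul_mem_tensorDeg _ _ one_mem_barDeg (cons_mem_barDeg hx a rfl) (by ring)

theorem emptyWord_eq_zero (n : ℤ) (hn : n ≠ 0) (x : TensorAlgebra k A)
    (hx : x ∈ (barGrading k A).deg n) : emptyWord k A x = 0 := by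
  refine barDeg_induction (P := fun n x => n ≠ 0 → emptyWord k A x = 0) ?_ ?_ ?_ ?_ ?_ hx hn
  · intro i _; simp
  · intro h; exact absurd rfl h
  · intro i r x h hi; rw [map_smul, h hi, smul_zero]
  · intro i x y h h' hi; rw [map_add, h hi, h' hi, add_zero]
  · intro i a x hx h hi; simp

theorem deconc_coassoc (x : TensorAlgebra k A) :
    TensorProduct.assoc k _ _ _ ((deconc k A).rTensor _ (deconc k A x))
      = (deconc k A).lTensor _ (deconc k A x) := by
  suffices h : (TensorProduct.assoc k _ _ _).toLinearMap ∘ₗ (deconc k A).rTensor _ ∘ₗ deconc k A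
      = (deconc k A).lTensor _ ∘ₗ deconc k A from LinearMap.congr_fun h x
  apply word_ext
  · simp
  · intro a x hx
    have h1 : ∀ t : TensorAlgebra k A ⊗[k] TensorAlgebra k A,
        TensorProduct.assoc k _ _ _ ((deconc k A).rTensor _ (consL _ a t))
        = 1 ⊗ₜ consL _ a t
          + consL _ a (TensorProduct.assoc k _ _ _ ((deconc k A).rTensor _ t)) := by
      intro t
      induction t using TensorProduct.induction_on with
      | zero => simp
      | add x y hx hy => simp only [map_add, tmul_add, hx, hy]; abel
      | tmul p q =>
        simp only [consL_tmul, LinearMap.rTensor_tmul, deconc_cons, add_tmul, map_add,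
          TensorProduct.assoc_tmul]
        congr 1
        generalize deconc k A p = u
        induction u using TensorProduct.induction_on with
        | zero => simp
        | add x y hx hy => simp only [map_add, add_tmul, hx, hy]
        | tmul a b => simp
    have h2 : ∀ t : TensorAlgebra k A ⊗[k] TensorAlgebra k A,
        (deconc k A).lTensor _ (consL _ a t) = consL _ a ((deconc k A).lTensor _ t) := by
      intro t
      induction t using TensorProduct.induction_on with
      | zero => simp
      | add x y hx hy => simp only [map_add, hx, hy]
      | tmul p q => simp
    simp only [LinearMap.comp_apply, LinearEquiv.coe_coe] at hx ⊢
    rw [deconc_cons, map_add, map_add, map_add, h1, h2, hx]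
    simp [tmul_add]
    abel

theorem deconc_counit_left (x : TensorAlgebra k A) :
    TensorProduct.lid k _ ((emptyWord k A).rTensor _ (deconc k A x)) = x := by
  suffices h : (TensorProduct.lid k _).toLinearMap ∘ₗ (emptyWord k A).rTensor _ ∘ₗ deconc k A
      = LinearMap.id from LinearMap.congr_fun h x
  apply word_ext
  · simp
  · intro a x _
    have h1 : ∀ t : TensorAlgebra k A ⊗[k] TensorAlgebra k A,
        (emptyWord k A).rTensor _ (consL _ a t) = 0 := by
      intro t
      induction t using TensorProduct.induction_on with
      | zero => simp
      | add x y hx hy => simp only [map_add, hx, hy, add_zero]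
      | tmul p q => simp
    simp [h1]

theorem deconc_counit_right (x : TensorAlgebra k A) :
    TensorProduct.rid k _ ((emptyWord k A).lTensor _ (deconc k A x)) = x := by
  suffices h : (TensorProduct.rid k _).toLinearMap ∘ₗ (emptyWord k A).lTensor _ ∘ₗ deconc k A
      = LinearMap.id from LinearMap.congr_fun h x
  apply word_ext
  · simp
  · intro a x hx
    have h1 : ∀ t : TensorAlgebra k A ⊗[k] TensorAlgebra k A,
        TensorProduct.rid k _ ((emptyWord k A).lTensor _ (consL _ a t))
          = TensorAlgebra.ι k a * TensorProduct.rid k _ ((emptyWord k A).lTensor _ t) := by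
      intro t
      induction t using TensorProduct.induction_on with
      | zero => simp
      | add x y hx hy => simp only [map_add, hx, hy, mul_add]
      | tmul p q => simp
    simp only [LinearMap.comp_apply, LinearEquiv.coe_coe, LinearMap.id_apply] at hx ⊢
    rw [deconc_cons, map_add, map_add, h1, hx]
    simp

variable [IsScalarTower k A A] [SMulCommClass k A A]

/-- The multiplication of the first letter of a word by an element of `A`,
`a, (a₁, …, aₙ) ↦ (a a₁, a₂, …, aₙ)`, and `a, 1 ↦ 0`. -/
def mulFirst (a : A) : TensorAlgebra k A →ₗ[k] TensorAlgebra k A :=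
  LinearMap.mul' k (TensorAlgebra k A) ∘ₗ
    TensorProduct.map (TensorAlgebra.ι k ∘ₗ LinearMap.mul k A a) LinearMap.id ∘ₗ firstLetter k A

variable (k A) in
/-- The differential `b'(a₁, …, aₙ) = ∑ᵢ (-1)^(i-1) (a₁, …, aᵢ aᵢ₊₁, …, aₙ)` of the bar
construction, defined by `b'(1) = 0` and `b'(a w) = a · w - a b'(w)`, where the product `a · w` is
that of `a` with the first letter of the word `w`. -/
def barDiff : TensorAlgebra k A →ₗ[k] TensorAlgebra k A :=
  wordRec 0 (LinearMap.mk₂ k (fun a q => mulFirst a q.1 - TensorAlgebra.ι k a * q.2)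
    (by intro a b q; simp [mulFirst, add_mul, LinearMap.comp_add, TensorProduct.map_add_left]; abel)
    (by intro r a q; simp [mulFirst, LinearMap.comp_smul, TensorProduct.map_smul_left, smul_sub])
    (by intro a p q; simp [mul_add]; abel)
    (by intro r a q; simp [smul_sub]))

@[simp] theorem mulFirst_one (a : A) : mulFirst (k := k) a 1 = 0 := by simp [mulFirst]

@[simp] theorem mulFirst_cons (a a' : A) (x : TensorAlgebra k A) :
    mulFirst a (TensorAlgebra.ι k a' * x) = TensorAlgebra.ι k (a * a') * x := by
  simp [mulFirst]

@[simp] theorem barDiff_one : barDiff k A 1 = 0 := wordRec_one _ _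

@[simp] theorem barDiff_cons (a : A) (x : TensorAlgebra k A) :
    barDiff k A (TensorAlgebra.ι k a * x)
      = mulFirst a x - TensorAlgebra.ι k a * barDiff k A x := wordRec_ι_mul _ _ _ _

theorem barDiff_mulFirst (a : A) (x : TensorAlgebra k A) :
    barDiff k A (mulFirst a x) = mulFirst a (barDiff k A x) := by
  have hm : ∀ (a a' : A) (y : TensorAlgebra k A), mulFirst (a * a') y
      = mulFirst a (mulFirst a' y) := by
    intro a a' y
    suffices h : mulFirst (k := k) (a * a') = mulFirst a ∘ₗ mulFirst a' from
      LinearMap.congr_fun h y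
    apply word_ext
    · simp
    · intro b z _
      simp [mul_assoc]
  suffices h : barDiff k A ∘ₗ mulFirst a = mulFirst a ∘ₗ barDiff k A from LinearMap.congr_fun h x
  apply word_ext
  · simp
  · intro b y _
    simp [hm]

theorem barDiff_barDiff (x : TensorAlgebra k A) : barDiff k A (barDiff k A x) = 0 := by
  suffices h : barDiff k A ∘ₗ barDiff k A = 0 from LinearMap.congr_fun h x
  apply word_ext
  · simp
  · intro a y h
    simp only [LinearMap.comp_apply, LinearMap.zero_apply] at h
    simp [barDiff_mulFirst, h]

theorem emptyWord_mulFirst (a : A) (x : TensorAlgebra k A) : emptyWord k A (mulFirst a x) = 0 := by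
  suffices h : emptyWord k A ∘ₗ mulFirst a = 0 from LinearMap.congr_fun h x
  apply word_ext
  · simp
  · intro a y h
    simp

theorem emptyWord_barDiff (x : TensorAlgebra k A) : emptyWord k A (barDiff k A x) = 0 := by
  suffices h : emptyWord k A ∘ₗ barDiff k A = 0 from LinearMap.congr_fun h x
  apply word_ext
  · simp
  · intro a y h
    simp [emptyWord_mulFirst]

theorem mulFirst_mem (n : ℤ) (x : TensorAlgebra k A) (hx : x ∈ barDeg k A n) (a : A) :
    mulFirst a x ∈ barDeg k A n := by
  refine barDeg_induction (P := fun n x => mulFirst a x ∈ barDeg k A n) ?_ ?_ ?_ ?_ ?_ hx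
  · intro i; simp
  · simp
  · intro i r x h; rw [map_smul]; exact Submodule.smul_mem _ _ h
  · intro i x y h h'; rw [map_add]; exact Submodule.add_mem _ h h'
  · intro i b x hx _
    rw [mulFirst_cons]
    exact cons_mem_barDeg hx _ rfl

theorem barDiff_mem (n : ℤ) (x : TensorAlgebra k A) (hx : x ∈ barDeg k A n) :
    barDiff k A x ∈ barDeg k A (n + 1) := by
  refine barDeg_induction (P := fun n x => barDiff k A x ∈ barDeg k A (n + 1)) ?_ ?_ ?_ ?_ ?_ hx
  · intro i; simp
  · simp
  · intro i r x h; rw [map_smul]; exact Submodule.smul_mem _ _ h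
  · intro i x y h h'; rw [map_add]; exact Submodule.add_mem _ h h'
  · intro i a x hx h
    rw [barDiff_cons]
    refine Submodule.sub_mem _ ?_ (cons_mem_barDeg h a (by ring))
    have h' : i - 1 + 1 = i := by ring
    rw [h']
    exact mulFirst_mem i x hx a

theorem deconc_mulFirst (a : A) (x : TensorAlgebra k A) :
    deconc k A (mulFirst a x) = 1 ⊗ₜ mulFirst a x + (mulFirst a).rTensor _ (deconc k A x) := by
  have h1 : ∀ (b : A) (t : TensorAlgebra k A ⊗[k] TensorAlgebra k A),
      (mulFirst a).rTensor _ (consL _ b t) = consL _ (a * b) t := by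
    intro b t
    induction t using TensorProduct.induction_on with
    | zero => simp
    | add x y hx hy => simp only [map_add, hx, hy]
    | tmul p q => simp
  suffices h : deconc k A ∘ₗ mulFirst a = TensorProduct.mk k _ _ 1 ∘ₗ mulFirst a
      + (mulFirst a).rTensor _ ∘ₗ deconc k A from LinearMap.congr_fun h x
  apply word_ext
  · simp
  · intro b y _
    simp [h1]

theorem deconc_barDiff (x : TensorAlgebra k A) :
    deconc k A (barDiff k A x)
      = (barGrading k A).tensorδ (barDiff k A) (barDiff k A) (deconc k A x) := by
  suffices h : deconc k A ∘ₗ barDiff k A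
      = (barGrading k A).tensorδ (barDiff k A) (barDiff k A) ∘ₗ deconc k A from
    LinearMap.congr_fun h x
  apply word_ext
  · simp [ZGrading.tensorδ_tmul]
  · intro a y hy
    have h1 : ∀ t : TensorAlgebra k A ⊗[k] TensorAlgebra k A,
        (barGrading k A).tensorδ (barDiff k A) (barDiff k A) (consL _ a t)
        = (mulFirst a).rTensor _ t
          - consL _ a ((barGrading k A).tensorδ (barDiff k A) (barDiff k A) t) := by
      intro t
      induction t using TensorProduct.induction_on with
      | zero => simp
      | add x y hx hy => simp only [map_add, hx, hy]; abel
      | tmul p q => simp [ZGrading.tensorδ_tmul, bar_ε_cons, sub_tmul, neg_tmul]; abel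
    simp only [LinearMap.comp_apply] at hy ⊢
    rw [barDiff_cons, map_sub, deconc_mulFirst, deconc_cons, deconc_cons, map_add, h1, hy,
      ZGrading.tensorδ_tmul, bar_ε_one, barDiff_one, barDiff_cons, tmul_sub, zero_tmul]
    abel

variable (k A) in
/-- The bar construction `BA` of a (not necessarily unital) algebra `A`, considered as concentrated
in degree zero: the tensor coalgebra of `A[1]` with the differential `b'`. -/
def bar : DGCoalgebra k (TensorAlgebra k A) where
  toZGrading := barGrading k A
  Δ := deconc k A
  η := emptyWord k A
  δ := barDiff k A
  Δ_mem := deconc_mem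
  η_eq_zero := emptyWord_eq_zero
  δ_mem := barDiff_mem
  coassoc := deconc_coassoc
  counit_left := deconc_counit_left
  counit_right := deconc_counit_right
  δ_δ := barDiff_barDiff
  η_δ := emptyWord_barDiff
  Δ_δ := deconc_barDiff

end Bar

section Kunneth

variable {k C D : Type*} [Field k] [AddCommGroup C] [Module k C] [AddCommGroup D] [Module k D]
variable (X : DGCoalgebra k C) (Y : DGCoalgebra k D)

/-- The signed shuffle
`(c₀ ⊗ c₁ ⊗ c₂) ⊗ (d₀ ⊗ d₁ ⊗ d₂) ↦ ± (c₀ ⊗ d₀) ⊗ (c₁ ⊗ d₁) ⊗ (c₂ ⊗ d₂)`. -/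
def shuffle₃ : (C ⊗[k] (C ⊗[k] C)) ⊗[k] (D ⊗[k] (D ⊗[k] D)) →ₗ[k]
    (C ⊗[k] D) ⊗[k] ((C ⊗[k] D) ⊗[k] (C ⊗[k] D)) :=
  LinearMap.lTensor (C ⊗[k] D) (X.interchange Y.toZGrading C D) ∘ₗ
    X.G₁.interchange Y.toZGrading C (D ⊗[k] D)

/-- The component `C ⊗ Ω¹D_♮ → Ω̇¹(C ⊗ D)` of the Künneth map,
`c ⊗ ω ↦ (-1)^|c| / 2 · R₂₃ ((Δ + τ Δ) c ⊗ ω)`. -/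
def kunneth₀₁ : C ⊗[k] (D ⊗[k] D) →ₗ[k] (C ⊗[k] D) ⊗[k] (C ⊗[k] D) :=
  (2⁻¹ : k) • X.interchange Y.toZGrading C D ∘ₗ
    TensorProduct.map ((X.Δ + X.τ ∘ₗ X.Δ) ∘ₗ X.ε) LinearMap.id

/-- The component `Ω¹C_♮ ⊗ D → Ω̇¹(C ⊗ D)` of the Künneth map,
`ω ⊗ c ↦ 1 / 2 · R₂₃ (ω ⊗ (Δ + τ Δ) c)`. -/
def kunneth₁₀ : (C ⊗[k] C) ⊗[k] D →ₗ[k] (C ⊗[k] D) ⊗[k] (C ⊗[k] D) :=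
  (2⁻¹ : k) • X.interchange Y.toZGrading C D ∘ₗ
    TensorProduct.map LinearMap.id (Y.Δ + Y.τ ∘ₗ Y.Δ)

/-- The component `Ω¹C_♮ ⊗ Ω¹D_♮ → Ω²(C ⊗ D)_♮` of the Künneth map, the composition of
`ω ⊗ ω' ↦ (-1)^|ω| / 2 · ((1 ⊗ Δ) ω ⊗ (Δ ⊗ 1) ω' - (Δ ⊗ 1) ω ⊗ (1 ⊗ Δ) ω')` with the signed
shuffle. -/
def kunneth₁₁ : (C ⊗[k] C) ⊗[k] (D ⊗[k] D) →ₗ[k]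
    (C ⊗[k] D) ⊗[k] ((C ⊗[k] D) ⊗[k] (C ⊗[k] D)) :=
  (2⁻¹ : k) • shuffle₃ X Y ∘ₗ
    (TensorProduct.map (LinearMap.lTensor C X.Δ ∘ₗ X.ε₁) (Y.Δl D)
      - TensorProduct.map (X.Δl C ∘ₗ X.ε₁) (LinearMap.lTensor D Y.Δ))

end Kunneth

section Retraction

variable (k A : Type*) [Field k] [NonUnitalRing A] [Module k A]
variable [IsScalarTower k A A] [SMulCommClass k A A]

/-- The map `A ⊗ BA → BA` that puts a letter in front of a word. -/
def cons : A ⊗[k] TensorAlgebra k A →ₗ[k] TensorAlgebra k A :=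
  LinearMap.mul' k (TensorAlgebra k A) ∘ₗ
    TensorProduct.map (TensorAlgebra.ι k) LinearMap.id

/-- The isomorphism `Ω¹BA = BA ⊗ ker η → BA ⊗ A ⊗ BA`,
`α ⊗ (b₁, …, bₘ) ↦ α ⊗ b₁ ⊗ (b₂, …, bₘ) - (α₁, …, αₙ₋₁) ⊗ αₙ ⊗ (b₁, …, bₘ)`. It is dual to the
isomorphism `α ⊗ a ⊗ β ↦ α da β` for the tensor algebra. -/
def toBimodule : TensorAlgebra k A ⊗[k] TensorAlgebra k A →ₗ[k]
    TensorAlgebra k A ⊗[k] (A ⊗[k] TensorAlgebra k A) :=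
  LinearMap.lTensor (TensorAlgebra k A) (firstLetter k A) -
    (TensorProduct.assoc k (TensorAlgebra k A) A (TensorAlgebra k A)).toLinearMap ∘ₗ
      (lastLetter k A).rTensor (TensorAlgebra k A)

/-- The inverse isomorphism `BA ⊗ A ⊗ BA → Ω¹BA`, `α ⊗ a ⊗ β ↦ ∑ α' ⊗ (α'', a, β)`. -/
def ofBimodule : TensorAlgebra k A ⊗[k] (A ⊗[k] TensorAlgebra k A) →ₗ[k]
    TensorAlgebra k A ⊗[k] TensorAlgebra k A :=
  LinearMap.lTensor (TensorAlgebra k A) (LinearMap.mul' k (TensorAlgebra k A)) ∘ₗ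
    (TensorProduct.assoc k (TensorAlgebra k A) (TensorAlgebra k A)
      (TensorAlgebra k A)).toLinearMap ∘ₗ
    TensorProduct.map (deconc k A) (cons k A)

/-- The isomorphism of `A ⊗ BA` with the cocommutator subspace of `Ω¹BA`: the tensor `a ⊗ γ` is
sent to the sum of the tensors `± γ'' ⊗ a ⊗ γ'` in `BA ⊗ A ⊗ BA ≅ Ω¹BA`, i.e. to the signed sum of
the `α ⊗ β` with `a` in `β` whose concatenation is a cyclic permutation of the word `(a, γ)`. -/
def ofCyclic : A ⊗[k] TensorAlgebra k A →ₗ[k] TensorAlgebra k A ⊗[k] TensorAlgebra k A :=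
  ofBimodule k A ∘ₗ LinearMap.lTensor (TensorAlgebra k A) (firstLetter k A) ∘ₗ
    (bar k A).τ ∘ₗ (bar k A).Δ ∘ₗ cons k A

/-- The projection `θ : Ω¹BA → Ω¹BA_♮`, given by `θ(α ⊗ a ⊗ β) = η(α) a ⊗ β` in terms of the
isomorphisms `Ω¹BA ≅ BA ⊗ A ⊗ BA` and `Ω¹BA_♮ ≅ A ⊗ BA`. -/
def θ : TensorAlgebra k A ⊗[k] TensorAlgebra k A →ₗ[k] TensorAlgebra k A ⊗[k] TensorAlgebra k A :=
  ofCyclic k A ∘ₗ (bar k A).d (A ⊗[k] TensorAlgebra k A) ∘ₗ toBimodule k A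

/-- The connection `∇ : Ω²BA → Ω¹BA`, given by `∇(β ⊗ α ⊗ a) = ± α ⊗ a ⊗ β` in terms of the
isomorphism `Ω¹BA ≅ BA ⊗ A ⊗ BA`, where `a` is a word of length one; it vanishes on the
`β ⊗ α ⊗ γ` where `γ` is a word of any other length. -/
def nabla : TensorAlgebra k A ⊗[k] (TensorAlgebra k A ⊗[k] TensorAlgebra k A) →ₗ[k]
    TensorAlgebra k A ⊗[k] TensorAlgebra k A :=
  ofBimodule k A ∘ₗ
    LinearMap.lTensor (TensorAlgebra k A)
      (LinearMap.rTensor (TensorAlgebra k A) TensorAlgebra.ιInv) ∘ₗ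
    (bar k A).rot₂

end Retraction

end XComplex

end

/-! Künneth map. Each boundary `b` alternates coproducts at single places and ends with a rotated
coproduct. The signed shuffles from `n` factors `C` and `n` factors `D` to `n` factors `C ⊗ D`
commute with coproducts, with rotations and with `d`. Hence `b` of a shuffled tensor is the same
alternating sum carried out in both factors at once (`b₁_shuffle₂`, `b₂_shuffle₃`). For `x` in
`Ω¹C_♮`, the equation `b x = 0` expresses `(1 ⊗ Δ) x` as `a + r a`, where `a = (Δ ⊗ 1) x` and `r` is
the cyclic permutation (`lTensor_Δ_of_mem`). Applying `d` gives `Δ d x = x + τ x` (`Δ_d_of_mem`).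
With `r³ = 1` and coassociativity, every identity needed for `p` becomes a comparison of finitely
many rotated coproducts. The central ones are `b₁_shuffle₂_symΔ_right`, `b₁_shuffle₂_symΔ_left`,
`two_d_cup` and `two_b₀_tmul`, which give `p ∂ = ∂ p`; `b₂_cup`, `b₁_d_cup` and the criterion
`mem_Ω₁dot_of_τ` show that the values of `p` lie in the right subspaces.

Retraction. As a coalgebra `BA` is a tensor coalgebra, and `Ω¹BA` is cofree as a bicomodule, so the
`b`-complex has an explicit homotopy. Write `Q (u ⊗ v) = ∑ u' ⊗ u'' v` (`splitMul`), `P (u ⊗ v) =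
π(u) v` with `π` the projection onto one-letter words (`headMul`), and `d - P` (`headDiff`). The
basic fact is that `Q (1 ⊗ (d - P))` is a left inverse of `Δ ⊗ 1`. The map `conn`, which is `- Q (1
⊗ (d - P)) r²`, satisfies `conn b = θ - 1` on one-forms (`conn_b₁`, `θ_eq`) and `b conn = -1` on
two-forms killed by `b` (`b₁_conn`). Thus `θ = 1 + conn b` is a projection of `Ω¹BA` onto the kernel
of `b`. On `Ω²BA_♮` the prescribed `∇` agrees with `conn` (`nabla_eq_conn`). This gives `b ∇ = -1`,
`∇ b = θ - 1` on `Ω̇¹BA`, and `∇ δ = δ ∇ - θ δ ∇`. The one further relation is `b d ∇ = 2 d`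
(`b₀_d_nabla`). It is checked after applying `d - P`, which is injective on `Ω¹BA_♮` by
`eq_cyc_of_mem`. These relations make `R` a morphism, and `R I = 1` because `θ` fixes `Ω¹BA_♮`.

A coalgebra morphism commutes with all operators that define `X̂²`, so the last assertion is
functoriality followed by composition. -/

noncomputable section

namespace XComplex

open TensorProduct

namespace DGCoalgebra

/-! ### Signed shuffles and their compatibility with coproducts, rotations, counits and
differentials. -/

section TensorForms

variable {k C D : Type*} [Field k] [AddCommGroup C] [Module k C] [AddCommGroup D] [Module k D]
variable (X : DGCoalgebra k C) (Y : DGCoalgebra k D)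

/-- The signed exchange `C ⊗ C ⊗ D ⊗ D → (C ⊗ D) ⊗ (C ⊗ D)`. -/
abbrev shuffle₂ : (C ⊗[k] C) ⊗[k] (D ⊗[k] D) →ₗ[k] (C ⊗[k] D) ⊗[k] (C ⊗[k] D) :=
  X.interchange Y.toZGrading C D

/-- The signed shuffle of four factors. -/
def shuffle₄ : (C ⊗[k] (C ⊗[k] (C ⊗[k] C))) ⊗[k] (D ⊗[k] (D ⊗[k] (D ⊗[k] D))) →ₗ[k]
    (C ⊗[k] D) ⊗[k] ((C ⊗[k] D) ⊗[k] ((C ⊗[k] D) ⊗[k] (C ⊗[k] D))) :=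
  LinearMap.lTensor (C ⊗[k] D) (shuffle₃ X Y) ∘ₗ
    X.G₂.interchange Y.toZGrading C (D ⊗[k] (D ⊗[k] D))

/-- Two single rotations move the first two factors past the third as one block, and the Koszul
signs of the two moves multiply to the sign of the block move. -/
theorem rot₂_rot₂_assoc (s : (C ⊗[k] C) ⊗[k] C) :
    X.rot₂ (X.rot₂ (TensorProduct.assoc k C C C s)) = X.G₁.swap X.toZGrading s := by
  suffices h : X.rot₂ ∘ₗ X.rot₂ ∘ₗ (TensorProduct.assoc k C C C).toLinearMap
      = X.G₁.swap X.toZGrading from LinearMap.congr_fun h s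
  ext a b c
  simp [rot₂, G₁, ZGrading.swap_tmul, ZGrading.tensor_ev, ZGrading.tensor_od, ZGrading.tensor_ε,
    tmul_add, neg_tmul, tmul_neg]
  abel

theorem rot₂_rot₂_rot₂ (t : C ⊗[k] (C ⊗[k] C)) : X.rot₂ (X.rot₂ (X.rot₂ t)) = t := by
  obtain ⟨s, rfl⟩ := (TensorProduct.assoc k C C C).surjective t
  rw [rot₂_rot₂_assoc, rot₂, LinearMap.comp_apply, ZGrading.swap_swap]
  rfl

/-- The coproduct of `D` is even, so it can be carried through the exchange with `M`. What remains
is the reordering of two successive exchanges, which is `interchange_assoc`. -/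
theorem Δl_interchange {M N : Type*} [AddCommGroup M] [Module k M] [AddCommGroup N] [Module k N]
    (GM : ZGrading k M) (x : C ⊗[k] M) (y : D ⊗[k] N) :
    (X.tensor Y).Δl (M ⊗[k] N) (GM.interchange Y.toZGrading C N (x ⊗ₜ y))
      = LinearMap.lTensor (C ⊗[k] D) (GM.interchange Y.toZGrading C N)
        ((X.toZGrading.tensor GM).interchange Y.toZGrading C (D ⊗[k] N)
          (X.Δl M x ⊗ₜ Y.Δl N y)) := by
  have h := ZGrading.interchange_assoc (U := C) (Z := N) X.toZGrading GM Y.toZGrading Y.toZGrading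
    (X.Δ.rTensor M x ⊗ₜ Y.Δ.rTensor N y)
  rw [TensorProduct.map_tmul] at h
  refine Eq.trans ?_ h.symm
  have h2 := ZGrading.IsEven.interchange (ZGrading.IsEven.id GM) Y.Δ_even X.Δ
    (LinearMap.id : N →ₗ[k] N) (x ⊗ₜ y)
  rw [TensorProduct.map_tmul] at h2
  unfold LinearMap.rTensor
  rw [h2, TensorProduct.map_id]
  generalize GM.interchange Y.toZGrading C N (x ⊗ₜ y) = u
  change (X.tensor Y).Δl (M ⊗[k] N) u = TensorProduct.assoc k (C ⊗[k] D) (C ⊗[k] D) (M ⊗[k] N)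
    (LinearMap.rTensor _ (X.interchange Y.toZGrading C D)
      (LinearMap.rTensor _ (TensorProduct.map X.Δ Y.Δ) u))
  rw [← LinearMap.rTensor_comp_apply]
  rfl

theorem lTensor_interchange {M N M' N' : Type*} [AddCommGroup M] [Module k M] [AddCommGroup N]
    [Module k N] [AddCommGroup M'] [Module k M'] [AddCommGroup N'] [Module k N']
    {GM : ZGrading k M} {GM' : ZGrading k M'} {f : M →ₗ[k] M'} (hf : ZGrading.IsEven GM GM' f)
    (g : N →ₗ[k] N') (x : C ⊗[k] M) (y : D ⊗[k] N) :
    GM'.interchange Y.toZGrading C N' (f.lTensor C x ⊗ₜ g.lTensor D y)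
      = (TensorProduct.map f g).lTensor (C ⊗[k] D)
        (GM.interchange Y.toZGrading C N (x ⊗ₜ y)) := by
  have h := ZGrading.IsEven.interchange hf (ZGrading.IsEven.id Y.toZGrading)
    (LinearMap.id : C →ₗ[k] C) g (x ⊗ₜ y)
  rw [TensorProduct.map_tmul, TensorProduct.map_id] at h
  exact h

/-- Naturality of the shuffles for maps of the factors other than the first. -/
theorem lTensor_lTensor_interchange {M N M' N' E' : Type*} [AddCommGroup M] [Module k M]
    [AddCommGroup N]
    [Module k N] [AddCommGroup M'] [Module k M'] [AddCommGroup N'] [Module k N']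
    [AddCommGroup E'] [Module k E']
    {GM : ZGrading k M} {GM' : ZGrading k M'} {f : M →ₗ[k] M'} (hf : ZGrading.IsEven GM GM' f)
    (g : N →ₗ[k] N') {E : Type*} [AddCommGroup E] [Module k E] {h : E →ₗ[k] E'}
    {j : M ⊗[k] N →ₗ[k] E} {j' : M' ⊗[k] N' →ₗ[k] E'}
    (hj : ∀ m n, h (j (m ⊗ₜ n)) = j' (f m ⊗ₜ g n)) (x : C ⊗[k] M) (y : D ⊗[k] N) :
    h.lTensor (C ⊗[k] D) (j.lTensor (C ⊗[k] D) (GM.interchange Y.toZGrading C N (x ⊗ₜ y)))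
      = j'.lTensor (C ⊗[k] D)
        (GM'.interchange Y.toZGrading C N' (f.lTensor C x ⊗ₜ g.lTensor D y)) := by
  rw [lTensor_interchange Y hf, ← LinearMap.lTensor_comp_apply, ← LinearMap.lTensor_comp_apply]
  congr 2
  apply TensorProduct.ext'
  intro m n
  simp [hj]

theorem τ_shuffle₂ (x : C ⊗[k] C) (y : D ⊗[k] D) :
    (X.tensor Y).τ (shuffle₂ X Y (x ⊗ₜ y)) = shuffle₂ X Y (X.τ x ⊗ₜ Y.τ y) := by
  suffices h : (X.tensor Y).τ ∘ₗ shuffle₂ X Y = shuffle₂ X Y ∘ₗ TensorProduct.map X.τ Y.τ from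
    LinearMap.congr_fun h (x ⊗ₜ y)
  ext a b c e
  simp [τ, tensor, ZGrading.interchange_tmul, ZGrading.swap_tmul, ZGrading.tensor_ev,
    ZGrading.tensor_od, ZGrading.tensor_ε, tmul_add, add_tmul, neg_tmul, tmul_neg]
  -- The signs are now encoded by parity projections and involutions. Writing `ε = ev - od` and
  -- splitting all four entries into even and odd parts reduces the claim to finitely many sign
  -- cases.
  have e1 : ∀ w : C, X.ε w = X.ev w - X.od w := by
    intro w; have := X.ev_add_od (X.ε w); simp at this; rw [← this]; abel
  have e2 : ∀ w : D, Y.ε w = Y.ev w - Y.od w := by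
    intro w; have := Y.ev_add_od (Y.ε w); simp at this; rw [← this]; abel
  simp only [e1, e2, tmul_sub, sub_tmul]
  have e1 : ∀ w : C, w = X.ev w + X.od w := fun w => (X.ev_add_od w).symm
  have e2 : ∀ w : D, w = Y.ev w + Y.od w := fun w => (Y.ev_add_od w).symm
  rw [e1 a, e1 b, e2 c, e2 e]
  simp only [tmul_add, add_tmul, map_add]
  simp
  try abel

theorem τ_even : ZGrading.IsEven X.G₁ X.G₁ X.τ := by
  constructor
  · intro t
    induction t using TensorProduct.induction_on with
    | zero => simp
    | add x y hx hy => simp only [map_add, hx, hy]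
    | tmul a b => simp [τ, G₁, ZGrading.tensor_ev, ZGrading.swap_tmul]
  · intro t
    induction t using TensorProduct.induction_on with
    | zero => simp
    | add x y hx hy => simp only [map_add, hx, hy]
    | tmul a b =>
      simp [τ, G₁, ZGrading.tensor_od, ZGrading.swap_tmul]
      try abel
  · intro t
    induction t using TensorProduct.induction_on with
    | zero => simp
    | add x y hx hy => simp only [map_add, hx, hy]
    | tmul a b =>
      simp [τ, G₁, ZGrading.tensor_ε, ZGrading.swap_tmul]

/-- The signed exchange of the first two factors. -/
def exch (M : Type*) [AddCommGroup M] [Module k M] :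
    C ⊗[k] (C ⊗[k] M) →ₗ[k] C ⊗[k] (C ⊗[k] M) :=
  (TensorProduct.assoc k C C M).toLinearMap ∘ₗ X.τ.rTensor M ∘ₗ
    (TensorProduct.assoc k C C M).symm.toLinearMap

theorem exch_tmul {M : Type*} [AddCommGroup M] [Module k M] (a b : C) (m : M) :
    X.exch M (a ⊗ₜ (b ⊗ₜ m)) = b ⊗ₜ (X.ev a ⊗ₜ m) + X.ε b ⊗ₜ (X.od a ⊗ₜ m) := by
  simp [exch, τ, ZGrading.swap_tmul, add_tmul]

/-- After reassociation the nested exchanges become a two-factor shuffle next to spectators `M` and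
`N`, so the claim reduces to `τ_shuffle₂`. -/
theorem exch_interchange {M N : Type*} [AddCommGroup M] [Module k M] [AddCommGroup N] [Module k N]
    (GM : ZGrading k M) (x : C ⊗[k] (C ⊗[k] M)) (y : D ⊗[k] (D ⊗[k] N)) :
    (X.tensor Y).exch (M ⊗[k] N) (LinearMap.lTensor (C ⊗[k] D) (GM.interchange Y.toZGrading C N)
        ((X.toZGrading.tensor GM).interchange Y.toZGrading C (D ⊗[k] N) (x ⊗ₜ y)))
      = LinearMap.lTensor (C ⊗[k] D) (GM.interchange Y.toZGrading C N)
        ((X.toZGrading.tensor GM).interchange Y.toZGrading C (D ⊗[k] N)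
          (X.exch M x ⊗ₜ Y.exch N y)) := by
  obtain ⟨x, rfl⟩ := (TensorProduct.assoc k C C M).surjective x
  obtain ⟨y, rfl⟩ := (TensorProduct.assoc k D D N).surjective y
  have h := ZGrading.interchange_assoc (U := C) (Z := N) X.toZGrading GM Y.toZGrading Y.toZGrading
  have h1 := h (x ⊗ₜ y)
  have h2 := h (X.τ.rTensor M x ⊗ₜ Y.τ.rTensor N y)
  have h3 := ZGrading.IsEven.interchange (ZGrading.IsEven.id GM) Y.τ_even X.τ
    (LinearMap.id : N →ₗ[k] N) (x ⊗ₜ y)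
  rw [TensorProduct.map_tmul] at h1 h2 h3
  simp only [exch, LinearMap.comp_apply, LinearEquiv.coe_coe, LinearEquiv.symm_apply_apply] at *
  rw [h1, h2, LinearEquiv.symm_apply_apply]
  congr 1
  unfold LinearMap.rTensor at *
  refine Eq.trans ?_ (congrArg _ h3.symm)
  rw [TensorProduct.map_id]
  change LinearMap.rTensor _ _ (LinearMap.rTensor _ _ _) = LinearMap.rTensor _ _
    (LinearMap.rTensor _ _ _)
  rw [← LinearMap.rTensor_comp_apply, ← LinearMap.rTensor_comp_apply]
  congr 2
  apply TensorProduct.ext'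
  intro a b
  exact X.τ_shuffle₂ Y a b

/-- A rotation is an exchange of the first two factors followed by a shorter rotation of the rest.
In this form, compatibility of rotations with shuffles and with coalgebra maps is proved by adding
one factor at a time. -/
theorem rot₂_eq (t : C ⊗[k] (C ⊗[k] C)) :
    X.rot₂ t = LinearMap.lTensor C X.τ (X.exch C t) := by
  suffices h : X.rot₂ = LinearMap.lTensor C X.τ ∘ₗ X.exch C from LinearMap.congr_fun h t
  ext a b c
  simp [rot₂, G₁, τ, exch_tmul, ZGrading.swap_tmul, ZGrading.tensor_ε]

theorem rot₃_eq (t : C ⊗[k] (C ⊗[k] (C ⊗[k] C))) :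
    X.rot₃ t = LinearMap.lTensor C X.rot₂ (X.exch (C ⊗[k] C) t) := by
  suffices h : X.rot₃ = LinearMap.lTensor C X.rot₂ ∘ₗ X.exch (C ⊗[k] C) from
    LinearMap.congr_fun h t
  ext a b c e
  simp [rot₃, rot₂, G₁, G₂, exch_tmul, ZGrading.swap_tmul, ZGrading.tensor_ε]

theorem rot₂_even : ZGrading.IsEven X.G₂ X.G₂ X.rot₂ := by
  constructor
  · intro t
    suffices h : X.G₂.ev ∘ₗ X.rot₂ = X.rot₂ ∘ₗ X.G₂.ev from LinearMap.congr_fun h t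
    ext a b c
    simp [G₂, rot₂, G₁, ZGrading.tensor_ev, ZGrading.tensor_od, ZGrading.tensor_ε,
      ZGrading.swap_tmul, tmul_add, neg_tmul, tmul_neg]
    try abel
  · intro t
    suffices h : X.G₂.od ∘ₗ X.rot₂ = X.rot₂ ∘ₗ X.G₂.od from LinearMap.congr_fun h t
    ext a b c
    simp [G₂, rot₂, G₁, ZGrading.tensor_ev, ZGrading.tensor_od, ZGrading.tensor_ε,
      ZGrading.swap_tmul, tmul_add, neg_tmul, tmul_neg]
    try abel
  · intro t
    rw [G₂_ε, ε₂_rot₂]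

theorem τ_shuffle₃ (x : C ⊗[k] (C ⊗[k] C)) (y : D ⊗[k] (D ⊗[k] D)) :
    (X.tensor Y).τ.lTensor _ (shuffle₃ X Y (x ⊗ₜ y))
      = shuffle₃ X Y (X.τ.lTensor _ x ⊗ₜ Y.τ.lTensor _ y) :=
  lTensor_lTensor_interchange Y X.τ_even Y.τ (X.τ_shuffle₂ Y) x y

theorem rot₂_shuffle₃ (x : C ⊗[k] (C ⊗[k] C)) (y : D ⊗[k] (D ⊗[k] D)) :
    (X.tensor Y).rot₂ (shuffle₃ X Y (x ⊗ₜ y)) = shuffle₃ X Y (X.rot₂ x ⊗ₜ Y.rot₂ y) := by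
  rw [rot₂_eq, rot₂_eq, rot₂_eq, ← τ_shuffle₃]
  exact congrArg _ (X.exch_interchange Y X.toZGrading x y)

theorem rot₂_shuffle₄ (x : C ⊗[k] (C ⊗[k] (C ⊗[k] C))) (y : D ⊗[k] (D ⊗[k] (D ⊗[k] D))) :
    (X.tensor Y).rot₂.lTensor _ (shuffle₄ X Y (x ⊗ₜ y))
      = shuffle₄ X Y (X.rot₂.lTensor _ x ⊗ₜ Y.rot₂.lTensor _ y) :=
  lTensor_lTensor_interchange Y X.rot₂_even Y.rot₂ (X.rot₂_shuffle₃ Y) x y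

theorem Δl_shuffle₂ (x : C ⊗[k] C) (y : D ⊗[k] D) :
    (X.tensor Y).Δl _ (shuffle₂ X Y (x ⊗ₜ y)) = shuffle₃ X Y (X.Δl C x ⊗ₜ Y.Δl D y) :=
  X.Δl_interchange Y X.toZGrading x y

theorem shuffle₄_apply (t : (C ⊗[k] (C ⊗[k] (C ⊗[k] C))) ⊗[k] (D ⊗[k] (D ⊗[k] (D ⊗[k] D)))) :
    shuffle₄ X Y t = LinearMap.lTensor (C ⊗[k] D)
      (LinearMap.lTensor (C ⊗[k] D) (X.interchange Y.toZGrading C D))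
        (LinearMap.lTensor (C ⊗[k] D) (X.G₁.interchange Y.toZGrading C (D ⊗[k] D))
          (X.G₂.interchange Y.toZGrading C (D ⊗[k] (D ⊗[k] D)) t)) := by
  rw [← LinearMap.lTensor_comp_apply]
  rfl

theorem Δl_shuffle₃ (x : C ⊗[k] (C ⊗[k] C)) (y : D ⊗[k] (D ⊗[k] D)) :
    (X.tensor Y).Δl _ (shuffle₃ X Y (x ⊗ₜ y)) = shuffle₄ X Y (X.Δl _ x ⊗ₜ Y.Δl _ y) := by
  rw [shuffle₄_apply]
  refine ((X.tensor Y).Δl_nat (X.interchange Y.toZGrading C D) _).trans ?_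
  exact congrArg _ (X.Δl_interchange Y X.G₁ x y)

theorem exch_nat {M N : Type*} [AddCommGroup M] [Module k M] [AddCommGroup N] [Module k N]
    (f : M →ₗ[k] N) (t : C ⊗[k] (C ⊗[k] M)) :
    X.exch N (LinearMap.lTensor C (LinearMap.lTensor C f) t)
      = LinearMap.lTensor C (LinearMap.lTensor C f) (X.exch M t) := by
  suffices h : X.exch N ∘ₗ LinearMap.lTensor C (LinearMap.lTensor C f)
      = LinearMap.lTensor C (LinearMap.lTensor C f) ∘ₗ X.exch M from LinearMap.congr_fun h t
  ext a b m
  simp [exch_tmul]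

theorem rot₃_shuffle₄ (x : C ⊗[k] (C ⊗[k] (C ⊗[k] C))) (y : D ⊗[k] (D ⊗[k] (D ⊗[k] D))) :
    (X.tensor Y).rot₃ (shuffle₄ X Y (x ⊗ₜ y)) = shuffle₄ X Y (X.rot₃ x ⊗ₜ Y.rot₃ y) := by
  rw [rot₃_eq, rot₃_eq, rot₃_eq, ← rot₂_shuffle₄]
  congr 1
  rw [shuffle₄_apply, shuffle₄_apply, exch_nat]
  exact congrArg _ (X.exch_interchange Y X.G₁ x y)

theorem Δ_shuffle₂ (x : C ⊗[k] C) (y : D ⊗[k] D) :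
    (X.tensor Y).Δ.lTensor _ (shuffle₂ X Y (x ⊗ₜ y))
      = shuffle₃ X Y (X.Δ.lTensor _ x ⊗ₜ Y.Δ.lTensor _ y) := by
  have h : ∀ t, LinearMap.lTensor _ (X.tensor Y).Δ t
    = LinearMap.lTensor (C ⊗[k] D) (shuffle₂ X Y)
      (LinearMap.lTensor (C ⊗[k] D) (TensorProduct.map X.Δ Y.Δ) t) := by
    intro t; rw [← LinearMap.lTensor_comp_apply]; rfl
  rw [h, ← lTensor_interchange Y X.Δ_even]
  rfl

theorem Δl_lTensor_shuffle₃ (x : C ⊗[k] (C ⊗[k] C)) (y : D ⊗[k] (D ⊗[k] D)) :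
    ((X.tensor Y).Δl _).lTensor _ (shuffle₃ X Y (x ⊗ₜ y))
      = shuffle₄ X Y ((X.Δl C).lTensor _ x ⊗ₜ (Y.Δl D).lTensor _ y) :=
  lTensor_lTensor_interchange Y X.Δl_even (Y.Δl D) (X.Δl_shuffle₂ Y) x y

theorem Δ_shuffle₃ (x : C ⊗[k] (C ⊗[k] C)) (y : D ⊗[k] (D ⊗[k] D)) :
    ((X.tensor Y).Δ.lTensor _).lTensor _ (shuffle₃ X Y (x ⊗ₜ y))
      = shuffle₄ X Y ((X.Δ.lTensor C).lTensor _ x ⊗ₜ (Y.Δ.lTensor D).lTensor _ y) :=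
  lTensor_lTensor_interchange Y X.lTensor_Δ_even (Y.Δ.lTensor D) (X.Δ_shuffle₂ Y) x y

/-- The counit is concentrated in degree zero, so `η ε = η` removes the Koszul sign and the even and
odd parts of the factor in `M` recombine. -/
theorem d_interchange {M N : Type*} [AddCommGroup M] [Module k M] [AddCommGroup N] [Module k N]
    (GM : ZGrading k M) (x : C ⊗[k] M) (y : D ⊗[k] N) :
    (X.tensor Y).d (M ⊗[k] N) (GM.interchange Y.toZGrading C N (x ⊗ₜ y))
      = X.d M x ⊗ₜ Y.d N y := by
  suffices h : (X.tensor Y).d (M ⊗[k] N) ∘ₗ GM.interchange Y.toZGrading C N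
      = TensorProduct.map (X.d M) (Y.d N) from LinearMap.congr_fun h (x ⊗ₜ y)
  ext c m e n
  simp only [d, tensor, AlgebraTensorModule.curry_apply, LinearMap.restrictScalars_self,
    curry_apply, LinearMap.comp_apply, ZGrading.interchange_tmul, map_add, LinearMap.rTensor_tmul,
    TensorProduct.map_tmul, LinearMap.mul'_apply, LinearEquiv.coe_coe,
    TensorProduct.lid_tmul, η_ε, ← smul_add, ← add_tmul, GM.ev_add_od]
  rw [smul_tmul_smul]

theorem d_shuffle₂ (x : C ⊗[k] C) (y : D ⊗[k] D) :
    (X.tensor Y).d _ (shuffle₂ X Y (x ⊗ₜ y)) = X.d C x ⊗ₜ Y.d D y :=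
  X.d_interchange Y X.toZGrading x y

theorem d_shuffle₃ (x : C ⊗[k] (C ⊗[k] C)) (y : D ⊗[k] (D ⊗[k] D)) :
    (X.tensor Y).d _ (shuffle₃ X Y (x ⊗ₜ y)) = shuffle₂ X Y (X.d _ x ⊗ₜ Y.d _ y) := by
  refine ((X.tensor Y).d_lTensor (shuffle₂ X Y) _).trans ?_
  exact congrArg _ (X.d_interchange Y X.G₁ x y)

theorem δ₁_shuffle₂ (x : C ⊗[k] C) (y : D ⊗[k] D) :
    (X.tensor Y).δ₁ (shuffle₂ X Y (x ⊗ₜ y))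
      = shuffle₂ X Y (X.δ₁ x ⊗ₜ y + X.ε₁ x ⊗ₜ Y.δ₁ y) := by
  have h := ZGrading.tensorδ_interchange (A := X.toZGrading) (δU := X.δ) (δZ := Y.δ) X.δ_odd
    Y.δ_odd (x ⊗ₜ y)
  rw [ZGrading.tensorδ_tmul, ZGrading.tensor_ε] at h
  exact h.symm

theorem interchange_ε {M : Type*} [AddCommGroup M] [Module k M] (GM : ZGrading k M)
    {N : Type*} [AddCommGroup N] [Module k N] (εN : N →ₗ[k] N)
    (x : C ⊗[k] M) (y : D ⊗[k] N) :
    TensorProduct.map (X.tensor Y).ε (TensorProduct.map GM.ε εN)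
      (GM.interchange Y.toZGrading C N (x ⊗ₜ y))
      = GM.interchange Y.toZGrading C N
        (TensorProduct.map X.ε GM.ε x ⊗ₜ TensorProduct.map Y.ε εN y) := by
  suffices h : TensorProduct.map (X.tensor Y).ε (TensorProduct.map GM.ε εN) ∘ₗ
      GM.interchange Y.toZGrading C N
      = GM.interchange Y.toZGrading C N ∘ₗ TensorProduct.map
        (TensorProduct.map X.ε GM.ε) (TensorProduct.map Y.ε εN) from
    LinearMap.congr_fun h (x ⊗ₜ y)
  ext c m e n
  simp [tensor, ZGrading.interchange_tmul, ZGrading.tensor_ε]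

theorem ε₁_shuffle₂ (x : C ⊗[k] C) (y : D ⊗[k] D) :
    (X.tensor Y).ε₁ (shuffle₂ X Y (x ⊗ₜ y)) = shuffle₂ X Y (X.ε₁ x ⊗ₜ Y.ε₁ y) := by
  have h := X.interchange_ε Y X.toZGrading Y.ε x y
  rw [← ZGrading.tensor_ε] at h
  exact h

end TensorForms
end DGCoalgebra

namespace DGCoalgebra

/-! ### Boundary identities for the products on `C ⊗ D` and the linear Künneth map. -/

section KunnethIdentities

variable {k C D : Type*} [Field k] [AddCommGroup C] [Module k C] [AddCommGroup D] [Module k D]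
variable (X : DGCoalgebra k C) (Y : DGCoalgebra k D)

theorem δ₂_shuffle₃ (x : C ⊗[k] (C ⊗[k] C)) (y : D ⊗[k] (D ⊗[k] D)) :
    (X.tensor Y).δ₂ (shuffle₃ X Y (x ⊗ₜ y))
      = shuffle₃ X Y (X.δ₂ x ⊗ₜ y + X.ε₂ x ⊗ₜ Y.δ₂ y) := by
  have h1 : ∀ m, (X.tensor Y).δ₁ (shuffle₂ X Y m)
      = shuffle₂ X Y (X.G₁.tensorδ X.δ₁ Y.δ₁ m) := fun m =>
    (ZGrading.tensorδ_interchange X.δ_odd Y.δ_odd m).symm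
  have h2 := (X.tensor Y).tensorδ_lTensor h1 (X.G₁.interchange Y.toZGrading C (D ⊗[k] D) (x ⊗ₜ y))
  have h3 := ZGrading.tensorδ_interchange (A := X.toZGrading) (δU := X.δ) (δZ := Y.δ₁) X.δ₁_odd
    Y.δ_odd (x ⊗ₜ y)
  refine h2.trans (congrArg _ (h3.symm.trans (congrArg _ ?_)))
  rw [ZGrading.tensorδ_tmul, ZGrading.tensor_ε, G₁_ε]
  rfl

theorem ε₂_shuffle₃ (x : C ⊗[k] (C ⊗[k] C)) (y : D ⊗[k] (D ⊗[k] D)) :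
    (X.tensor Y).ε₂ (shuffle₃ X Y (x ⊗ₜ y)) = shuffle₃ X Y (X.ε₂ x ⊗ₜ Y.ε₂ y) := by
  have h := X.interchange_ε Y X.G₁ Y.ε₁ x y
  rw [G₁_ε] at h
  refine Eq.trans ?_ (congrArg (LinearMap.lTensor (C ⊗[k] D) (shuffle₂ X Y)) h)
  refine (X.tensor Y).map_ε_lTensor ?_ _
  intro m
  induction m using TensorProduct.induction_on with
  | zero => simp
  | add x y hx hy => simp only [map_add, hx, hy]
  | tmul x y => rw [ε₁_shuffle₂, TensorProduct.map_tmul]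

theorem d_even : ZGrading.IsEven X.G₁ X.toZGrading (X.d C) := by
  constructor
  · intro t
    induction t using TensorProduct.induction_on with
    | zero => simp
    | add x y hx hy => simp only [map_add, hx, hy]
    | tmul a b => simp [d, G₁, ZGrading.tensor_ev]
  · intro t
    induction t using TensorProduct.induction_on with
    | zero => simp
    | add x y hx hy => simp only [map_add, hx, hy]
    | tmul a b => simp [d, G₁, ZGrading.tensor_od]
  · intro t
    induction t using TensorProduct.induction_on with
    | zero => simp
    | add x y hx hy => simp only [map_add, hx, hy]
    | tmul a b => simp [d, G₁, ZGrading.tensor_ε]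

theorem lTensor_d_shuffle₃ (x : C ⊗[k] (C ⊗[k] C)) (y : D ⊗[k] (D ⊗[k] D)) :
    ((X.tensor Y).d _).lTensor _ (shuffle₃ X Y (x ⊗ₜ y))
      = shuffle₂ X Y ((X.d C).lTensor _ x ⊗ₜ (Y.d D).lTensor _ y) := by
  have h := lTensor_lTensor_interchange Y X.d_even (Y.d D) (j' := LinearMap.id)
    (X.d_shuffle₂ Y) x y
  rw [LinearMap.lTensor_id] at h
  exact h

/-- Up to the signed exchange, `1 ⊗ η` is `d`. Membership is thus phrased through `d` and `τ`, which
are already known to commute with shuffles and later with coalgebra maps; `mem_Ω₂'` serves the same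
end. -/
theorem mem_Ω₁ {t : C ⊗[k] C} : t ∈ X.Ω₁ ↔ X.d C (X.τ t) = 0 := by
  rw [d_τ, Ω₁, LinearMap.mem_ker, LinearEquiv.map_eq_zero_iff]

theorem mem_Ω₂' {t : C ⊗[k] (C ⊗[k] C)} : t ∈ X.Ω₂ ↔ LinearMap.lTensor C (X.d C) t = 0 ∧
    LinearMap.lTensor C (X.d C) (LinearMap.lTensor C X.τ t) = 0 := by
  rw [mem_Ω₂, ← LinearMap.lTensor_comp_apply]
  have : X.d C ∘ₗ X.τ = (TensorProduct.rid k C).toLinearMap ∘ₗ X.η.lTensor C :=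
    LinearMap.ext fun t => X.d_τ t
  rw [this]

theorem τ_τ (t : C ⊗[k] C) : X.τ (X.τ t) = t := ZGrading.swap_swap t

variable {X Y}

/-- On the cocommutator subspace, `1 + τ` is the composition of `Δ` and `d`. -/
theorem Δ_d_of_mem {t : C ⊗[k] C} (ht : t ∈ X.Ω₁nat) : X.Δ (X.d C t) = t + X.τ t := by
  have h := X.d_b₁ t
  rw [LinearMap.mem_ker.1 ht.2, map_zero] at h
  rw [eq_comm, sub_add_eq_add_sub, sub_eq_zero] at h
  exact h.symm

/-- This is `b t = 0` solved for its middle term. It eliminates `1 ⊗ Δ` on cocommutator forms in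
favour of rotations of `Δl t`. -/
theorem lTensor_Δ_of_mem {t : C ⊗[k] C} (ht : t ∈ X.Ω₁nat) :
    LinearMap.lTensor C X.Δ t = X.Δl C t + X.rot₂ (X.Δl C t) := by
  have h := LinearMap.mem_ker.1 ht.2
  simp only [b₁, LinearMap.add_apply, LinearMap.sub_apply, LinearMap.comp_apply] at h
  rw [sub_add_eq_add_sub, sub_eq_zero] at h
  exact h.symm

variable (X Y)

theorem Δl_τ (t : C ⊗[k] C) : X.Δl C (X.τ t) = X.rot₂ (LinearMap.lTensor C X.Δ t) :=
  (X.rot₂_lTensor t).symm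

/-- Together with `Δl_τ` this replaces both coproducts of `τ t` by rotated coproducts of `t`, so no
further operators occur in the comparisons below. -/
theorem lTensor_Δ_τ (t : C ⊗[k] C) :
    LinearMap.lTensor C X.Δ (X.τ t) = X.rot₂ (X.rot₂ (X.Δl C t)) := (X.rot₂_rot₂ t).symm

/-- The boundary acts diagonally: each of its three terms commutes with the shuffle separately. The
same holds in degree two in `b₂_shuffle₃`. -/
theorem b₁_shuffle₂ (x : C ⊗[k] C) (y : D ⊗[k] D) :
    (X.tensor Y).b₁ (shuffle₂ X Y (x ⊗ₜ y)) = shuffle₃ X Y (X.Δl C x ⊗ₜ Y.Δl D y)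
      - shuffle₃ X Y (X.Δ.lTensor C x ⊗ₜ Y.Δ.lTensor D y)
      + shuffle₃ X Y (X.rot₂ (X.Δl C x) ⊗ₜ Y.rot₂ (Y.Δl D y)) := by
  simp only [b₁, LinearMap.add_apply, LinearMap.sub_apply, LinearMap.comp_apply, Δl_shuffle₂,
    Δ_shuffle₂, rot₂_shuffle₃]

theorem b₀_tmul (x : C) (y : D) : (X.tensor Y).b₀ (x ⊗ₜ y)
    = shuffle₂ X Y (X.Δ x ⊗ₜ Y.Δ y - X.τ (X.Δ x) ⊗ₜ Y.τ (Y.Δ y)) := by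
  have h : (X.tensor Y).Δ (x ⊗ₜ y) = shuffle₂ X Y (X.Δ x ⊗ₜ Y.Δ y) := rfl
  simp only [b₀, LinearMap.sub_apply, LinearMap.comp_apply, h, τ_shuffle₂, map_sub]

/-- The image of `x ⊗ y` under `1 ⊗ (1 + τ) Δ`, before division by `2`. -/
def symΔ : C →ₗ[k] C ⊗[k] C := X.Δ + X.τ ∘ₗ X.Δ

theorem symΔ_apply (x : C) : X.symΔ x = X.Δ x + X.τ (X.Δ x) := rfl

/-- The difference of `(1 ⊗ Δ) x ⊗ (Δ ⊗ 1) y` and `(Δ ⊗ 1) x ⊗ (1 ⊗ Δ) y`. -/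
def cup (x : C ⊗[k] C) (y : D ⊗[k] D) : (C ⊗[k] D) ⊗[k] ((C ⊗[k] D) ⊗[k] (C ⊗[k] D)) :=
  shuffle₃ X Y (X.Δ.lTensor C x ⊗ₜ Y.Δl D y - X.Δl C x ⊗ₜ Y.Δ.lTensor D y)

theorem kunneth₁₀_tmul (t : C ⊗[k] C) (y : D) : kunneth₁₀ X Y (t ⊗ₜ y)
    = (2⁻¹ : k) • shuffle₂ X Y (t ⊗ₜ Y.symΔ y) := by
  simp [kunneth₁₀, symΔ]

theorem kunneth₀₁_tmul (x : C) (t : D ⊗[k] D) : kunneth₀₁ X Y (x ⊗ₜ t)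
    = (2⁻¹ : k) • shuffle₂ X Y (X.symΔ (X.ε x) ⊗ₜ t) := by
  simp [kunneth₀₁, symΔ]

theorem kunneth₁₁_tmul (s : C ⊗[k] C) (t : D ⊗[k] D) : kunneth₁₁ X Y (s ⊗ₜ t)
    = (2⁻¹ : k) • cup X Y (X.ε₁ s) t := by
  simp [kunneth₁₁, cup]

/-! ### Boundaries of the products with `symΔ` and of the cup product. -/

variable {X Y}

/-- Put `a = Δl x`, `w = Δl (Δ y)` and `r = rot₂`. The other coproduct of `x` is `a + r a`; that of
`Δ y` is again `w` by coassociativity; those of `τ Δ y` are `r w` and `r² w`. Both sides equal the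
shuffle of `a ⊗ r w - a ⊗ r² w - r a ⊗ w + r a ⊗ r w`. -/
theorem b₁_shuffle₂_symΔ_right {x : C ⊗[k] C} (hx : x ∈ X.Ω₁nat) (y : D) :
    (X.tensor Y).b₁ (shuffle₂ X Y (x ⊗ₜ Y.symΔ y)) = - cup X Y x (Y.b₀ y) := by
  have h1 := lTensor_Δ_of_mem hx
  have h2 := Y.Δl_Δ y
  simp only [b₁_shuffle₂, cup, symΔ_apply, b₀, LinearMap.sub_apply, LinearMap.comp_apply, map_add,
    map_sub, Δl_τ, lTensor_Δ_τ, h1, h2, tmul_add, tmul_sub, add_tmul]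
  abel

/-- The mirror computation. The sign is opposite because `cup` is antisymmetric in the roles of `Δ ⊗
1` and `1 ⊗ Δ`. -/
theorem b₁_shuffle₂_symΔ_left (x : C) {y : D ⊗[k] D} (hy : y ∈ Y.Ω₁nat) :
    (X.tensor Y).b₁ (shuffle₂ X Y (X.symΔ x ⊗ₜ y)) = cup X Y (X.b₀ x) y := by
  have h1 := lTensor_Δ_of_mem hy
  have h2 := X.Δl_Δ x
  simp only [b₁_shuffle₂, cup, symΔ_apply, b₀, LinearMap.sub_apply, LinearMap.comp_apply, map_add,
    map_sub, Δl_τ, lTensor_Δ_τ, h1, h2, tmul_add, sub_tmul, add_tmul]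
  abel

/-- Here `d` undoes `Δ ⊗ 1` and turns `1 ⊗ Δ` into `Δ d`, which is `1 + τ` on cocommutator forms;
the two copies of `x ⊗ y` cancel. -/
theorem d_cup {x : C ⊗[k] C} (hx : x ∈ X.Ω₁nat) {y : D ⊗[k] D} (hy : y ∈ Y.Ω₁nat) :
    (X.tensor Y).d _ (cup X Y x y) = shuffle₂ X Y (X.τ x ⊗ₜ y - x ⊗ₜ Y.τ y) := by
  simp only [cup, map_sub, d_shuffle₃, d_Δl, d_lTensor, Δ_d_of_mem hx, Δ_d_of_mem hy, add_tmul,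
    tmul_add, map_add]
  abel

/-- Since `Δ d x = x + τ x` is already `τ`-invariant, `symΔ (d x) = 2 (x + τ x)`. The symmetric
parts cancel in the difference, and the doubled right-hand side of `d_cup` is left. This matches the
coefficient `2` of `d` in the differential of `X̂²`. -/
theorem two_d_cup {x : C ⊗[k] C} (hx : x ∈ X.Ω₁nat) {y : D ⊗[k] D} (hy : y ∈ Y.Ω₁nat) :
    (2 : k) • (X.tensor Y).d _ (cup X Y x y)
      = shuffle₂ X Y (X.symΔ (X.d C x) ⊗ₜ y) - shuffle₂ X Y (x ⊗ₜ Y.symΔ (Y.d D y)) := by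
  simp only [d_cup hx hy, symΔ_apply, Δ_d_of_mem hx, Δ_d_of_mem hy, add_tmul,
    tmul_add, map_add, map_sub, τ_τ, two_smul]
  abel

/-- With `a = Δl x`, `c = Δl y` and `r³ = 1`, the boundaries of `τ x ⊗ y` and of `x ⊗ τ y` are both
the shuffle of `a ⊗ r c + r a ⊗ c`, so their difference vanishes. -/
theorem b₁_d_cup {x : C ⊗[k] C} (hx : x ∈ X.Ω₁nat) {y : D ⊗[k] D} (hy : y ∈ Y.Ω₁nat) :
    (X.tensor Y).b₁ ((X.tensor Y).d _ (cup X Y x y)) = 0 := by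
  have h1 := lTensor_Δ_of_mem hx
  have h2 := lTensor_Δ_of_mem hy
  simp only [d_cup hx hy, map_sub, b₁_shuffle₂, Δl_τ, lTensor_Δ_τ, h1, h2, map_add, add_tmul,
    tmul_add, rot₂_rot₂_rot₂]
  abel

theorem b₂_shuffle₃ (x : C ⊗[k] (C ⊗[k] C)) (y : D ⊗[k] (D ⊗[k] D)) :
    (X.tensor Y).b₂ (shuffle₃ X Y (x ⊗ₜ y)) = shuffle₄ X Y (X.Δl _ x ⊗ₜ Y.Δl _ y)
      - shuffle₄ X Y ((X.Δl C).lTensor C x ⊗ₜ (Y.Δl D).lTensor D y)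
      + shuffle₄ X Y ((X.Δ.lTensor C).lTensor C x ⊗ₜ (Y.Δ.lTensor D).lTensor D y)
      - shuffle₄ X Y (X.rot₃ (X.Δl _ x) ⊗ₜ Y.rot₃ (Y.Δl _ y)) := by
  simp only [b₂, LinearMap.add_apply, LinearMap.sub_apply, LinearMap.comp_apply, Δl_shuffle₃,
    Δl_lTensor_shuffle₃, Δ_shuffle₃, rot₃_shuffle₄]

/-- Apply `Δl` to `(1 ⊗ Δ) x = Δl x + r (Δl x)` and use that rotating after a coproduct in the
second place is taking the coproduct in the first place after rotating. The next lemma applies `1 ⊗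
Δl` instead. -/
theorem rot₃_Δl_Δl_of_mem {x : C ⊗[k] C} (hx : x ∈ X.Ω₁nat) :
    X.rot₃ (X.Δl _ (X.Δl C x)) = X.Δl _ (X.Δ.lTensor C x) - X.Δl _ (X.Δl C x) := by
  rw [lTensor_Δ_of_mem hx, map_add, X.Δl_Δl, ← X.rot₃_lTensor_Δl]
  abel

theorem rot₃_Δl_Δ_of_mem {x : C ⊗[k] C} (hx : x ∈ X.Ω₁nat) :
    X.rot₃ (X.Δl _ (X.Δ.lTensor C x))
      = (X.Δl C).lTensor C (X.Δ.lTensor C x) - X.Δl _ (X.Δl C x) := by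
  rw [X.Δl_nat, X.rot₃_lTensor_Δ, lTensor_Δ_of_mem hx, map_add, X.Δl_Δl]
  abel

/-- By coassociativity only three iterated coproducts of `x` occur: `p = Δl (Δl x)`, `q = Δl ((1 ⊗
Δ) x)` and `s = (1 ⊗ Δl) ((1 ⊗ Δ) x)`. The rotation sends `p` to `q - p` and `q` to `s - p`. With
the analogous `p'`, `q'`, `s'` for `y`, the boundary of each of the two terms of `cup` is the
shuffle of `q ⊗ p' + p ⊗ q' - p ⊗ p'`. -/
theorem b₂_cup {x : C ⊗[k] C} (hx : x ∈ X.Ω₁nat) {y : D ⊗[k] D} (hy : y ∈ Y.Ω₁nat) :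
    (X.tensor Y).b₂ (cup X Y x y) = 0 := by
  have h0 := X.Δl_Δl x
  have h0' := Y.Δl_Δl y
  have h1 := X.Δl_nat X.Δ x
  have h1' := Y.Δl_nat Y.Δ y
  simp only [cup, map_sub, b₂_shuffle₃, rot₃_Δl_Δl_of_mem hx, rot₃_Δl_Δl_of_mem hy,
    rot₃_Δl_Δ_of_mem hx, rot₃_Δl_Δ_of_mem hy, ← lTensor_Δ_Δ, ← h0, ← h0', ← h1, ← h1', sub_tmul,
    tmul_sub]
  abel

theorem lTensor_d_Δ (t : C ⊗[k] C) :
    (X.d C).lTensor C (X.Δ.lTensor C t) = t := by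
  rw [← LinearMap.lTensor_comp_apply]
  have : X.d C ∘ₗ X.Δ = LinearMap.id := LinearMap.ext fun t => X.d_Δ t
  rw [this]; simp

theorem lTensor_d_τ_Δl {x : C ⊗[k] C} (hx : x ∈ X.Ω₁) :
    (X.d C).lTensor C (X.τ.lTensor C (X.Δl C x)) = 0 := by
  rw [← LinearMap.lTensor_comp_apply]
  have : X.d C ∘ₗ X.τ = (TensorProduct.rid k C).toLinearMap ∘ₗ X.η.lTensor C :=
    LinearMap.ext fun t => X.d_τ t
  rw [this, LinearMap.lTensor_comp_apply, ← Δl_nat, LinearMap.mem_ker.1 hx, map_zero, map_zero]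

/-- A counit in the middle place reduces both terms of `cup` to `x ⊗ y`, so they cancel; a counit in
the last place kills each term, because `x` and `y` are one-forms. -/
theorem cup_mem_Ω₂nat {x : C ⊗[k] C} (hx : x ∈ X.Ω₁nat) {y : D ⊗[k] D} (hy : y ∈ Y.Ω₁nat) :
    cup X Y x y ∈ (X.tensor Y).Ω₂nat := by
  refine (X.tensor Y).mem_Ω₂nat.2 ⟨(X.tensor Y).mem_Ω₂'.2 ⟨?_, ?_⟩, b₂_cup hx hy, b₁_d_cup hx hy⟩
  · simp only [cup, map_sub, lTensor_d_shuffle₃, lTensor_d_Δ, lTensor_d_Δl, sub_self]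
  · simp only [cup, map_sub, τ_shuffle₃, lTensor_d_shuffle₃, lTensor_d_τ_Δl hx.1,
      lTensor_d_τ_Δl hy.1, zero_tmul, tmul_zero, map_zero, sub_zero]

/-- A criterion for membership in `Ω̇¹`. -/
theorem mem_Ω₁dot_of_τ {t : C ⊗[k] C} (h1 : X.d C (X.τ t) = 0)
    (h2 : (2 : k) • (t + X.τ t) = X.symΔ (X.d C t)) : t ∈ X.Ω₁dot := by
  refine X.mem_Ω₁dot.2 ⟨X.mem_Ω₁.2 h1, ?_⟩
  -- A closed form of `2 d b + b d`: insert `d b t = t - Δ d t + τ t` and `b d t = Δ d t - τ Δ d t`.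
  have h : (2 : k) • X.d (C ⊗[k] C) (X.b₁ t) + X.b₀ (X.d C t)
      = (2 : k) • (t + X.τ t) - X.symΔ (X.d C t) := by
    simp only [d_b₁, b₀, symΔ_apply, LinearMap.sub_apply, LinearMap.comp_apply, two_smul]
    abel
  rw [h, h2, sub_self]

theorem d_symΔ (x : C) : X.d C (X.symΔ x) = (2 : k) • x := by
  rw [symΔ_apply, map_add, d_Δ, d_τ, X.counit_right, two_smul]

/-- As `symΔ y` is fixed by `τ` and `d (symΔ y) = 2 y`, the criterion follows from `Δ (d x) = x + τ
x`. -/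
theorem shuffle₂_symΔ_right_mem {x : C ⊗[k] C} (hx : x ∈ X.Ω₁nat) (y : D) :
    shuffle₂ X Y (x ⊗ₜ Y.symΔ y) ∈ (X.tensor Y).Ω₁dot := by
  refine mem_Ω₁dot_of_τ ?_ ?_
  · rw [τ_shuffle₂, d_shuffle₂, X.mem_Ω₁.1 hx.1, zero_tmul]
  · have h : (X.tensor Y).Δ (X.d C x ⊗ₜ y) = shuffle₂ X Y (X.Δ (X.d C x) ⊗ₜ Y.Δ y) := rfl
    rw [d_shuffle₂, d_symΔ, tmul_smul, map_smul, symΔ_apply (X.tensor Y), h, τ_shuffle₂,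
      τ_shuffle₂, Δ_d_of_mem hx]
    simp only [symΔ_apply, map_add, τ_τ, add_tmul, tmul_add]
    congr 1
    abel

theorem shuffle₂_symΔ_left_mem (x : C) {y : D ⊗[k] D} (hy : y ∈ Y.Ω₁nat) :
    shuffle₂ X Y (X.symΔ x ⊗ₜ y) ∈ (X.tensor Y).Ω₁dot := by
  refine mem_Ω₁dot_of_τ ?_ ?_
  · rw [τ_shuffle₂, d_shuffle₂, Y.mem_Ω₁.1 hy.1, tmul_zero]
  · have h : (X.tensor Y).Δ (x ⊗ₜ Y.d D y) = shuffle₂ X Y (X.Δ x ⊗ₜ Y.Δ (Y.d D y)) := rfl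
    rw [d_shuffle₂, d_symΔ, smul_tmul, tmul_smul, map_smul, symΔ_apply (X.tensor Y), h,
      τ_shuffle₂, τ_shuffle₂, Δ_d_of_mem hy]
    simp only [symΔ_apply, map_add, τ_τ, add_tmul, tmul_add]
    congr 1
    abel

theorem ε₁_symΔ (x : C) : X.ε₁ (X.symΔ x) = X.symΔ (X.ε x) := by
  have h : X.τ (X.ε₁ (X.Δ x)) = X.ε₁ (X.τ (X.Δ x)) := ZGrading.swap_ε _
  have h' : X.Δ (X.ε x) = X.ε₁ (X.Δ x) := X.Δ_ε x
  rw [symΔ_apply, symΔ_apply, map_add, h', h]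

theorem δ₁_symΔ (x : C) : X.δ₁ (X.symΔ x) = X.symΔ (X.δ x) := by
  have h : X.τ (X.δ₁ (X.Δ x)) = X.δ₁ (X.τ (X.Δ x)) := ZGrading.swap_tensorδ X.δ_odd X.δ_odd _
  have h' : X.Δ (X.δ x) = X.δ₁ (X.Δ x) := X.Δ_δ x
  rw [symΔ_apply, symΔ_apply, map_add, h', h]

theorem ε₂_Δl (t : C ⊗[k] C) : X.ε₂ (X.Δl C t) = X.Δl C (X.ε₁ t) := X.map_ε_Δl t

theorem ε₂_lTensor_Δ (t : C ⊗[k] C) :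
    X.ε₂ (LinearMap.lTensor C X.Δ t) = LinearMap.lTensor C X.Δ (X.ε₁ t) :=
  X.map_ε_lTensor (fun m => (X.Δ_ε m).symm) t

theorem δ₂_Δl (t : C ⊗[k] C) : X.δ₂ (X.Δl C t) = X.Δl C (X.δ₁ t) := X.tensorδ_Δl X.δ t

theorem δ₂_lTensor_Δ (t : C ⊗[k] C) :
    X.δ₂ (LinearMap.lTensor C X.Δ t) = LinearMap.lTensor C X.Δ (X.δ₁ t) :=
  X.tensorδ_lTensor (fun m => (X.Δ_δ m).symm) t

variable (X Y) in
theorem ε₂_cup (x : C ⊗[k] C) (y : D ⊗[k] D) :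
    (X.tensor Y).ε₂ (cup X Y x y) = cup X Y (X.ε₁ x) (Y.ε₁ y) := by
  simp only [cup, map_sub, ε₂_shuffle₃, ε₂_Δl, ε₂_lTensor_Δ]

variable (X Y) in
theorem δ₂_cup (x : C ⊗[k] C) (y : D ⊗[k] D) :
    (X.tensor Y).δ₂ (cup X Y x y) = cup X Y (X.δ₁ x) y + cup X Y (X.ε₁ x) (Y.δ₁ y) := by
  simp only [cup, map_sub, δ₂_shuffle₃, ε₂_Δl, ε₂_lTensor_Δ, δ₂_Δl, δ₂_lTensor_Δ, map_add]
  abel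

theorem δ₁_ε₁ (t : C ⊗[k] C) : X.δ₁ (X.ε₁ t) = - X.ε₁ (X.δ₁ t) := by
  have h := X.δ₁_odd.ε t
  rw [G₁_ε] at h
  rw [h, neg_neg]

theorem δ_ε (t : C) : X.δ (X.ε t) = - X.ε (X.δ t) := by
  rw [X.δ_odd.ε t, neg_neg]

variable (X Y)

/-- The Künneth map `p : X̂(C) ⊗ X̂(D) → X̂²(C ⊗ D)`. -/
def kunnethLin :
    (C × X.Ω₁nat) ⊗[k] (D × Y.Ω₁nat) →ₗ[k]
      (C ⊗[k] D) × (X.tensor Y).Ω₂nat × (X.tensor Y).Ω₁dot :=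
  LinearMap.prod (TensorProduct.map (LinearMap.fst k _ _) (LinearMap.fst k _ _))
    (LinearMap.prod
      (LinearMap.codRestrict _ (kunneth₁₁ X Y ∘ₗ
        TensorProduct.map (X.Ω₁nat.subtype ∘ₗ LinearMap.snd k _ _)
          (Y.Ω₁nat.subtype ∘ₗ LinearMap.snd k _ _)) (by
        intro t
        induction t using TensorProduct.induction_on with
        | zero => simp
        | add x y hx hy => rw [map_add]; exact Submodule.add_mem _ hx hy
        | tmul u v =>
          simp only [LinearMap.comp_apply, TensorProduct.map_tmul, LinearMap.snd_apply,
            Submodule.subtype_apply, kunneth₁₁_tmul]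
          -- The sign `(-1)^|ω|` is the involution `ε₁` on the first argument, which preserves
          -- `Ω¹C_♮`.
          exact Submodule.smul_mem _ _ (cup_mem_Ω₂nat (X.ε_mem_Ω₁nat u.2.2) v.2.2)))
      (LinearMap.codRestrict _ (kunneth₁₀ X Y ∘ₗ
          TensorProduct.map (X.Ω₁nat.subtype ∘ₗ LinearMap.snd k _ _) (LinearMap.fst k _ _)
        + kunneth₀₁ X Y ∘ₗ
          TensorProduct.map (LinearMap.fst k _ _) (Y.Ω₁nat.subtype ∘ₗ LinearMap.snd k _ _)) (by
        intro t
        induction t using TensorProduct.induction_on with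
        | zero => simp
        | add x y hx hy => rw [map_add]; exact Submodule.add_mem _ hx hy
        | tmul u v =>
          simp only [LinearMap.comp_apply, TensorProduct.map_tmul, LinearMap.snd_apply,
            LinearMap.fst_apply, LinearMap.add_apply,
            Submodule.subtype_apply, kunneth₁₀_tmul, kunneth₀₁_tmul]
          exact Submodule.add_mem _ (Submodule.smul_mem _ _ (shuffle₂_symΔ_right_mem u.2.2 _))
            (Submodule.smul_mem _ _ (shuffle₂_symΔ_left_mem _ v.2.2)))))

theorem kunnethLin_tmul (x : C) (s : X.Ω₁nat) (y : D) (t : Y.Ω₁nat) :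
    (kunnethLin X Y ((x, s) ⊗ₜ (y, t))).1 = x ⊗ₜ y ∧
    ((kunnethLin X Y ((x, s) ⊗ₜ (y, t))).2.1 : (C ⊗[k] D) ⊗[k] ((C ⊗[k] D) ⊗[k] (C ⊗[k] D)))
      = (2⁻¹ : k) • cup X Y (X.ε₁ s) t ∧
    ((kunnethLin X Y ((x, s) ⊗ₜ (y, t))).2.2 : (C ⊗[k] D) ⊗[k] (C ⊗[k] D))
      = (2⁻¹ : k) • (shuffle₂ X Y (s.1 ⊗ₜ Y.symΔ y) + shuffle₂ X Y (X.symΔ (X.ε x) ⊗ₜ t.1)) :=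
  ⟨rfl, kunneth₁₁_tmul X Y s.1 t.1, by
    rw [smul_add, ← kunneth₁₀_tmul, ← kunneth₀₁_tmul]; rfl⟩

end KunnethIdentities

end DGCoalgebra

namespace DGCoalgebra

/-! ### The Künneth map commutes with parities and differentials. -/

section KunnethMap

variable {k C D : Type*} [Field k] [AddCommGroup C] [Module k C] [AddCommGroup D] [Module k D]
variable (X : DGCoalgebra k C) (Y : DGCoalgebra k D)

theorem cup_sub_left (x x' : C ⊗[k] C) (y : D ⊗[k] D) :
    cup X Y (x - x') y = cup X Y x y - cup X Y x' y := by
  simp only [cup, map_sub, sub_tmul]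
  abel

theorem cup_sub_right (x : C ⊗[k] C) (y y' : D ⊗[k] D) :
    cup X Y x (y - y') = cup X Y x y - cup X Y x y' := by
  simp only [cup, map_sub, tmul_sub]
  abel

theorem cup_neg_left (x : C ⊗[k] C) (y : D ⊗[k] D) : cup X Y (-x) y = - cup X Y x y := by
  simp only [cup, map_sub, map_neg, neg_tmul]
  abel

theorem d_ε₁ (t : C ⊗[k] C) : X.d C (X.ε₁ t) = X.ε (X.d C t) := X.d_map_ε X.ε _

theorem Xhat_diff_fst (u : C × X.Ω₁nat) : (X.Xhat.diff u).1 = X.δ u.1 + X.d C u.2 := rfl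

theorem Xhat_diff_snd (u : C × X.Ω₁nat) :
    ((X.Xhat.diff u).2 : C ⊗[k] C) = X.b₀ u.1 - X.δ₁ u.2 := rfl

theorem Xhat_γ_fst (u : C × X.Ω₁nat) : (X.Xhat.γ u).1 = X.ε u.1 := rfl

theorem Xhat_γ_snd (u : C × X.Ω₁nat) : ((X.Xhat.γ u).2 : C ⊗[k] C) = - X.ε₁ u.2 := rfl

/-- The polarization `2 (a a' - c c') = (a - c)(a' + c') + (a + c)(a' - c')`, with `a = Δ x`, `c = τ
Δ x` and likewise for `y`. It explains the symmetrized coproducts in `p`. -/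
theorem two_b₀_tmul (x : C) (y : D) :
    (2 : k) • (X.tensor Y).b₀ (x ⊗ₜ y)
      = shuffle₂ X Y (X.b₀ x ⊗ₜ Y.symΔ y) + shuffle₂ X Y (X.symΔ x ⊗ₜ Y.b₀ y) := by
  rw [b₀_tmul]
  simp only [symΔ_apply, b₀, LinearMap.sub_apply, LinearMap.comp_apply, tmul_add,
    tmul_sub, add_tmul, sub_tmul, map_add, map_sub, two_smul]
  abel

theorem ε_tmul (x : C) (y : D) : (X.tensor Y).ε (x ⊗ₜ y) = X.ε x ⊗ₜ Y.ε y :=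
  LinearMap.congr_fun (ZGrading.tensor_ε _ _) (x ⊗ₜ y)

theorem δ_tmul (x : C) (y : D) : (X.tensor Y).δ (x ⊗ₜ y) = X.δ x ⊗ₜ y + X.ε x ⊗ₜ Y.δ y :=
  ZGrading.tensorδ_tmul _ _ _ _ _

theorem kunnethLin_fst (u : C × X.Ω₁nat) (v : D × Y.Ω₁nat) :
    (kunnethLin X Y (u ⊗ₜ v)).1 = u.1 ⊗ₜ v.1 := rfl

section

variable [NeZero (2 : k)]

theorem Xhat2_diff_fst (u : C × X.Ω₂nat × X.Ω₁dot) :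
    (X.Xhat2.diff u).1 = X.δ u.1 + X.d C u.2.2 := rfl

theorem Xhat2_diff_snd_fst (u : C × X.Ω₂nat × X.Ω₁dot) :
    ((X.Xhat2.diff u).2.1 : C ⊗[k] (C ⊗[k] C)) = X.δ₂ u.2.1 + X.b₁ u.2.2 := rfl

theorem Xhat2_diff_snd_snd (u : C × X.Ω₂nat × X.Ω₁dot) :
    ((X.Xhat2.diff u).2.2 : C ⊗[k] C)
      = X.b₀ u.1 + (2 : k) • X.d (C ⊗[k] C) u.2.1 - X.δ₁ u.2.2 := rfl

theorem Xhat2_γ_fst (u : C × X.Ω₂nat × X.Ω₁dot) : (X.Xhat2.γ u).1 = X.ε u.1 := rfl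

theorem Xhat2_γ_snd_fst (u : C × X.Ω₂nat × X.Ω₁dot) :
    ((X.Xhat2.γ u).2.1 : C ⊗[k] (C ⊗[k] C)) = X.ε₂ u.2.1 := rfl

theorem Xhat2_γ_snd_snd (u : C × X.Ω₂nat × X.Ω₁dot) :
    ((X.Xhat2.γ u).2.2 : C ⊗[k] C) = - X.ε₁ u.2.2 := rfl

theorem kunnethLin_two (u : C × X.Ω₁nat) (v : D × Y.Ω₁nat) :
    (2 : k) • ((kunnethLin X Y (u ⊗ₜ v)).2.1 : (C ⊗[k] D) ⊗[k] ((C ⊗[k] D) ⊗[k] (C ⊗[k] D)))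
      = cup X Y (X.ε₁ u.2) v.2 := by
  rw [(kunnethLin_tmul X Y u.1 u.2 v.1 v.2).2.1, smul_inv_smul₀ (NeZero.ne _)]

theorem kunnethLin_one (u : C × X.Ω₁nat) (v : D × Y.Ω₁nat) :
    (2 : k) • ((kunnethLin X Y (u ⊗ₜ v)).2.2 : (C ⊗[k] D) ⊗[k] (C ⊗[k] D))
      = shuffle₂ X Y (u.2.1 ⊗ₜ Y.symΔ v.1) + shuffle₂ X Y (X.symΔ (X.ε u.1) ⊗ₜ v.2.1) := by
  rw [(kunnethLin_tmul X Y u.1 u.2 v.1 v.2).2.2, smul_inv_smul₀ (NeZero.ne _)]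

theorem kunnethLin_γ (t : (C × X.Ω₁nat) ⊗[k] (D × Y.Ω₁nat)) :
    kunnethLin X Y ((X.Xhat.tensor Y.Xhat).γ t) = (X.tensor Y).Xhat2.γ (kunnethLin X Y t) := by
  induction t using TensorProduct.induction_on with
  | zero => simp only [map_zero]
  | add x y hx hy => simp only [map_add, hx, hy]
  | tmul u v =>
    have h2 : IsUnit (2 : k) := isUnit_iff_ne_zero.2 (NeZero.ne _)
    have h : (X.Xhat.tensor Y.Xhat).γ (u ⊗ₜ v) = X.Xhat.γ u ⊗ₜ Y.Xhat.γ v := rfl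
    rw [h]
    refine Prod.ext ?_ (Prod.ext (Subtype.ext (h2.smul_left_cancel.1 ?_))
      (Subtype.ext (h2.smul_left_cancel.1 ?_)))
    · rw [Xhat2_γ_fst, kunnethLin_fst, kunnethLin_fst, ε_tmul, Xhat_γ_fst, Xhat_γ_fst]
    · rw [Xhat2_γ_snd_fst, ← map_smul, kunnethLin_two, kunnethLin_two, ε₂_cup, Xhat_γ_snd,
        Xhat_γ_snd]
      simp only [cup, map_neg, neg_tmul, tmul_neg, neg_neg]
    · rw [Xhat2_γ_snd_snd, smul_neg, ← map_smul, kunnethLin_one, kunnethLin_one, Xhat_γ_snd,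
        Xhat_γ_snd, Xhat_γ_fst, Xhat_γ_fst, map_add, ε₁_shuffle₂, ε₁_shuffle₂, ε₁_symΔ, ε₁_symΔ]
      simp only [map_neg, neg_tmul, tmul_neg, neg_add]

theorem kunnethLin_diff (t : (C × X.Ω₁nat) ⊗[k] (D × Y.Ω₁nat)) :
    kunnethLin X Y ((X.Xhat.tensor Y.Xhat).diff t)
      = (X.tensor Y).Xhat2.diff (kunnethLin X Y t) := by
  induction t using TensorProduct.induction_on with
  | zero => simp only [map_zero]
  | add x y hx hy => simp only [map_add, hx, hy]
  | tmul u v =>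
    -- All three components are compared after doubling, which clears the factors `1/2` in `p`.
    have h2 : IsUnit (2 : k) := isUnit_iff_ne_zero.2 (NeZero.ne _)
    have h : (X.Xhat.tensor Y.Xhat).diff (u ⊗ₜ v)
        = X.Xhat.diff u ⊗ₜ v + X.Xhat.γ u ⊗ₜ Y.Xhat.diff v := rfl
    rw [h, map_add]
    refine Prod.ext (h2.smul_left_cancel.1 ?_) (Prod.ext (Subtype.ext (h2.smul_left_cancel.1 ?_))
      (Subtype.ext (h2.smul_left_cancel.1 ?_)))
    -- Forms of degree zero: `d ∘ symΔ = 2` produces the terms `d ω ⊗ e` and `± c ⊗ d ω'`.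
    · rw [Xhat2_diff_fst, smul_add (2 : k) _ ((X.tensor Y).d _ _), ← map_smul ((X.tensor Y).d _),
        kunnethLin_one, Prod.fst_add, kunnethLin_fst, kunnethLin_fst, kunnethLin_fst, map_add,
        d_shuffle₂, d_shuffle₂, d_symΔ, d_symΔ, δ_tmul, Xhat_diff_fst, Xhat_diff_fst, Xhat_γ_fst]
      simp only [add_tmul, tmul_add, smul_add, tmul_smul, smul_tmul']
      abel
    -- Forms of degree two: `b` of the mixed products gives the cups with `b c` and `b e`, and `δ`
    -- acts on `cup` as a derivation.
    · rw [Xhat2_diff_snd_fst, smul_add, ← map_smul, ← map_smul, kunnethLin_two, kunnethLin_one,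
        Prod.snd_add, Prod.fst_add, Submodule.coe_add, smul_add, kunnethLin_two, kunnethLin_two,
        map_add, b₁_shuffle₂_symΔ_right u.2.2, b₁_shuffle₂_symΔ_left _ v.2.2, δ₂_cup,
        Xhat_diff_snd, Xhat_diff_snd, Xhat_γ_snd, map_sub, map_neg, ε₁_ε₁, cup_sub_left,
        cup_neg_left, cup_sub_right, δ₁_ε₁, cup_neg_left, ε₁_b₀]
      abel
    -- Forms of degree one: `two_b₀_tmul` accounts for the terms with `b c` and `b e`, and
    -- `two_d_cup` for those with `d ω` and `d ω'`.
    · rw [Xhat2_diff_snd_snd, smul_sub, smul_add, ← map_smul ((X.tensor Y).δ₁),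
        ← map_smul ((X.tensor Y).d _), kunnethLin_two, kunnethLin_one, kunnethLin_fst, two_b₀_tmul,
        Prod.snd_add, Prod.snd_add, Submodule.coe_add, smul_add, kunnethLin_one, kunnethLin_one,
        two_d_cup (X.ε_mem_Ω₁nat u.2.2) v.2.2, map_add, δ₁_shuffle₂,
        δ₁_shuffle₂, ε₁_symΔ, δ₁_symΔ, δ₁_symΔ, δ_ε,
        Xhat_diff_snd, Xhat_diff_snd, Xhat_γ_snd, Xhat_diff_fst, Xhat_diff_fst, Xhat_γ_fst, d_ε₁]
      simp only [map_add, map_sub, map_neg, add_tmul, tmul_add, sub_tmul, tmul_sub, neg_tmul,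
        ZGrading.ε_ε]
      abel

/-- The Künneth morphism `p : X̂(C) ⊗ X̂(D) → X̂²(C ⊗ D)`. -/
def kunneth : SuperComplex.Hom (X.Xhat.tensor Y.Xhat) (X.tensor Y).Xhat2 where
  toLin := kunnethLin X Y
  map_γ := kunnethLin_γ X Y
  map_diff := kunnethLin_diff X Y

end

end KunnethMap

/-! ### Functoriality of forms and of `X̂²` in the coalgebra. -/

section Functoriality

variable {k C D : Type*} [Field k] [AddCommGroup C] [Module k C] [AddCommGroup D] [Module k D]
variable {X : DGCoalgebra k C} {Y : DGCoalgebra k D} (f : Hom X Y)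

namespace Hom

theorem even : ZGrading.IsEven X.toZGrading Y.toZGrading f.toLin :=
  ZGrading.isEven_of_deg _ _ f.map_deg

/-- The map induced on `C ⊗ C`. -/
def map₁ : C ⊗[k] C →ₗ[k] D ⊗[k] D := TensorProduct.map f.toLin f.toLin

/-- The map induced on `C ⊗ C ⊗ C`. -/
def map₂ : C ⊗[k] (C ⊗[k] C) →ₗ[k] D ⊗[k] (D ⊗[k] D) := TensorProduct.map f.toLin f.map₁

/-- The map induced on `C ⊗ C ⊗ C ⊗ C`. -/
def map₃ : C ⊗[k] (C ⊗[k] (C ⊗[k] C)) →ₗ[k] D ⊗[k] (D ⊗[k] (D ⊗[k] D)) :=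
  TensorProduct.map f.toLin f.map₂

theorem even₁ : ZGrading.IsEven X.G₁ Y.G₁ f.map₁ := f.even.tensor f.even

theorem even₂ : ZGrading.IsEven X.G₂ Y.G₂ f.map₂ := f.even.tensor f.even₁

variable {M N M' N' : Type*} [AddCommGroup M] [Module k M] [AddCommGroup N] [Module k N]
  [AddCommGroup M'] [Module k M'] [AddCommGroup N'] [Module k N']

theorem map_Δl (g : M →ₗ[k] N) (t : C ⊗[k] M) :
    Y.Δl N (TensorProduct.map f.toLin g t)
      = TensorProduct.map f.toLin (TensorProduct.map f.toLin g) (X.Δl M t) := by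
  induction t using TensorProduct.induction_on with
  | zero => simp
  | add x y hx hy => simp only [map_add, hx, hy]
  | tmul c m =>
    simp only [Δl, LinearMap.comp_apply, TensorProduct.map_tmul, LinearMap.rTensor_tmul,
      LinearEquiv.coe_coe, f.map_Δ]
    generalize X.Δ c = u
    induction u using TensorProduct.induction_on with
    | zero => simp
    | add x y hx hy => simp only [map_add, add_tmul, hx, hy]
    | tmul a b => simp

theorem map_lTensor {g : M →ₗ[k] N} {g' : M' →ₗ[k] N'} {h : M →ₗ[k] M'} {h' : N →ₗ[k] N'}
    (H : ∀ m, h' (g m) = g' (h m)) (t : C ⊗[k] M) :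
    h'.lTensor D (TensorProduct.map f.toLin g t)
      = TensorProduct.map f.toLin g' (h.lTensor C t) := by
  induction t using TensorProduct.induction_on with
  | zero => simp
  | add x y hx hy => simp only [map_add, hx, hy]
  | tmul c m => simp [H]

theorem map_d (g : M →ₗ[k] N) (t : C ⊗[k] M) :
    Y.d N (TensorProduct.map f.toLin g t) = g (X.d M t) := by
  induction t using TensorProduct.induction_on with
  | zero => simp
  | add x y hx hy => simp only [map_add, hx, hy]
  | tmul c m => simp [d, f.map_η]

theorem map_τ (t : C ⊗[k] C) : Y.τ (f.map₁ t) = f.map₁ (X.τ t) := f.even.swap f.even t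

theorem map_exch (g : M →ₗ[k] N) (t : C ⊗[k] (C ⊗[k] M)) :
    Y.exch N (TensorProduct.map f.toLin (TensorProduct.map f.toLin g) t)
      = TensorProduct.map f.toLin (TensorProduct.map f.toLin g) (X.exch M t) := by
  suffices h : Y.exch N ∘ₗ TensorProduct.map f.toLin (TensorProduct.map f.toLin g)
      = TensorProduct.map f.toLin (TensorProduct.map f.toLin g) ∘ₗ X.exch M from
    LinearMap.congr_fun h t
  ext a b m
  simp [exch_tmul, f.even.ev, f.even.od, f.even.ε]

theorem map_rot₂ (t : C ⊗[k] (C ⊗[k] C)) : Y.rot₂ (f.map₂ t) = f.map₂ (X.rot₂ t) := by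
  rw [rot₂_eq, rot₂_eq, map₂, map₁, f.map_exch]
  exact f.map_lTensor f.map_τ _

theorem map_rot₃ (t : C ⊗[k] (C ⊗[k] (C ⊗[k] C))) : Y.rot₃ (f.map₃ t) = f.map₃ (X.rot₃ t) := by
  rw [rot₃_eq, rot₃_eq, map₃, map₂, f.map_exch]
  exact f.map_lTensor f.map_rot₂ _

theorem map_b₀ (x : C) : Y.b₀ (f.toLin x) = f.map₁ (X.b₀ x) := by
  have h : Y.Δ (f.toLin x) = f.map₁ (X.Δ x) := f.map_Δ x
  simp only [b₀, LinearMap.sub_apply, LinearMap.comp_apply, h, map_τ, map_sub]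

theorem map_b₁ (t : C ⊗[k] C) : Y.b₁ (f.map₁ t) = f.map₂ (X.b₁ t) := by
  have h1 : Y.Δl D (f.map₁ t) = f.map₂ (X.Δl C t) := f.map_Δl f.toLin t
  have h2 : Y.Δ.lTensor D (f.map₁ t) = f.map₂ (X.Δ.lTensor C t) := f.map_lTensor f.map_Δ t
  simp only [b₁, LinearMap.sub_apply, LinearMap.add_apply, LinearMap.comp_apply, map_sub, map_add,
    h1, h2, map_rot₂]

theorem map_b₂ (t : C ⊗[k] (C ⊗[k] C)) : Y.b₂ (f.map₂ t) = f.map₃ (X.b₂ t) := by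
  have h1 : Y.Δl _ (f.map₂ t) = f.map₃ (X.Δl _ t) := f.map_Δl f.map₁ t
  have h2 : (Y.Δl D).lTensor D (f.map₂ t) = f.map₃ ((X.Δl C).lTensor C t) :=
    f.map_lTensor (f.map_Δl f.toLin) t
  have h3 : (Y.Δ.lTensor D).lTensor D (f.map₂ t) = f.map₃ ((X.Δ.lTensor C).lTensor C t) :=
    f.map_lTensor (f.map_lTensor f.map_Δ) t
  simp only [b₂, LinearMap.sub_apply, LinearMap.add_apply, LinearMap.comp_apply, map_sub, map_add,
    h1, h2, h3, map_rot₃]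

theorem map_d₁ (t : C ⊗[k] C) : Y.d D (f.map₁ t) = f.toLin (X.d C t) := f.map_d _ t

theorem map_d₂ (t : C ⊗[k] (C ⊗[k] C)) : Y.d _ (f.map₂ t) = f.map₁ (X.d _ t) := f.map_d _ t

theorem map_δ₁ (t : C ⊗[k] C) : Y.δ₁ (f.map₁ t) = f.map₁ (X.δ₁ t) :=
  ZGrading.tensorδ_map f.even.ε f.map_δ f.map_δ t

theorem map_δ₂ (t : C ⊗[k] (C ⊗[k] C)) : Y.δ₂ (f.map₂ t) = f.map₂ (X.δ₂ t) :=
  ZGrading.tensorδ_map f.even.ε f.map_δ f.map_δ₁ t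

theorem map_ε₁ (t : C ⊗[k] C) : Y.ε₁ (f.map₁ t) = f.map₁ (X.ε₁ t) := by
  rw [← G₁_ε, ← G₁_ε, f.even₁.ε]

theorem map_ε₂ (t : C ⊗[k] (C ⊗[k] C)) : Y.ε₂ (f.map₂ t) = f.map₂ (X.ε₂ t) := by
  rw [← G₂_ε, ← G₂_ε, f.even₂.ε]

theorem map₁_mem_Ω₁ {t : C ⊗[k] C} (ht : t ∈ X.Ω₁) : f.map₁ t ∈ Y.Ω₁ := by
  rw [mem_Ω₁] at ht ⊢
  rw [map_τ, map_d₁, ht, map_zero]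

theorem map₂_mem_Ω₂ {t : C ⊗[k] (C ⊗[k] C)} (ht : t ∈ X.Ω₂) : f.map₂ t ∈ Y.Ω₂ := by
  rw [mem_Ω₂'] at ht ⊢
  have h1 : (Y.d D).lTensor D (f.map₂ t) = f.map₁ ((X.d C).lTensor C t) :=
    f.map_lTensor f.map_d₁ t
  have h2 : Y.τ.lTensor D (f.map₂ t) = f.map₂ (X.τ.lTensor C t) := f.map_lTensor f.map_τ t
  have h3 : (Y.d D).lTensor D (f.map₂ (X.τ.lTensor C t))
      = f.map₁ ((X.d C).lTensor C (X.τ.lTensor C t)) := f.map_lTensor f.map_d₁ _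
  rw [h1, h2, h3, ht.1, ht.2, map_zero]
  exact ⟨rfl, rfl⟩

theorem map₁_mem_Ω₁dot {t : C ⊗[k] C} (ht : t ∈ X.Ω₁dot) : f.map₁ t ∈ Y.Ω₁dot := by
  rw [mem_Ω₁dot] at ht ⊢
  refine ⟨f.map₁_mem_Ω₁ ht.1, ?_⟩
  rw [map_b₁, map_d₂, map_d₁, map_b₀, ← map_smul, ← map_add, ht.2, map_zero]

theorem map₂_mem_Ω₂nat {t : C ⊗[k] (C ⊗[k] C)} (ht : t ∈ X.Ω₂nat) : f.map₂ t ∈ Y.Ω₂nat := by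
  rw [mem_Ω₂nat] at ht ⊢
  refine ⟨f.map₂_mem_Ω₂ ht.1, ?_, ?_⟩
  · rw [map_b₂, ht.2.1, map_zero]
  · rw [map_d₂, map_b₁, ht.2.2, map_zero]

/-- The morphism `X̂²(f)`. -/
def Xhat2 [NeZero (2 : k)] : SuperComplex.Hom X.Xhat2 Y.Xhat2 where
  toLin := f.toLin.prodMap ((f.map₂.restrict fun _ => f.map₂_mem_Ω₂nat).prodMap
    (f.map₁.restrict fun _ => f.map₁_mem_Ω₁dot))
  map_γ := by
    rintro ⟨x, s, t⟩
    refine Prod.ext ?_ (Prod.ext (Subtype.ext ?_) (Subtype.ext ?_))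
    · exact (f.even.ε x).symm
    · exact (f.map_ε₂ s).symm
    · exact (map_neg f.map₁ _).trans (congrArg _ (f.map_ε₁ t).symm)
  map_diff := by
    rintro ⟨x, s, t⟩
    refine Prod.ext ?_ (Prod.ext (Subtype.ext ?_) (Subtype.ext ?_))
    · change f.toLin (X.δ x + X.d C t) = Y.δ (f.toLin x) + Y.d D (f.map₁ t)
      rw [map_add, f.map_δ, map_d₁]
    · change f.map₂ (X.δ₂ s + X.b₁ t) = Y.δ₂ (f.map₂ s) + Y.b₁ (f.map₁ t)
      rw [map_add, map_δ₂, map_b₁]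
    · change f.map₁ (X.b₀ x + (2 : k) • X.d _ s.1 - X.δ₁ t)
        = Y.b₀ (f.toLin x) + (2 : k) • Y.d _ (f.map₂ s) - Y.δ₁ (f.map₁ t)
      rw [map_sub, map_add, map_smul, map_b₀, map_d₂, map_δ₁]

end Hom

end Functoriality

end DGCoalgebra

/-- The composition of two morphisms of supercomplexes. -/
def SuperComplex.Hom.comp {k U V W : Type*} [Field k] [AddCommGroup U] [Module k U]
    [AddCommGroup V] [Module k V] [AddCommGroup W] [Module k W] {L : SuperComplex k U}
    {M : SuperComplex k V} {N : SuperComplex k W} (g : SuperComplex.Hom M N)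
    (f : SuperComplex.Hom L M) : SuperComplex.Hom L N where
  toLin := g.toLin ∘ₗ f.toLin
  map_γ v := by rw [LinearMap.comp_apply, LinearMap.comp_apply, f.map_γ, g.map_γ]
  map_diff v := by rw [LinearMap.comp_apply, LinearMap.comp_apply, f.map_diff, g.map_diff]

/-! ### Word combinatorics in the bar construction and formulas for `θ` and `∇` without letters. -/

section BarForms

variable (k A : Type*) [Field k] [NonUnitalRing A] [Module k A]

/-- The projection onto the words of length one. -/
def oneLetter : TensorAlgebra k A →ₗ[k] TensorAlgebra k A :=
  TensorAlgebra.ι k ∘ₗ TensorAlgebra.ιInv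

/-- The projection onto the words of positive length. -/
def posPart : TensorAlgebra k A →ₗ[k] TensorAlgebra k A :=
  LinearMap.id - (emptyWord k A).smulRight 1

/-- The map `u ⊗ v ↦ π(u) v`, where `π` is the projection onto the words of length one. -/
def headMul : TensorAlgebra k A ⊗[k] TensorAlgebra k A →ₗ[k] TensorAlgebra k A :=
  LinearMap.mul' k (TensorAlgebra k A) ∘ₗ (oneLetter k A).rTensor _

variable {k A}

theorem ιInv_one : TensorAlgebra.ιInv (1 : TensorAlgebra k A) = 0 := by
  -- The map `ιInv` is defined through the trivial square-zero extension of `k` by `A`, which needs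
  -- a right action of `k`; it is the left action, as `k` is commutative.
  let _ : Module kᵐᵒᵖ A := Module.compHom _ ((RingHom.id k).fromOpposite mul_comm)
  have _ : IsCentralScalar k A := ⟨fun r m => rfl⟩
  exact congrArg TrivSqZeroExt.snd
    (map_one (TensorAlgebra.toTrivSqZeroExt (R := k) (M := A)))

theorem ιInv_cons (a : A) (x : TensorAlgebra k A) :
    TensorAlgebra.ιInv (TensorAlgebra.ι k a * x) = emptyWord k A x • a := by
  suffices h : TensorAlgebra.ιInv ∘ₗ LinearMap.mulLeft k (TensorAlgebra.ι k a)
      = (emptyWord k A).smulRight a from LinearMap.congr_fun h x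
  let _ : Module kᵐᵒᵖ A := Module.compHom _ ((RingHom.id k).fromOpposite mul_comm)
  have _ : IsCentralScalar k A := ⟨fun r m => rfl⟩
  apply word_ext
  · have := TensorAlgebra.ι_leftInverse (R := k) (M := A) a
    simpa using this
  · intro b y _
    simp [TensorAlgebra.ιInv]

@[simp] theorem oneLetter_one : oneLetter k A 1 = 0 := by simp [oneLetter, ιInv_one]

@[simp] theorem oneLetter_cons (a : A) (x : TensorAlgebra k A) :
    oneLetter k A (TensorAlgebra.ι k a * x) = emptyWord k A x • TensorAlgebra.ι k a := by
  simp [oneLetter, ιInv_cons]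

theorem posPart_apply (x : TensorAlgebra k A) : posPart k A x = x - emptyWord k A x • 1 := rfl

theorem emptyWord_posPart (x : TensorAlgebra k A) : emptyWord k A (posPart k A x) = 0 := by
  rw [posPart_apply, map_sub, map_smul, emptyWord_one, smul_eq_mul, mul_one, sub_self]

@[simp] theorem headMul_tmul (x y : TensorAlgebra k A) :
    headMul k A (x ⊗ₜ y) = oneLetter k A x * y := rfl

theorem emptyWord_oneLetter_mul (x y : TensorAlgebra k A) :
    emptyWord k A (oneLetter k A x * y) = 0 := emptyWord_cons _ _

theorem emptyWord_headMul (t : TensorAlgebra k A ⊗[k] TensorAlgebra k A) :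
    emptyWord k A (headMul k A t) = 0 := by
  induction t using TensorProduct.induction_on with
  | zero => simp
  | add x y hx hy => rw [map_add, map_add, hx, hy, add_zero]
  | tmul x y => exact emptyWord_oneLetter_mul x y

/-- A nonempty word has exactly one cut whose left part is a single letter, and concatenation
restores the word. The next lemma is the same at the right end. -/
theorem headMul_deconc (x : TensorAlgebra k A) : headMul k A (deconc k A x) = posPart k A x := by
  suffices h : headMul k A ∘ₗ deconc k A = posPart k A from LinearMap.congr_fun h x
  apply word_ext
  · simp [posPart_apply]
  · intro a y _
    have h1 : ∀ t : TensorAlgebra k A ⊗[k] TensorAlgebra k A, headMul k A (consL _ a t)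
        = TensorAlgebra.ι k a * TensorProduct.lid k _ ((emptyWord k A).rTensor _ t) := by
      intro t
      induction t using TensorProduct.induction_on with
      | zero => simp
      | add x y hx hy => simp only [map_add, mul_add, hx, hy]
      | tmul p q => simp
    simp [h1, posPart_apply, deconc_counit_left]

theorem mul_oneLetter_deconc (x : TensorAlgebra k A) :
    LinearMap.mul' k _ ((oneLetter k A).lTensor _ (deconc k A x)) = posPart k A x := by
  suffices h : LinearMap.mul' k _ ∘ₗ (oneLetter k A).lTensor _ ∘ₗ deconc k A = posPart k A from
    LinearMap.congr_fun h x
  apply word_ext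
  · simp [posPart_apply]
  · intro a y hy
    have h1 : ∀ t : TensorAlgebra k A ⊗[k] TensorAlgebra k A,
        LinearMap.mul' k _ ((oneLetter k A).lTensor _ (consL _ a t))
        = TensorAlgebra.ι k a * LinearMap.mul' k _ ((oneLetter k A).lTensor _ t) := by
      intro t
      induction t using TensorProduct.induction_on with
      | zero => simp
      | add x y hx hy => simp only [map_add, mul_add, hx, hy]
      | tmul p q => simp [mul_assoc]
    simp only [LinearMap.comp_apply] at hy ⊢
    simp [h1, hy, posPart_apply, mul_sub]

theorem cons_firstLetter (x : TensorAlgebra k A) :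
    cons k A (firstLetter k A x) = posPart k A x := by
  suffices h : cons k A ∘ₗ firstLetter k A = posPart k A from LinearMap.congr_fun h x
  apply word_ext
  · simp [posPart_apply]
  · intro a y _
    simp [posPart_apply, cons]

/-- Removing the last letter leaves the empty word exactly for words of length one. -/
theorem lid_lastLetter (x : TensorAlgebra k A) :
    TensorProduct.lid k A ((emptyWord k A).rTensor A (lastLetter k A x))
      = TensorAlgebra.ιInv x := by
  suffices h : (TensorProduct.lid k A).toLinearMap ∘ₗ (emptyWord k A).rTensor A ∘ₗ lastLetter k A
      = TensorAlgebra.ιInv from LinearMap.congr_fun h x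
  apply word_ext
  · simp [ιInv_one]
  · intro a y _
    have h1 : ∀ t : TensorAlgebra k A ⊗[k] A,
        (emptyWord k A).rTensor A (consL _ a t) = 0 := by
      intro t
      induction t using TensorProduct.induction_on with
      | zero => simp
      | add x y hx hy => simp only [map_add, hx, hy, add_zero]
      | tmul p q => simp
    simp [h1, ιInv_cons]

theorem mul_mem_barDeg {i j : ℤ} {x y : TensorAlgebra k A} (hx : x ∈ barDeg k A i)
    (hy : y ∈ barDeg k A j) : x * y ∈ barDeg k A (i + j) := by
  refine barDeg_induction (P := fun i x => x * y ∈ barDeg k A (i + j)) ?_ ?_ ?_ ?_ ?_ hx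
  · intro i; simp
  · simpa using hy
  · intro i r x h; rw [smul_mul_assoc]; exact Submodule.smul_mem _ _ h
  · intro i x y h h'; rw [add_mul]; exact Submodule.add_mem _ h h'
  · intro i a x _ h
    rw [mul_assoc]
    exact cons_mem_barDeg h a (by ring)

theorem oneLetter_mem {i : ℤ} {x : TensorAlgebra k A} (hx : x ∈ barDeg k A i) :
    oneLetter k A x ∈ barDeg k A i := by
  refine barDeg_induction (P := fun i x => oneLetter k A x ∈ barDeg k A i) ?_ ?_ ?_ ?_ ?_ hx
  · intro i; simp
  · simp
  · intro i r x h; rw [map_smul]; exact Submodule.smul_mem _ _ h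
  · intro i x y h h'; rw [map_add]; exact Submodule.add_mem _ h h'
  · intro i a x hx h
    rw [oneLetter_cons]
    by_cases hi : i = 0
    · subst hi
      have := cons_mem_barDeg (one_mem_barDeg (k := k) (A := A)) a rfl
      rw [mul_one] at this
      exact Submodule.smul_mem _ _ this
    · rw [emptyWord_eq_zero i hi x hx, zero_smul]
      exact Submodule.zero_mem _

/-- A cut of the word `x y` falls in `x` or in `y`; the cut between the two is counted twice and
subtracted once. -/
theorem deconc_mul (x y : TensorAlgebra k A) :
    deconc k A (x * y) = (LinearMap.mulRight k y).lTensor _ (deconc k A x)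
      + (LinearMap.mulLeft k x).rTensor _ (deconc k A y) - x ⊗ₜ y := by
  suffices h : deconc k A ∘ₗ LinearMap.mulRight k y
      = (LinearMap.mulRight k y).lTensor _ ∘ₗ deconc k A
      + LinearMap.applyₗ (deconc k A y) ∘ₗ LinearMap.rTensorHom _ ∘ₗ
        LinearMap.mul k (TensorAlgebra k A) - (TensorProduct.mk k _ _).flip y
      from LinearMap.congr_fun h x
  have h1 : ∀ z : TensorAlgebra k A, (LinearMap.applyₗ (deconc k A y) ∘ₗ LinearMap.rTensorHom _ ∘ₗ
        LinearMap.mul k (TensorAlgebra k A)) z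
        = (LinearMap.mulLeft k z).rTensor _ (deconc k A y) := fun _ => rfl
  apply word_ext
  · simp only [LinearMap.add_apply, LinearMap.sub_apply, LinearMap.comp_apply, h1]
    simp
  · intro a x hx
    have h2 : ∀ t : TensorAlgebra k A ⊗[k] TensorAlgebra k A,
        (LinearMap.mulRight k y).lTensor _ (consL _ a t)
          = consL _ a ((LinearMap.mulRight k y).lTensor _ t) := by
      intro t
      induction t using TensorProduct.induction_on with
      | zero => simp
      | add x y hx hy => simp only [map_add, hx, hy]
      | tmul p q => simp
    have h3 : ∀ t : TensorAlgebra k A ⊗[k] TensorAlgebra k A,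
        (LinearMap.mulLeft k (TensorAlgebra.ι k a * x)).rTensor _ t
          = consL _ a ((LinearMap.mulLeft k x).rTensor _ t) := by
      intro t
      induction t using TensorProduct.induction_on with
      | zero => simp
      | add x y hx hy => simp only [map_add, hx, hy]
      | tmul p q => simp
    simp only [LinearMap.add_apply, LinearMap.sub_apply, LinearMap.comp_apply, h1,
      LinearMap.mulRight_apply, LinearMap.flip_apply, TensorProduct.mk_apply] at hx ⊢
    rw [mul_assoc, deconc_cons, deconc_cons, hx, h3, map_add, h2, map_sub, map_add]
    simp only [LinearMap.lTensor_tmul, LinearMap.mulRight_apply, mul_assoc, consL_tmul]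
    abel

variable [IsScalarTower k A A] [SMulCommClass k A A]

variable (k A) in
/-- The map `u ⊗ v ↦ ∑ u' ⊗ u'' v`. -/
def splitMul : TensorAlgebra k A ⊗[k] TensorAlgebra k A →ₗ[k]
    TensorAlgebra k A ⊗[k] TensorAlgebra k A :=
  (LinearMap.mul' k (TensorAlgebra k A)).lTensor _ ∘ₗ (bar k A).Δl _

variable (k A) in
/-- The map `u ⊗ v ↦ η(u) v - π(u) v`, where `π` is the projection onto the words of length one. -/
def headDiff : TensorAlgebra k A ⊗[k] TensorAlgebra k A →ₗ[k] TensorAlgebra k A :=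
  (bar k A).d _ - headMul k A

theorem ofBimodule_eq (t : TensorAlgebra k A ⊗[k] (A ⊗[k] TensorAlgebra k A)) :
    ofBimodule k A t = splitMul k A ((cons k A).lTensor _ t) := by
  suffices h : ofBimodule k A = splitMul k A ∘ₗ (cons k A).lTensor _ from LinearMap.congr_fun h t
  apply TensorProduct.ext'
  intro x t
  rfl

/-- Eliminates the coordinates `BA ⊗ A ⊗ BA`: from here on only endomorphisms built from
concatenation, deconcatenation and `oneLetter` are needed. -/
theorem nabla_eq (t : TensorAlgebra k A ⊗[k] (TensorAlgebra k A ⊗[k] TensorAlgebra k A)) :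
    nabla k A t = splitMul k A ((headMul k A).lTensor _ ((bar k A).rot₂ t)) := by
  have h : headMul k A = cons k A ∘ₗ TensorAlgebra.ιInv.rTensor (TensorAlgebra k A) := by
    apply TensorProduct.ext'
    intro x y
    rfl
  rw [h, LinearMap.lTensor_comp_apply, ← ofBimodule_eq]
  rfl

/-- For `α ⊗ β`, the first term of the bimodule coordinates survives `d` when `α` is empty, and
restores the positive part of `β`; the second survives when `α` is a single letter, which is then
put in front of `β`. -/
theorem cons_toBimodule (t : TensorAlgebra k A ⊗[k] TensorAlgebra k A) :
    cons k A ((bar k A).d _ (toBimodule k A t))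
      = posPart k A ((bar k A).d _ t) - headMul k A t := by
  induction t using TensorProduct.induction_on with
  | zero => simp
  | add x y hx hy => simp only [map_add, hx, hy]; abel
  | tmul x y =>
    have h : ∀ s : TensorAlgebra k A ⊗[k] A, cons k A ((bar k A).d (A ⊗[k] TensorAlgebra k A)
        (TensorProduct.assoc k _ _ _ (s ⊗ₜ y)))
        = TensorAlgebra.ι k (TensorProduct.lid k A ((emptyWord k A).rTensor A s)) * y := by
      intro s
      induction s using TensorProduct.induction_on with
      | zero => simp
      | add x y hx hy => simp only [map_add, add_tmul, add_mul, hx, hy]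
      | tmul p q => simp [DGCoalgebra.d, bar, cons]
    simp only [toBimodule, LinearMap.sub_apply, LinearMap.comp_apply, LinearMap.rTensor_tmul,
      map_sub, LinearEquiv.coe_coe, h, lid_lastLetter, LinearMap.lTensor_tmul]
    congr 1
    simp [DGCoalgebra.d, cons_firstLetter]

theorem emptyWord_d_of_mem {t : TensorAlgebra k A ⊗[k] TensorAlgebra k A}
    (ht : t ∈ (bar k A).Ω₁) : emptyWord k A ((bar k A).d _ t) = 0 := by
  have h := (bar k A).d_lTensor (bar k A).η t
  rw [LinearMap.mem_ker.1 ht, map_zero] at h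
  exact h.symm

theorem lTensor_posPart (t : TensorAlgebra k A ⊗[k] TensorAlgebra k A) :
    (posPart k A).lTensor _ t = t - (bar k A).d _ ((bar k A).τ t) ⊗ₜ 1 := by
  rw [DGCoalgebra.d_τ]
  induction t using TensorProduct.induction_on with
  | zero => simp
  | add x y hx hy => simp only [map_add, add_tmul, hx, hy]; abel
  | tmul x y => simp [posPart_apply, tmul_sub, bar, smul_tmul]

theorem splitMul_tmul_one (x : TensorAlgebra k A) :
    splitMul k A (x ⊗ₜ 1) = (bar k A).Δ x := by
  simp only [splitMul, DGCoalgebra.Δl, LinearMap.comp_apply, LinearMap.rTensor_tmul,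
    LinearEquiv.coe_coe]
  generalize (bar k A).Δ x = u
  induction u using TensorProduct.induction_on with
  | zero => simp
  | add x y hx hy => simp only [map_add, add_tmul, hx, hy]
  | tmul x y => simp

variable (k A) in
/-- The map `Q τ Δ - Δ`, where `Q (u ⊗ v) = ∑ u' ⊗ u'' v`. On words of positive length it is the
isomorphism with the cocommutator subspace of the forms of degree one. -/
def cyc : TensorAlgebra k A →ₗ[k] TensorAlgebra k A ⊗[k] TensorAlgebra k A :=
  splitMul k A ∘ₗ (bar k A).τ ∘ₗ (bar k A).Δ - (bar k A).Δ

/-- The cyclic word attached to a one-form is `d t - P t`; no empty-word correction occurs, since `η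
d` vanishes on one-forms. Discarding the cut with an empty right factor from `τ Δ` accounts for the
term `- Δ` in `cyc`. -/
theorem θ_eq {t : TensorAlgebra k A ⊗[k] TensorAlgebra k A} (ht : t ∈ (bar k A).Ω₁) :
    θ k A t = cyc k A (headDiff k A t) := by
  have h1 : ∀ s, ofBimodule k A ((firstLetter k A).lTensor _ s)
      = splitMul k A ((posPart k A).lTensor _ s) := by
    intro s
    rw [ofBimodule_eq, ← LinearMap.lTensor_comp_apply]
    have : cons k A ∘ₗ firstLetter k A = posPart k A := LinearMap.ext cons_firstLetter
    rw [this]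
  have h2 : θ k A t = splitMul k A ((posPart k A).lTensor _ ((bar k A).τ ((bar k A).Δ
      (cons k A ((bar k A).d _ (toBimodule k A t)))))) := h1 _
  have h3 : cons k A ((bar k A).d _ (toBimodule k A t)) = headDiff k A t := by
    rw [cons_toBimodule, posPart_apply, emptyWord_d_of_mem ht, zero_smul, sub_zero]
    rfl
  rw [h2, h3, lTensor_posPart, DGCoalgebra.τ_τ, DGCoalgebra.d_Δ, map_sub, splitMul_tmul_one]
  rfl

theorem headMul_Δ (x : TensorAlgebra k A) :
    headMul k A ((bar k A).Δ x) = posPart k A x := headMul_deconc x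

theorem headDiff_Δ (x : TensorAlgebra k A) :
    headDiff k A ((bar k A).Δ x) = emptyWord k A x • 1 := by
  rw [headDiff, LinearMap.sub_apply, DGCoalgebra.d_Δ, headMul_Δ, posPart_apply, sub_sub_cancel]

theorem mul_lTensor_headMul (x y : TensorAlgebra k A) :
    LinearMap.mul' k _ ((headMul k A).lTensor _ ((bar k A).Δl _ (x ⊗ₜ y)))
      = posPart k A x * y := by
  rw [← mul_oneLetter_deconc]
  have h : (bar k A).Δl (TensorAlgebra k A) (x ⊗ₜ y)
      = TensorProduct.assoc k _ _ _ (deconc k A x ⊗ₜ y) := rfl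
  rw [h]
  generalize deconc k A x = u
  induction u using TensorProduct.induction_on with
  | zero => simp
  | add x y hx hy => simp only [map_add, add_tmul, add_mul, hx, hy]
  | tmul p q => simp [mul_assoc]

/-- Since `∑ x' π(x'') = x - η(x)`, multiplying after `(1 ⊗ P)(Δ ⊗ 1)` gives multiplication minus
`d`; coassociativity supplies the remaining first factor. As `(1 ⊗ d)(Δ ⊗ 1) = 1`, it follows that
`Q (1 ⊗ (d - P))` is a left inverse of `Δ ⊗ 1`. -/
theorem splitMul_headMul_Δl (t : TensorAlgebra k A ⊗[k] TensorAlgebra k A) :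
    splitMul k A ((headMul k A).lTensor _ ((bar k A).Δl _ t)) = splitMul k A t - t := by
  have h : LinearMap.mul' k (TensorAlgebra k A) ∘ₗ (headMul k A).lTensor _ ∘ₗ (bar k A).Δl _
      = LinearMap.mul' k (TensorAlgebra k A) - (bar k A).d _ := by
    apply TensorProduct.ext'
    intro x y
    refine (mul_lTensor_headMul x y).trans ?_
    simp [posPart_apply, sub_mul, DGCoalgebra.d, bar]
  rw [splitMul, LinearMap.comp_apply, LinearMap.comp_apply, DGCoalgebra.Δl_nat,
    DGCoalgebra.Δl_Δl, ← LinearMap.lTensor_comp_apply, ← LinearMap.lTensor_comp_apply,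
    LinearMap.comp_assoc, h, LinearMap.lTensor_sub, LinearMap.sub_apply, DGCoalgebra.lTensor_d_Δl]

variable (k A) in
/-- The map `u ⊗ v ⊗ m ↦ u v ⊗ m`. -/
def mulAssoc (M : Type*) [AddCommGroup M] [Module k M] :
    TensorAlgebra k A ⊗[k] (TensorAlgebra k A ⊗[k] M) →ₗ[k] TensorAlgebra k A ⊗[k] M :=
  (LinearMap.mul' k (TensorAlgebra k A)).rTensor M ∘ₗ (TensorProduct.assoc k _ _ _).symm.toLinearMap

theorem Δ_mul' (t : TensorAlgebra k A ⊗[k] TensorAlgebra k A) :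
    (bar k A).Δ (LinearMap.mul' k _ t) = splitMul k A t
      + mulAssoc k A _ ((bar k A).Δ.lTensor _ t) - t := by
  induction t using TensorProduct.induction_on with
  | zero => simp
  | add x y hx hy => simp only [map_add, hx, hy]; abel
  | tmul x y =>
    refine (deconc_mul x y).trans ?_
    congr 2
    · have h : splitMul k A (x ⊗ₜ y) = (LinearMap.mul' k (TensorAlgebra k A)).lTensor _
        (TensorProduct.assoc k _ _ _ (deconc k A x ⊗ₜ y)) := rfl
      rw [h]
      generalize deconc k A x = u
      induction u using TensorProduct.induction_on with
      | zero => simp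
      | add x y hx hy => simp only [map_add, add_tmul, hx, hy]
      | tmul p q => simp
    · have h : (bar k A).Δ.lTensor _ (x ⊗ₜ y) = x ⊗ₜ[k] deconc k A y := rfl
      rw [h]
      generalize deconc k A y = u
      induction u using TensorProduct.induction_on with
      | zero => simp
      | add x y hx hy => simp only [map_add, tmul_add, hx, hy]
      | tmul p q => simp [mulAssoc]

variable (k A) in
/-- The map `u ⊗ v ⊗ m ↦ ∑ u' ⊗ u'' v ⊗ m`. -/
def splitMul₁ (M : Type*) [AddCommGroup M] [Module k M] :
    TensorAlgebra k A ⊗[k] (TensorAlgebra k A ⊗[k] M) →ₗ[k]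
      TensorAlgebra k A ⊗[k] (TensorAlgebra k A ⊗[k] M) :=
  (TensorProduct.assoc k _ _ _).toLinearMap ∘ₗ (splitMul k A).rTensor M ∘ₗ
    (TensorProduct.assoc k _ _ _).symm.toLinearMap

theorem splitMul₁_eq {M : Type*} [AddCommGroup M] [Module k M]
    (t : TensorAlgebra k A ⊗[k] (TensorAlgebra k A ⊗[k] M)) :
    splitMul₁ k A M t = (mulAssoc k A M).lTensor _ ((bar k A).Δl _ t) := by
  suffices h : splitMul₁ k A M = (mulAssoc k A M).lTensor _ ∘ₗ (bar k A).Δl _ from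
    LinearMap.congr_fun h t
  ext1
  apply LinearMap.ext
  intro x
  apply TensorProduct.ext'
  intro y m
  simp only [AlgebraTensorModule.curry_apply, LinearMap.restrictScalars_self, curry_apply,
    splitMul₁, splitMul, DGCoalgebra.Δl, LinearMap.comp_apply, LinearEquiv.coe_coe,
    TensorProduct.assoc_symm_tmul, LinearMap.rTensor_tmul]
  generalize (bar k A).Δ x = u
  induction u using TensorProduct.induction_on with
  | zero => simp
  | add x y hx hy => simp only [map_add, add_tmul, hx, hy]
  | tmul p q => simp [mulAssoc]

end BarForms

/-! ### The homotopy `conn` and its comparison with `∇`. -/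

section Connection

variable {k A : Type*} [Field k] [NonUnitalRing A] [Module k A]
variable [IsScalarTower k A A] [SMulCommClass k A A]

theorem mul'_even : ZGrading.IsEven (bar k A).G₁ (bar k A).toZGrading
    (LinearMap.mul' k (TensorAlgebra k A)) := by
  refine ZGrading.isEven_of_deg _ _ fun n t ht => ?_
  refine ZGrading.map_mem_of_mem_tensorDeg _ _ _ _ n ?_ ht
  rintro i j v hv w hw rfl
  exact mul_mem_barDeg hv hw

theorem headMul_even : ZGrading.IsEven (bar k A).G₁ (bar k A).toZGrading (headMul k A) := by
  refine ZGrading.isEven_of_deg _ _ fun n t ht => ?_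
  refine ZGrading.map_mem_of_mem_tensorDeg _ _ _ _ n ?_ ht
  rintro i j v hv w hw rfl
  exact mul_mem_barDeg (oneLetter_mem hv) hw

theorem headDiff_even : ZGrading.IsEven (bar k A).G₁ (bar k A).toZGrading (headDiff k A) := by
  have h1 := (bar k A).d_even
  have h2 := headMul_even (k := k) (A := A)
  constructor <;> intro v
  · simp only [headDiff, LinearMap.sub_apply, map_sub, h1.ev, h2.ev]
  · simp only [headDiff, LinearMap.sub_apply, map_sub, h1.od, h2.od]
  · simp only [headDiff, LinearMap.sub_apply, map_sub, h1.ε, h2.ε]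

theorem splitMul_even : ZGrading.IsEven (bar k A).G₁ (bar k A).G₁ (splitMul k A) := by
  have h1 := (bar k A).Δl_even
  have h2 : ZGrading.IsEven (bar k A).G₂ (bar k A).G₁
      ((LinearMap.mul' k (TensorAlgebra k A)).lTensor _) :=
    ZGrading.IsEven.tensor (ZGrading.IsEven.id (bar k A).toZGrading) mul'_even
  exact ⟨fun v => (h2.ev _).trans (congrArg _ (h1.ev v)),
    fun v => (h2.od _).trans (congrArg _ (h1.od v)),
    fun v => (h2.ε _).trans (congrArg _ (h1.ε v))⟩

/-- The action of a map `C ⊗ C → C` on the first two factors of `C ⊗ C ⊗ M`. -/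
def onFirst {C : Type*} [AddCommGroup C] [Module k C] (f : C ⊗[k] C →ₗ[k] C)
    (M : Type*) [AddCommGroup M] [Module k M] : C ⊗[k] (C ⊗[k] M) →ₗ[k] C ⊗[k] M :=
  f.rTensor M ∘ₗ (TensorProduct.assoc k C C M).symm.toLinearMap

section General

variable {C : Type*} [AddCommGroup C] [Module k C] (X : DGCoalgebra k C)

/-- Two rotations carry the first pair to the end as a block, and an even map of that pair passes
through the block move without a sign. -/
theorem lTensor_rot₂_rot₂ {f : C ⊗[k] C →ₗ[k] C} (hf : ZGrading.IsEven X.G₁ X.toZGrading f)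
    (t : C ⊗[k] (C ⊗[k] C)) :
    f.lTensor C (X.rot₂ (X.rot₂ t)) = X.τ (onFirst f C t) := by
  obtain ⟨s, rfl⟩ := (TensorProduct.assoc k C C C).surjective t
  rw [DGCoalgebra.rot₂_rot₂_assoc, onFirst, LinearMap.comp_apply, LinearEquiv.coe_coe,
    LinearEquiv.symm_apply_apply]
  exact (hf.swap (ZGrading.IsEven.id X.toZGrading) s).symm

theorem τ_lTensor {f : C ⊗[k] C →ₗ[k] C} (hf : ZGrading.IsEven X.G₁ X.toZGrading f)
    (t : C ⊗[k] (C ⊗[k] C)) : X.τ (f.lTensor C t) = onFirst f C (X.rot₂ t) := by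
  rw [DGCoalgebra.rot₂, LinearMap.comp_apply, onFirst, LinearMap.comp_apply, LinearEquiv.coe_coe,
    LinearEquiv.coe_coe, LinearEquiv.symm_apply_apply]
  exact (ZGrading.IsEven.id X.toZGrading).swap hf t

theorem rot₂_lTensor_lTensor {f : C ⊗[k] C →ₗ[k] C} (hf : ZGrading.IsEven X.G₁ X.toZGrading f)
    (t : C ⊗[k] (C ⊗[k] (C ⊗[k] C))) :
    X.rot₂ ((f.lTensor C).lTensor C t) = (onFirst f C).lTensor C (X.rot₃ t) := by
  rw [DGCoalgebra.rot₂_eq, DGCoalgebra.rot₃_eq, DGCoalgebra.exch_nat,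
    ← LinearMap.lTensor_comp_apply, ← LinearMap.lTensor_comp_apply]
  congr 2
  exact LinearMap.ext (τ_lTensor X hf)

theorem onFirst_d (t : C ⊗[k] (C ⊗[k] C)) : onFirst (X.d C) C t = X.d _ t := by
  suffices h : onFirst (X.d C) C = X.d (C ⊗[k] C) from LinearMap.congr_fun h t
  ext a b c
  simp [onFirst, DGCoalgebra.d, smul_tmul']

theorem onFirst_sub (f g : C ⊗[k] C →ₗ[k] C) (M : Type*) [AddCommGroup M] [Module k M] :
    onFirst (f - g) M = onFirst f M - onFirst g M := by
  rw [onFirst, LinearMap.rTensor_sub, LinearMap.sub_comp]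
  rfl

theorem onFirst_Δl (f : C ⊗[k] C →ₗ[k] C) (M : Type*) [AddCommGroup M] [Module k M]
    (t : C ⊗[k] M) : onFirst f M (X.Δl M t) = (f ∘ₗ X.Δ).rTensor M t := by
  rw [DGCoalgebra.Δl, onFirst, LinearMap.rTensor_comp, LinearMap.comp_apply, LinearMap.comp_apply,
    LinearMap.comp_apply, LinearEquiv.coe_coe, LinearEquiv.coe_coe, LinearEquiv.symm_apply_apply]

theorem rot₃_injective : Function.Injective X.rot₃ := by
  have h : Function.Injective (X.swap X.G₂) :=
    Function.LeftInverse.injective (g := X.G₂.swap X.toZGrading) fun t => ZGrading.swap_swap t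
  have h2 : Function.Injective
      (LinearMap.lTensor C (TensorProduct.assoc k C C C).toLinearMap) :=
    (LinearEquiv.lTensor C (TensorProduct.assoc k C C C)).injective
  exact h2.comp ((TensorProduct.assoc k C (C ⊗[k] C) C).injective.comp h)

theorem d_rot₃ (t : C ⊗[k] (C ⊗[k] (C ⊗[k] C))) :
    X.d _ (X.rot₃ t) = X.rot₂ ((X.d _).lTensor C t) := by
  suffices h : X.d _ ∘ₗ X.rot₃ = X.rot₂ ∘ₗ (X.d _).lTensor C from LinearMap.congr_fun h t
  ext a b c e
  simp [DGCoalgebra.d, DGCoalgebra.rot₃, DGCoalgebra.rot₂, DGCoalgebra.G₁, DGCoalgebra.G₂,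
    ZGrading.swap_tmul, ZGrading.tensor_ε, smul_tmul']

/-- The invariance under the cyclic permutation of the elements of `Ω²C_♮`, in the form
`d b + b d = 0`. -/
theorem rot₂_of_mem {t : C ⊗[k] (C ⊗[k] C)} (ht : t ∈ X.Ω₂nat) :
    X.rot₂ t = t + X.rot₂ (X.Δl C (X.d _ t)) := by
  obtain ⟨h1, h2, h3⟩ := X.mem_Ω₂nat.1 ht
  -- With `y = d t`, applying `d` to `b t = 0` gives `t - Δl y + (1 ⊗ Δ) y - r t = 0`. As `b d t =
  -- 0`, the form `y` is a cocommutator, and the two middle terms combine to `r (Δl y)`.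
  have h4 := congrArg (X.d _) h2
  rw [map_zero] at h4
  simp only [DGCoalgebra.b₂, LinearMap.add_apply, LinearMap.sub_apply, LinearMap.comp_apply,
    map_add, map_sub, DGCoalgebra.d_Δl, DGCoalgebra.d_lTensor, d_rot₃,
    DGCoalgebra.lTensor_d_Δl] at h4
  rw [DGCoalgebra.lTensor_Δ_of_mem ⟨X.d_mem h1, LinearMap.mem_ker.2 h3⟩] at h4
  rw [sub_eq_zero] at h4
  rw [← h4]
  abel

/-- Obtained by rotating `rot₂_of_mem` twice more, since three rotations are the identity. -/
theorem rot₂_rot₂_of_mem {t : C ⊗[k] (C ⊗[k] C)} (ht : t ∈ X.Ω₂nat) :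
    X.rot₂ (X.rot₂ t) = t - X.Δl C (X.d _ t) := by
  have h := congrArg (fun s => X.rot₂ (X.rot₂ s)) (rot₂_of_mem X ht)
  simp only [map_add, DGCoalgebra.rot₂_rot₂_rot₂] at h
  rw [eq_sub_iff_add_eq, ← h]

end General

theorem splitMul_lTensor_posPart (t : TensorAlgebra k A ⊗[k] TensorAlgebra k A) :
    splitMul k A ((posPart k A).lTensor _ t)
      = splitMul k A t - (bar k A).Δ ((bar k A).d _ ((bar k A).τ t)) := by
  rw [lTensor_posPart, map_sub, splitMul_tmul_one]

theorem headMul_lTensor_Δ (t : TensorAlgebra k A ⊗[k] TensorAlgebra k A) :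
    (headMul k A).lTensor _ ((bar k A).Δ.lTensor _ t) = (posPart k A).lTensor _ t := by
  rw [← LinearMap.lTensor_comp_apply]
  have : headMul k A ∘ₗ (bar k A).Δ = posPart k A := LinearMap.ext headMul_Δ
  rw [this]

/-- A letter put in front of a word adds one cut, namely the one before the letter. -/
theorem Δ_headMul (t : TensorAlgebra k A ⊗[k] TensorAlgebra k A) :
    (bar k A).Δ (headMul k A t) = 1 ⊗ₜ headMul k A t
      + onFirst (headMul k A) _ ((bar k A).Δ.lTensor _ t) := by
  induction t using TensorProduct.induction_on with
  | zero => simp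
  | add x y hx hy => simp only [map_add, tmul_add, hx, hy]; abel
  | tmul x y =>
    refine (deconc_cons (TensorAlgebra.ιInv x) y).trans ?_
    congr 1
    have h : (bar k A).Δ.lTensor _ (x ⊗ₜ y) = x ⊗ₜ[k] deconc k A y := rfl
    rw [h]
    generalize deconc k A y = u
    induction u using TensorProduct.induction_on with
    | zero => simp
    | add x y hx hy => simp only [map_add, tmul_add, hx, hy]
    | tmul p q => simp [onFirst, oneLetter]

theorem τ_one_tmul (x : TensorAlgebra k A) : (bar k A).τ (1 ⊗ₜ x) = x ⊗ₜ 1 := by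
  have h1 : (bar k A).ev 1 = 1 := by
    have h : (1 : TensorAlgebra k A) ∈ (bar k A).deg 0 := one_mem_barDeg
    rw [ZGrading.ev, ZGrading.weight_of_mem _ _ h]
    simp
  have h2 : (bar k A).od 1 = 0 := by
    have h : (1 : TensorAlgebra k A) ∈ (bar k A).deg 0 := one_mem_barDeg
    rw [ZGrading.od, ZGrading.weight_of_mem _ _ h]
    simp
  rw [DGCoalgebra.τ, ZGrading.swap_tmul, h1, h2, tmul_zero, add_zero]

variable (k A) in
/-- The connection given by `- Q (1 ⊗ (d - P))` up to a cyclic permutation, where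
`Q (u ⊗ v) = ∑ u' ⊗ u'' v` and `P (u ⊗ v) = π(u) v`. -/
def conn : TensorAlgebra k A ⊗[k] (TensorAlgebra k A ⊗[k] TensorAlgebra k A) →ₗ[k]
    TensorAlgebra k A ⊗[k] TensorAlgebra k A :=
  - (splitMul k A ∘ₗ (headDiff k A).lTensor _ ∘ₗ (bar k A).rot₂ ∘ₗ (bar k A).rot₂)

theorem conn_apply (t : TensorAlgebra k A ⊗[k] (TensorAlgebra k A ⊗[k] TensorAlgebra k A)) :
    conn k A t = - splitMul k A ((headDiff k A).lTensor _ ((bar k A).rot₂ ((bar k A).rot₂ t))) :=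
  rfl

theorem headDiff_lTensor (t : TensorAlgebra k A ⊗[k] (TensorAlgebra k A ⊗[k] TensorAlgebra k A)) :
    (headDiff k A).lTensor _ t
      = ((bar k A).d _).lTensor _ t - (headMul k A).lTensor _ t := by
  rw [headDiff, LinearMap.lTensor_sub, LinearMap.sub_apply]

/-- After two rotations `b t` consists of `(1 ⊗ Δ) τ t`, minus the twice rotated `(1 ⊗ Δ) t`, plus
`Δl t`. Under `Q (1 ⊗ (d - P))` the last gives `t` by the left-inverse property, and the first gives
`Δ d t`, because `(d - P) Δ` is the projection onto the empty word. The middle one, before its sign,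
gives `Q τ Δ (d - P) t + Δ P t`; here `Δ_headMul` produces the extra summand `1 ⊗ P t`. -/
theorem conn_b₁ (t : TensorAlgebra k A ⊗[k] TensorAlgebra k A) :
    conn k A ((bar k A).b₁ t) = cyc k A (headDiff k A t) - t := by
  have h1 : (bar k A).rot₂ ((bar k A).rot₂ ((bar k A).b₁ t))
      = (bar k A).Δ.lTensor _ ((bar k A).τ t)
        - (bar k A).rot₂ ((bar k A).rot₂ ((bar k A).Δ.lTensor _ t)) + (bar k A).Δl _ t := by
    simp only [DGCoalgebra.b₁, LinearMap.add_apply, LinearMap.sub_apply, LinearMap.comp_apply,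
      map_add, map_sub]
    rw [DGCoalgebra.rot₂_rot₂_rot₂, DGCoalgebra.rot₂_rot₂]
  have h2 : ((bar k A).d _).lTensor _ ((bar k A).Δ.lTensor _ ((bar k A).τ t)) = (bar k A).τ t :=
    DGCoalgebra.lTensor_d_Δ _
  have h3 : onFirst (headMul k A) _ ((bar k A).Δ.lTensor _ t)
      = (bar k A).Δ (headMul k A t) - 1 ⊗ₜ headMul k A t := by rw [Δ_headMul]; abel
  rw [conn_apply, h1]
  simp only [map_add, map_sub, headDiff_lTensor, headMul_lTensor_Δ, h2, splitMul_headMul_Δl,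
    splitMul_lTensor_posPart, DGCoalgebra.τ_τ, lTensor_rot₂_rot₂ _ (bar k A).d_even,
    lTensor_rot₂_rot₂ _ headMul_even, DGCoalgebra.lTensor_d_Δl, onFirst_d, DGCoalgebra.d_lTensor,
    h3, τ_one_tmul, splitMul_tmul_one]
  simp only [cyc, headDiff, LinearMap.sub_apply, LinearMap.comp_apply, map_sub]
  abel

theorem Δl_splitMul (t : TensorAlgebra k A ⊗[k] TensorAlgebra k A) :
    (bar k A).Δl _ (splitMul k A t) = (splitMul k A).lTensor _ ((bar k A).Δl _ t) := by
  rw [splitMul, LinearMap.comp_apply, DGCoalgebra.Δl_nat, DGCoalgebra.Δl_Δl,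
    ← LinearMap.lTensor_comp_apply]

theorem lTensor_Δ_splitMul (t : TensorAlgebra k A ⊗[k] TensorAlgebra k A) :
    (bar k A).Δ.lTensor _ (splitMul k A t) = (splitMul k A).lTensor _ ((bar k A).Δl _ t)
      + splitMul₁ k A _ ((bar k A).Δ.lTensor _ t) - (bar k A).Δl _ t := by
  have h : (bar k A).Δ ∘ₗ LinearMap.mul' k (TensorAlgebra k A) = splitMul k A
      + mulAssoc k A _ ∘ₗ (bar k A).Δ.lTensor _ - LinearMap.id := LinearMap.ext Δ_mul'
  rw [splitMul₁_eq, DGCoalgebra.Δl_nat, ← LinearMap.lTensor_comp_apply]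
  conv_lhs => rw [splitMul, LinearMap.comp_apply, ← LinearMap.lTensor_comp_apply, h]
  rw [LinearMap.lTensor_sub, LinearMap.lTensor_add, LinearMap.sub_apply, LinearMap.add_apply,
    LinearMap.lTensor_id, LinearMap.id_apply]

theorem rot₂_lTensor_splitMul
    (t : TensorAlgebra k A ⊗[k] (TensorAlgebra k A ⊗[k] TensorAlgebra k A)) :
    (bar k A).rot₂ ((splitMul k A).lTensor _ t) = splitMul₁ k A _ ((bar k A).rot₂ t) := by
  rw [DGCoalgebra.rot₂, LinearMap.comp_apply, LinearMap.comp_apply, splitMul₁,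
    LinearMap.comp_apply, LinearMap.comp_apply, LinearEquiv.coe_coe, LinearEquiv.coe_coe,
    LinearEquiv.symm_apply_apply]
  congr 1
  exact (ZGrading.IsEven.id (bar k A).toZGrading).swap splitMul_even t

/-- The term `(1 ⊗ Q) Δl t` arises from `Δ ⊗ 1` and again, by the cut formula for a product, from `1
⊗ Δ`; the two cancel in `b`. -/
theorem b₁_splitMul (t : TensorAlgebra k A ⊗[k] TensorAlgebra k A) :
    (bar k A).b₁ (splitMul k A t) = (bar k A).Δl _ t
      - splitMul₁ k A _ ((bar k A).Δ.lTensor _ t)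
      + splitMul₁ k A _ ((bar k A).rot₂ ((bar k A).Δl _ t)) := by
  simp only [DGCoalgebra.b₁, LinearMap.add_apply, LinearMap.sub_apply, LinearMap.comp_apply,
    Δl_splitMul, lTensor_Δ_splitMul, rot₂_lTensor_splitMul]
  abel

theorem splitMul₁_one_tmul {M : Type*} [AddCommGroup M] [Module k M]
    (t : TensorAlgebra k A ⊗[k] M) :
    splitMul₁ k A M ((TensorProduct.mk k (TensorAlgebra k A) M 1).lTensor _ t)
      = (bar k A).Δl M t := by
  induction t using TensorProduct.induction_on with
  | zero => simp
  | add x y hx hy => simp only [map_add, hx, hy]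
  | tmul x m => simp [splitMul₁, splitMul_tmul_one, DGCoalgebra.Δl]

/-- The left-inverse property of `Q (1 ⊗ (d - P))`, carried along with a spectator factor `M`. -/
theorem splitMul₁_onFirst_Δl {M : Type*} [AddCommGroup M] [Module k M]
    (t : TensorAlgebra k A ⊗[k] (TensorAlgebra k A ⊗[k] M)) :
    splitMul₁ k A M ((onFirst (headDiff k A) M).lTensor _ ((bar k A).Δl _ t)) = t := by
  have h : ∀ s, splitMul k A ((headDiff k A).lTensor _ ((bar k A).Δl _ s)) = s := by
    intro s
    rw [headDiff_lTensor, map_sub, splitMul_headMul_Δl, DGCoalgebra.lTensor_d_Δl, sub_sub_cancel]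
  obtain ⟨s, rfl⟩ := (TensorProduct.assoc k _ _ _).surjective t
  have h2 : (onFirst (headDiff k A) M).lTensor _ ((bar k A).Δl _ (TensorProduct.assoc k _ _ _ s))
      = TensorProduct.assoc k _ _ _
        (((headDiff k A).lTensor _ ∘ₗ (bar k A).Δl _).rTensor M s) := by
    induction s using TensorProduct.induction_on with
    | zero => simp
    | add x y hx hy => simp only [map_add, hx, hy]
    | tmul p m =>
      induction p using TensorProduct.induction_on with
      | zero => simp
      | add x y hx hy => simp only [map_add, add_tmul, hx, hy]
      | tmul x y =>
        simp only [DGCoalgebra.Δl, LinearMap.comp_apply, TensorProduct.assoc_tmul,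
          LinearMap.rTensor_tmul, LinearEquiv.coe_coe]
        generalize (bar k A).Δ x = u
        induction u using TensorProduct.induction_on with
        | zero => simp
        | add x y hx hy => simp only [map_add, add_tmul, hx, hy]
        | tmul a b => simp [onFirst]
  rw [h2, splitMul₁, LinearMap.comp_apply, LinearMap.comp_apply, LinearEquiv.coe_coe,
    LinearEquiv.coe_coe, LinearEquiv.symm_apply_apply, ← LinearMap.rTensor_comp_apply]
  have h3 : splitMul k A ∘ₗ (headDiff k A).lTensor _ ∘ₗ (bar k A).Δl _ = LinearMap.id :=
    LinearMap.ext h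
  rw [h3, LinearMap.rTensor_id, LinearMap.id_apply]

/-- The rotated form of the equation `b ω = 0` for a form of degree two. -/
theorem b₂_rot₂_eq_zero {C : Type*} [AddCommGroup C] [Module k C] (X : DGCoalgebra k C)
    {s : C ⊗[k] (C ⊗[k] C)} (hs : X.b₂ (X.rot₂ s) = 0) :
    (X.Δl C).lTensor C s - (X.Δ.lTensor C).lTensor C s + X.rot₃ (X.Δl _ s)
      - X.Δl _ (X.rot₂ s) = 0 := by
  apply rot₃_injective X
  rw [map_zero, ← hs]
  simp only [map_add, map_sub, DGCoalgebra.rot₃_lTensor_Δl, DGCoalgebra.rot₃_lTensor_Δ,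
    DGCoalgebra.rot₃_rot₃, DGCoalgebra.b₂, LinearMap.add_apply, LinearMap.sub_apply,
    LinearMap.comp_apply]

theorem b₁_conn {t : TensorAlgebra k A ⊗[k] (TensorAlgebra k A ⊗[k] TensorAlgebra k A)}
    (ht : (bar k A).b₂ t = 0) : (bar k A).b₁ (conn k A t) = - t := by
  -- With `t = r s`, the two rotations in `conn` complete a full turn, so `conn t = - Q (1 ⊗ (d -
  -- P)) s`.
  obtain ⟨s, rfl⟩ : ∃ s, (bar k A).rot₂ s = t :=
    ⟨_, DGCoalgebra.rot₂_rot₂_rot₂ _ t⟩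
  -- Apply `Q` with a spectator, after `d - P` on the second and third factors, to the rotated
  -- equation `b t = 0`. By the left-inverse property its last term becomes `r s = t`.
  have h0 := congrArg (fun u => splitMul₁ k A _ ((onFirst (headDiff k A) _).lTensor _ u))
    (b₂_rot₂_eq_zero _ ht)
  simp only [map_add, map_sub, map_zero, splitMul₁_onFirst_Δl] at h0
  have e1 : onFirst (headDiff k A) _ ∘ₗ (bar k A).Δl (TensorAlgebra k A)
      = TensorProduct.mk k _ _ 1 ∘ₗ (bar k A).d _ := by
    apply TensorProduct.ext'
    intro x y
    rw [LinearMap.comp_apply, onFirst_Δl, LinearMap.rTensor_tmul, LinearMap.comp_apply, headDiff_Δ,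
      smul_tmul]
    rfl
  have e2 : (bar k A).Δ ∘ₗ headDiff k A = onFirst (headDiff k A) _ ∘ₗ (bar k A).Δ.lTensor _
      - TensorProduct.mk k _ _ 1 ∘ₗ headMul k A := by
    apply LinearMap.ext
    intro u
    simp only [LinearMap.comp_apply, LinearMap.sub_apply, headDiff, onFirst_sub, map_sub,
      Δ_headMul, onFirst_d, DGCoalgebra.d_lTensor, TensorProduct.mk_apply]
    abel
  -- The identities `t1`, `t2`, `t3` match the other three terms with those of `b (Q (1 ⊗ (d - P))
  -- s)` given by `b₁_splitMul`.
  have t1 : splitMul₁ k A _ ((onFirst (headDiff k A) _).lTensor _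
      (((bar k A).Δl _).lTensor _ s)) = (bar k A).Δl _ (((bar k A).d _).lTensor _ s) := by
    rw [← LinearMap.lTensor_comp_apply, e1, LinearMap.lTensor_comp_apply, splitMul₁_one_tmul]
  have t2 : splitMul₁ k A _ ((bar k A).Δ.lTensor _ ((headDiff k A).lTensor _ s))
      = splitMul₁ k A _ ((onFirst (headDiff k A) _).lTensor _
        (((bar k A).Δ.lTensor _).lTensor _ s))
        - (bar k A).Δl _ ((headMul k A).lTensor _ s) := by
    rw [← LinearMap.lTensor_comp_apply, e2, LinearMap.lTensor_sub, LinearMap.sub_apply,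
      LinearMap.lTensor_comp_apply, LinearMap.lTensor_comp_apply, map_sub, splitMul₁_one_tmul]
  have t3 : (bar k A).rot₂ ((bar k A).Δl _ ((headDiff k A).lTensor _ s))
      = (onFirst (headDiff k A) _).lTensor _ ((bar k A).rot₃ ((bar k A).Δl _ s)) := by
    rw [DGCoalgebra.Δl_nat, rot₂_lTensor_lTensor _ headDiff_even]
  rw [conn_apply, DGCoalgebra.rot₂_rot₂_rot₂, map_neg, b₁_splitMul, t2, t3, headDiff_lTensor,
    map_sub, ← t1]
  rw [← sub_eq_zero, ← neg_eq_zero, ← h0]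
  abel

/-- Apply `Q (1 ⊗ P) r` to `b y = 0`. The two terms with `Q τ y` cancel, and `Δ d y = y + τ y`
leaves `y`. -/
theorem splitMul_headMul_rot₂ {y : TensorAlgebra k A ⊗[k] TensorAlgebra k A}
    (hy : y ∈ (bar k A).Ω₁nat) :
    splitMul k A ((headMul k A).lTensor _ ((bar k A).rot₂ ((bar k A).Δl _ y))) = y := by
  have h := congrArg (fun u => splitMul k A ((headMul k A).lTensor _ ((bar k A).rot₂ u)))
    (LinearMap.mem_ker.1 hy.2)
  simp only [DGCoalgebra.b₁, LinearMap.add_apply, LinearMap.sub_apply, LinearMap.comp_apply,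
    map_add, map_sub, map_zero, DGCoalgebra.rot₂_lTensor, DGCoalgebra.rot₂_rot₂,
    splitMul_headMul_Δl, headMul_lTensor_Δ, splitMul_lTensor_posPart, DGCoalgebra.τ_τ,
    DGCoalgebra.Δ_d_of_mem hy] at h
  rw [← sub_eq_zero, ← h]
  abel

/-- With `y = d t`, substituting `r t = t + r (Δl y)` and `r² t = t - Δl y` turns both sides into `Q
(1 ⊗ P) t + y`; the contribution of `1 ⊗ d` vanishes on `Ω²`. -/
theorem nabla_eq_conn {t : TensorAlgebra k A ⊗[k] (TensorAlgebra k A ⊗[k] TensorAlgebra k A)}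
    (ht : t ∈ (bar k A).Ω₂nat) : nabla k A t = conn k A t := by
  obtain ⟨h1, h2, h3⟩ := (bar k A).mem_Ω₂nat.1 ht
  have hy : (bar k A).d _ t ∈ (bar k A).Ω₁nat := ⟨(bar k A).d_mem h1, LinearMap.mem_ker.2 h3⟩
  rw [nabla_eq, conn_apply, rot₂_rot₂_of_mem _ ht, rot₂_of_mem _ ht]
  simp only [map_add, map_sub, headDiff_lTensor, splitMul_headMul_rot₂ hy, splitMul_headMul_Δl,
    DGCoalgebra.lTensor_d_Δl, ((bar k A).mem_Ω₂.1 h1).1, map_zero]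
  abel

end Connection

/-! ### Homotopy relations between `∇`, `θ`, `b`, `d` and `δ`. -/

section Projection

variable {k A : Type*} [Field k] [NonUnitalRing A] [Module k A]
variable [IsScalarTower k A A] [SMulCommClass k A A]

/-- The projection onto the empty word is multiplicative, so `(1 ⊗ η) Q = 1 ⊗ η`. -/
theorem splitMul_lTensor_mem {M : Type*} [AddCommGroup M] [Module k M] {f : M →ₗ[k] TensorAlgebra k A}
    (hf : ∀ m, emptyWord k A (f m) = 0) (t : TensorAlgebra k A ⊗[k] M) :
    splitMul k A (f.lTensor _ t) ∈ (bar k A).Ω₁ := by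
  have h1 : emptyWord k A ∘ₗ LinearMap.mul' k (TensorAlgebra k A)
      = emptyWord k A ∘ₗ (bar k A).d _ := by
    apply TensorProduct.ext'
    intro x y
    simp [emptyWord, DGCoalgebra.d, bar]
  have h2 : emptyWord k A ∘ₗ f = 0 := LinearMap.ext hf
  rw [DGCoalgebra.Ω₁, LinearMap.mem_ker]
  change (emptyWord k A).lTensor _ _ = 0
  rw [splitMul, LinearMap.comp_apply, ← LinearMap.lTensor_comp_apply, h1,
    LinearMap.lTensor_comp_apply, DGCoalgebra.lTensor_d_Δl, ← LinearMap.lTensor_comp_apply, h2,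
    LinearMap.lTensor_zero, LinearMap.zero_apply]

theorem cyc_mem (x : TensorAlgebra k A) : cyc k A x ∈ (bar k A).Ω₁ := by
  have h := splitMul_lTensor_posPart ((bar k A).τ ((bar k A).Δ x))
  rw [DGCoalgebra.τ_τ, DGCoalgebra.d_Δ] at h
  have h1 := splitMul_lTensor_mem emptyWord_posPart ((bar k A).τ ((bar k A).Δ x))
  rwa [h] at h1

theorem nabla_mem (t : TensorAlgebra k A ⊗[k] (TensorAlgebra k A ⊗[k] TensorAlgebra k A)) :
    nabla k A t ∈ (bar k A).Ω₁ := by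
  rw [nabla_eq]
  exact splitMul_lTensor_mem emptyWord_headMul _

theorem θ_eq_add_conn {t : TensorAlgebra k A ⊗[k] TensorAlgebra k A} (ht : t ∈ (bar k A).Ω₁) :
    θ k A t = t + conn k A ((bar k A).b₁ t) := by
  rw [θ_eq ht, conn_b₁, add_sub_cancel]

/-- From `θ = 1 + conn b` and `b conn = -1` on boundaries, `b θ = b - b = 0`. -/
theorem θ_mem {t : TensorAlgebra k A ⊗[k] TensorAlgebra k A} (ht : t ∈ (bar k A).Ω₁) :
    θ k A t ∈ (bar k A).Ω₁nat := by
  refine ⟨θ_eq ht ▸ cyc_mem _, LinearMap.mem_ker.2 ?_⟩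
  rw [θ_eq_add_conn ht, map_add, b₁_conn ((bar k A).b₂_b₁ t), add_neg_cancel]

theorem θ_of_mem {t : TensorAlgebra k A ⊗[k] TensorAlgebra k A} (ht : t ∈ (bar k A).Ω₁nat) :
    θ k A t = t := by
  rw [θ_eq_add_conn ht.1, LinearMap.mem_ker.1 ht.2, map_zero, add_zero]

theorem b₁_nabla {t : TensorAlgebra k A ⊗[k] (TensorAlgebra k A ⊗[k] TensorAlgebra k A)}
    (ht : t ∈ (bar k A).Ω₂nat) : (bar k A).b₁ (nabla k A t) = - t := by
  rw [nabla_eq_conn ht, b₁_conn ((bar k A).mem_Ω₂nat.1 ht).2.1]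

theorem nabla_b₁ [NeZero (2 : k)] {t : TensorAlgebra k A ⊗[k] TensorAlgebra k A}
    (ht : t ∈ (bar k A).Ω₁dot) : nabla k A ((bar k A).b₁ t) = θ k A t - t := by
  rw [nabla_eq_conn ((bar k A).b₁_mem_Ω₂nat ht), θ_eq_add_conn ht.1, add_sub_cancel_left]

/-- Write `δ t = - δ b ∇ t = - b δ ∇ t` and use `conn b = θ - 1`. The failure of `∇` to commute with
`δ` is what the term `- δ ∇ ω₂` in `R` corrects. -/
theorem nabla_δ₂ {t : TensorAlgebra k A ⊗[k] (TensorAlgebra k A ⊗[k] TensorAlgebra k A)}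
    (ht : t ∈ (bar k A).Ω₂nat) : nabla k A ((bar k A).δ₂ t)
      = (bar k A).δ₁ (nabla k A t) - θ k A ((bar k A).δ₁ (nabla k A t)) := by
  rw [θ_eq_add_conn ((bar k A).δ_mem_Ω₁ (nabla_mem t)), ← DGCoalgebra.δ₂_b₁, b₁_nabla ht, map_neg,
    map_neg, nabla_eq_conn ((bar k A).δ_mem_Ω₂nat ht)]
  abel

/-- Both `d Q` and `P Q` start from concatenation, but `P Q` loses the terms whose first factor is
empty. -/
theorem headDiff_splitMul (t : TensorAlgebra k A ⊗[k] TensorAlgebra k A) :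
    headDiff k A (splitMul k A t) = (bar k A).d _ t := by
  have h : headMul k A ∘ₗ splitMul k A
      = LinearMap.mul' k (TensorAlgebra k A) - (bar k A).d _ := by
    apply TensorProduct.ext'
    intro x y
    have h1 : splitMul k A (x ⊗ₜ y) = (LinearMap.mulRight k y).lTensor _ ((bar k A).Δ x) := by
      have h : splitMul k A (x ⊗ₜ y) = (LinearMap.mul' k (TensorAlgebra k A)).lTensor _
        (TensorProduct.assoc k _ _ _ (deconc k A x ⊗ₜ y)) := rfl
      rw [h]
      change _ = (LinearMap.mulRight k y).lTensor _ (deconc k A x)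
      generalize deconc k A x = u
      induction u using TensorProduct.induction_on with
      | zero => simp
      | add x y hx hy => simp only [map_add, add_tmul, hx, hy]
      | tmul p q => simp
    have h2 : ∀ u, headMul k A ((LinearMap.mulRight k y).lTensor _ u) = headMul k A u * y := by
      intro u
      induction u using TensorProduct.induction_on with
      | zero => simp
      | add x y hx hy => simp only [map_add, add_mul, hx, hy]
      | tmul p q => simp [mul_assoc]
    rw [LinearMap.comp_apply, h1, h2, headMul_Δ]
    simp [posPart_apply, sub_mul, DGCoalgebra.d, bar]
  have h3 := LinearMap.congr_fun h t
  rw [LinearMap.comp_apply] at h3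
  rw [headDiff, LinearMap.sub_apply, h3, splitMul, LinearMap.comp_apply, DGCoalgebra.d_lTensor,
    DGCoalgebra.d_Δl, LinearMap.sub_apply, sub_sub_cancel]

theorem headDiff_nabla {t : TensorAlgebra k A ⊗[k] (TensorAlgebra k A ⊗[k] TensorAlgebra k A)}
    (ht : t ∈ (bar k A).Ω₂nat) : headDiff k A (nabla k A t) = 0 := by
  rw [nabla_eq_conn ht, conn_apply, map_neg, headDiff_splitMul, DGCoalgebra.d_lTensor,
    DGCoalgebra.d_rot₂, DGCoalgebra.lTensor_d_rot₂,
    ((bar k A).mem_Ω₂.1 ((bar k A).mem_Ω₂nat.1 ht).1).2, map_zero, map_zero, map_zero, neg_zero]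

theorem headDiff_b₀ {x : TensorAlgebra k A} (hx : emptyWord k A x = 0) :
    headDiff k A ((bar k A).b₀ x) = headMul k A ((bar k A).τ ((bar k A).Δ x)) - x := by
  have h : (bar k A).d _ ((bar k A).τ ((bar k A).Δ x)) = x := by
    rw [DGCoalgebra.d_τ, (bar k A).counit_right]
  rw [DGCoalgebra.b₀, LinearMap.sub_apply, LinearMap.comp_apply, map_sub, headDiff_Δ, hx,
    headDiff, LinearMap.sub_apply, h, zero_smul, zero_sub, neg_sub]

/-- A cocommutator form is thus determined by its image under `d - P`, so equations in `Ω¹BA_♮` may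
be checked in `BA`. -/
theorem eq_cyc_of_mem {t : TensorAlgebra k A ⊗[k] TensorAlgebra k A} (ht : t ∈ (bar k A).Ω₁nat) :
    t = cyc k A (headDiff k A t) := by
  rw [← θ_eq ht.1, θ_of_mem ht]

/-- On `Ω²BA_♮` one has `b d ∇ = 2 d`. -/
theorem b₀_d_nabla {t : TensorAlgebra k A ⊗[k] (TensorAlgebra k A ⊗[k] TensorAlgebra k A)}
    (ht : t ∈ (bar k A).Ω₂nat) :
    (bar k A).b₀ ((bar k A).d _ (nabla k A t)) = (2 : k) • (bar k A).d _ t := by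
  obtain ⟨h1, h2, h3⟩ := (bar k A).mem_Ω₂nat.1 ht
  have hy : (bar k A).d _ t ∈ (bar k A).Ω₁nat := ⟨(bar k A).d_mem h1, LinearMap.mem_ker.2 h3⟩
  have hw : emptyWord k A ((bar k A).d _ (nabla k A t)) = 0 := emptyWord_d_of_mem (nabla_mem t)
  have hP : headMul k A (nabla k A t) = (bar k A).d _ (nabla k A t) := by
    have h := headDiff_nabla ht
    rw [headDiff, LinearMap.sub_apply, sub_eq_zero] at h
    exact h.symm
  -- With `v = ∇ t` and `w = d v = P v`, the relation `b v = - t` gives `d t = - (v - Δ w + τ v)`.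
  have hb := (bar k A).d_b₁ (nabla k A t)
  rw [b₁_nabla ht, map_neg, neg_eq_iff_eq_neg] at hb
  -- Since `d d t = 0`, the identity `Δ d y = y + τ y` for `y = d t` makes `y` anti-invariant. The
  -- image of `y` under `d - P` can then be computed both from `y` and from `- τ y` (`e1` and `e2`);
  -- the sum of the two values is the image of `b w`.
  have hτ : (bar k A).τ ((bar k A).d _ t) = - (bar k A).d _ t := by
    have h := DGCoalgebra.Δ_d_of_mem hy
    rw [(bar k A).d_d h1, map_zero] at h
    exact (neg_eq_of_add_eq_zero_right h.symm).symm
  have hd : headDiff k A ((bar k A).d _ t) = - headMul k A ((bar k A).d _ t) := by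
    rw [headDiff, LinearMap.sub_apply, (bar k A).d_d h1, zero_sub]
  have e1 : headDiff k A ((bar k A).d _ t) = headMul k A ((bar k A).τ (nabla k A t)) := by
    rw [hd, hb]
    simp only [map_neg, map_add, map_sub, headMul_Δ, posPart_apply, hw, zero_smul, hP]
    abel
  have e2 : headDiff k A ((bar k A).d _ t)
      = headMul k A ((bar k A).τ ((bar k A).Δ ((bar k A).d _ (nabla k A t))))
        - (bar k A).d _ (nabla k A t) - headMul k A ((bar k A).τ (nabla k A t)) := by
    rw [hd, ← map_neg, ← hτ, hb]
    simp only [map_neg, map_add, map_sub, DGCoalgebra.τ_τ, hP]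
    abel
  have e3 : headDiff k A ((bar k A).b₀ ((bar k A).d _ (nabla k A t)))
      = headDiff k A ((2 : k) • (bar k A).d _ t) := by
    rw [headDiff_b₀ hw, map_smul, two_smul]
    nth_rewrite 1 [e2]
    rw [e1]
    abel
  rw [eq_cyc_of_mem ((bar k A).b₀_mem_Ω₁nat ((bar k A).d _ (nabla k A t))), e3,
    ← eq_cyc_of_mem (Submodule.smul_mem _ _ hy)]

theorem ε₁_splitMul (t : TensorAlgebra k A ⊗[k] TensorAlgebra k A) :
    (bar k A).ε₁ (splitMul k A t) = splitMul k A ((bar k A).ε₁ t) := by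
  have h := splitMul_even.ε t
  rwa [DGCoalgebra.G₁_ε] at h

theorem ε₁_nabla (t : TensorAlgebra k A ⊗[k] (TensorAlgebra k A ⊗[k] TensorAlgebra k A)) :
    (bar k A).ε₁ (nabla k A t) = nabla k A ((bar k A).ε₂ t) := by
  rw [nabla_eq, nabla_eq, ε₁_splitMul, ← DGCoalgebra.ε₂_rot₂]
  congr 1
  refine DGCoalgebra.map_ε_lTensor (bar k A) (fun m => ?_) _
  have h := headMul_even.ε m
  rw [DGCoalgebra.G₁_ε] at h
  exact h

theorem ε₁_cyc (x : TensorAlgebra k A) :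
    (bar k A).ε₁ (cyc k A x) = cyc k A ((bar k A).ε x) := by
  have h1 := (bar k A).Δ_even.ε x
  have h2 := (DGCoalgebra.τ_even (X := bar k A)).ε ((bar k A).Δ x)
  change (bar k A).G₁.ε _ = _ at h1
  rw [DGCoalgebra.G₁_ε] at h1 h2
  simp only [cyc, LinearMap.sub_apply, LinearMap.comp_apply, map_sub, ε₁_splitMul, h1, h2]

theorem ε₁_θ {t : TensorAlgebra k A ⊗[k] TensorAlgebra k A} (ht : t ∈ (bar k A).Ω₁) :
    (bar k A).ε₁ (θ k A t) = θ k A ((bar k A).ε₁ t) := by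
  have h := headDiff_even.ε t
  rw [DGCoalgebra.G₁_ε] at h
  rw [θ_eq ht, θ_eq ((bar k A).ε_mem_Ω₁ ht), ε₁_cyc, h]

end Projection

/-! ### The retraction `R`. -/

section Retract

variable (k A : Type*) [Field k] [NonUnitalRing A] [Module k A]
variable [IsScalarTower k A A] [SMulCommClass k A A]

/-- The linear map underlying the retraction `R`. -/
def retractLin : TensorAlgebra k A × (bar k A).Ω₂nat × (bar k A).Ω₁dot →ₗ[k]
    TensorAlgebra k A × (bar k A).Ω₁nat :=
  let p₂ := LinearMap.fst k (bar k A).Ω₂nat (bar k A).Ω₁dot ∘ₗ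
    LinearMap.snd k (TensorAlgebra k A) ((bar k A).Ω₂nat × (bar k A).Ω₁dot)
  let p₁ := LinearMap.snd k (bar k A).Ω₂nat (bar k A).Ω₁dot ∘ₗ
    LinearMap.snd k (TensorAlgebra k A) ((bar k A).Ω₂nat × (bar k A).Ω₁dot)
  LinearMap.prod
    (LinearMap.fst k _ _ + (bar k A).d _ ∘ₗ nabla k A ∘ₗ (bar k A).Ω₂nat.subtype ∘ₗ p₂)
    (LinearMap.codRestrict (bar k A).Ω₁nat
      (θ k A ∘ₗ ((bar k A).Ω₁dot.subtype ∘ₗ p₁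
        - (bar k A).δ₁ ∘ₗ nabla k A ∘ₗ (bar k A).Ω₂nat.subtype ∘ₗ p₂))
      fun w => θ_mem (Submodule.sub_mem _ w.2.2.2.1 ((bar k A).δ_mem_Ω₁ (nabla_mem _))))

variable {k A}

theorem retractLin_fst (w : TensorAlgebra k A × (bar k A).Ω₂nat × (bar k A).Ω₁dot) :
    (retractLin k A w).1 = w.1 + (bar k A).d _ (nabla k A w.2.1) := rfl

theorem retractLin_snd (w : TensorAlgebra k A × (bar k A).Ω₂nat × (bar k A).Ω₁dot) :
    ((retractLin k A w).2 : TensorAlgebra k A ⊗[k] TensorAlgebra k A)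
      = θ k A (w.2.2 - (bar k A).δ₁ (nabla k A w.2.1)) := rfl

variable [NeZero (2 : k)]

theorem retractLin_γ (w : TensorAlgebra k A × (bar k A).Ω₂nat × (bar k A).Ω₁dot) :
    retractLin k A ((bar k A).Xhat2.γ w) = (bar k A).Xhat.γ (retractLin k A w) := by
  have hm : (w.2.2 : TensorAlgebra k A ⊗[k] TensorAlgebra k A)
      - (bar k A).δ₁ (nabla k A w.2.1) ∈ (bar k A).Ω₁ :=
    Submodule.sub_mem _ w.2.2.2.1 ((bar k A).δ_mem_Ω₁ (nabla_mem _))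
  refine Prod.ext ?_ (Subtype.ext ?_)
  · rw [DGCoalgebra.Xhat_γ_fst, retractLin_fst, retractLin_fst, DGCoalgebra.Xhat2_γ_fst,
      DGCoalgebra.Xhat2_γ_snd_fst, ← ε₁_nabla, DGCoalgebra.d_ε₁, map_add]
  · rw [DGCoalgebra.Xhat_γ_snd, retractLin_snd, retractLin_snd, DGCoalgebra.Xhat2_γ_snd_fst,
      DGCoalgebra.Xhat2_γ_snd_snd, ε₁_θ hm, ← ε₁_nabla, DGCoalgebra.δ₁_ε₁,
      map_sub (bar k A).ε₁, ← map_neg (θ k A)]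
    congr 1
    abel

theorem retractLin_diff (w : TensorAlgebra k A × (bar k A).Ω₂nat × (bar k A).Ω₁dot) :
    retractLin k A ((bar k A).Xhat2.diff w) = (bar k A).Xhat.diff (retractLin k A w) := by
  -- The value of `∇` on the two-form part of `∂ w` is `δ ∇ ω₂ + θ(ω₁ - δ ∇ ω₂) - ω₁`, which governs
  -- both components of `R ∂ w`.
  have hN : nabla k A ((bar k A).δ₂ w.2.1 + (bar k A).b₁ w.2.2)
      = (bar k A).δ₁ (nabla k A w.2.1)
        + θ k A (w.2.2 - (bar k A).δ₁ (nabla k A w.2.1)) - w.2.2 := by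
    rw [map_add, nabla_δ₂ w.2.1.2, nabla_b₁ w.2.2.2, map_sub]
    abel
  have hm := θ_mem (Submodule.sub_mem _ w.2.2.2.1
    ((bar k A).δ_mem_Ω₁ (nabla_mem (k := k) (A := A) w.2.1)))
  have hd : ∀ t, (bar k A).d _ ((bar k A).δ₁ t) = (bar k A).δ ((bar k A).d _ t) :=
    fun t => (bar k A).d_tensorδ (bar k A).δ t
  refine Prod.ext ?_ (Subtype.ext ?_)
  · rw [DGCoalgebra.Xhat_diff_fst, retractLin_fst, retractLin_fst, retractLin_snd,
      DGCoalgebra.Xhat2_diff_fst, DGCoalgebra.Xhat2_diff_snd_fst, hN, map_sub ((bar k A).d _),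
      map_add ((bar k A).d _), hd, map_add]
    abel
  · rw [DGCoalgebra.Xhat_diff_snd, retractLin_fst, retractLin_snd, retractLin_snd,
      DGCoalgebra.Xhat2_diff_snd_fst, DGCoalgebra.Xhat2_diff_snd_snd, hN, map_sub ((bar k A).δ₁),
      map_add ((bar k A).δ₁), DGCoalgebra.δ₁_δ₁, zero_add, ← b₀_d_nabla w.2.1.2]
    -- After `δ² = 0` and `b d ∇ = 2 d` the argument of `θ` is the second component of `∂ R w`. It
    -- lies in `Ω¹BA_♮`, where `θ` is the identity.
    have h : (bar k A).b₀ (w.1 + (bar k A).d _ (nabla k A w.2.1))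
        - (bar k A).δ₁ (θ k A (w.2.2 - (bar k A).δ₁ (nabla k A w.2.1))) ∈ (bar k A).Ω₁nat :=
      Submodule.sub_mem _ ((bar k A).b₀_mem_Ω₁nat _) ((bar k A).δ_mem_Ω₁nat hm)
    refine Eq.trans (congrArg (θ k A) ?_) (θ_of_mem h)
    rw [map_add (bar k A).b₀]
    abel

variable (k A) in
/-- The retraction `R : X̂²(BA) → X̂(BA)`. -/
def retract : SuperComplex.Hom (bar k A).Xhat2 (bar k A).Xhat where
  toLin := retractLin k A
  map_γ := retractLin_γ
  map_diff := retractLin_diff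

theorem retract_incl (w : TensorAlgebra k A × (bar k A).Ω₁nat) :
    (retract k A).toLin ((bar k A).incl.toLin w) = w := by
  have h1 : (((bar k A).incl.toLin w).2.1 : TensorAlgebra k A ⊗[k]
      (TensorAlgebra k A ⊗[k] TensorAlgebra k A)) = 0 := rfl
  have h2 : nabla k A ((bar k A).incl.toLin w).2.1 = 0 :=
    (congrArg (nabla k A) h1).trans (map_zero (nabla k A))
  have h3 : (((bar k A).incl.toLin w).2.2 : TensorAlgebra k A ⊗[k] TensorAlgebra k A) = w.2 := rfl
  have h4 : ((bar k A).incl.toLin w).1 = w.1 := rfl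
  have h5 := retractLin_fst ((bar k A).incl.toLin w)
  have h6 := retractLin_snd ((bar k A).incl.toLin w)
  rw [h2, map_zero ((bar k A).d _), add_zero, h4] at h5
  rw [h2, map_zero (bar k A).δ₁, sub_zero, h3, θ_of_mem w.2.2] at h6
  exact Prod.ext h5 (Subtype.ext h6)

end Retract

end XComplex

end

theorem theorem6 {k C D A : Type*} [Field k] [NeZero (2 : k)]
    [AddCommGroup C] [Module k C] [AddCommGroup D] [Module k D]
    [NonUnitalRing A] [Module k A] [IsScalarTower k A A] [SMulCommClass k A A]
    (X : XComplex.DGCoalgebra k C) (Y : XComplex.DGCoalgebra k D) :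
    -- the Künneth map `p`
    ∃ p : XComplex.SuperComplex.Hom (X.Xhat.tensor Y.Xhat) (X.tensor Y).Xhat2,
      (∀ u v, (p.toLin (u ⊗ₜ v)).1 = u.1 ⊗ₜ[k] v.1 ∧
        ((p.toLin (u ⊗ₜ v)).2.1 : (C ⊗[k] D) ⊗[k] ((C ⊗[k] D) ⊗[k] (C ⊗[k] D)))
          = XComplex.kunneth₁₁ X Y ((u.2 : C ⊗[k] C) ⊗ₜ (v.2 : D ⊗[k] D)) ∧
        ((p.toLin (u ⊗ₜ v)).2.2 : (C ⊗[k] D) ⊗[k] (C ⊗[k] D))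
          = XComplex.kunneth₁₀ X Y ((u.2 : C ⊗[k] C) ⊗ₜ v.1)
            + XComplex.kunneth₀₁ X Y (u.1 ⊗ₜ (v.2 : D ⊗[k] D))) ∧
    -- the retraction `R`
    ∃ R : XComplex.SuperComplex.Hom (XComplex.bar k A).Xhat2 (XComplex.bar k A).Xhat,
      (∀ w, (R.toLin w).1 = w.1 + (XComplex.bar k A).d _ (XComplex.nabla k A w.2.1) ∧
        ((R.toLin w).2 : TensorAlgebra k A ⊗[k] TensorAlgebra k A)
          = XComplex.θ k A (w.2.2 - (XComplex.bar k A).δ₁ (XComplex.nabla k A w.2.1))) ∧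
      (∀ w, R.toLin ((XComplex.bar k A).incl.toLin w) = w) ∧
    -- the map induced by `f`, and the composition
    ∀ f : XComplex.DGCoalgebra.Hom (X.tensor Y) (XComplex.bar k A),
      ∃ F : XComplex.SuperComplex.Hom (X.tensor Y).Xhat2 (XComplex.bar k A).Xhat2,
        (∀ w, (F.toLin w).1 = f.toLin w.1 ∧
          ((F.toLin w).2.1 : TensorAlgebra k A ⊗[k] (TensorAlgebra k A ⊗[k] TensorAlgebra k A))
            = TensorProduct.map f.toLin (TensorProduct.map f.toLin f.toLin) w.2.1 ∧
          ((F.toLin w).2.2 : TensorAlgebra k A ⊗[k] TensorAlgebra k A)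
            = TensorProduct.map f.toLin f.toLin w.2.2) ∧
        ∃ Φ : XComplex.SuperComplex.Hom (X.Xhat.tensor Y.Xhat) (XComplex.bar k A).Xhat,
          ∀ t, Φ.toLin t = R.toLin (F.toLin (p.toLin t)) := by
  -- The maps were built from the prescribed formulas, so these hold by definition.
  exact ⟨XComplex.DGCoalgebra.kunneth X Y, fun _ _ => ⟨rfl, rfl, rfl⟩, XComplex.retract k A,
    ⟨fun _ => ⟨rfl, rfl⟩, XComplex.retract_incl, fun f => ⟨f.Xhat2, fun _ => ⟨rfl, rfl, rfl⟩,
      ((XComplex.retract k A).comp f.Xhat2).comp (XComplex.DGCoalgebra.kunneth X Y),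
      fun _ => rfl⟩⟩⟩
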